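/- Let $r\ge 1$ be a fixed integer. Consider the decision problem Robust Low Boolean-Rank Approximation with rank bound $r$: given a binary $m\times n$ matrix $\mathbf A$ and integers $B,\ell\ge 0$, decide whether there are binary $m\times n$ matrices $\mathbf M$ and $\mathbf C$ such that $\mathbf M$ has Boolean rank at most $r$, at most $\ell$ columns of $\mathbf C$ are non-zero, and $\|\mathbf A-\mathbf M-\mathbf C\|_0\le B$. Here $\|\cdot\|_0$ is the number of non-zero entries, and the Boolean rank of $\mathbf M$ is the least $s$ such that $\mathbf M$ is the product of a binary $m\times s$ matrix and a binary $s\times n$ matrix over the Boolean semiring $(\{0,1\},\vee,\wedge)$. This problem is fixed-parameter tractable parameterized by $B$: for every fixed $r\ge 1$ there are a computable function $f$ and a constant $c$, and an algorithm (a program of a random access machine with unit-cost addition and subtraction) that decides every instance $I=(\mathbf A,B,\ell)$ in at most $f(B)\cdot|I|^{c}$ steps, where $|I|$ is the number of bits of the instance (the entries of $\mathbf A$ are written out and $m,n,B,\ell$ are written in binary). -/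

import Mathlib

/-! ## Random access machines with a step count -/

namespace RAM

/-- A configuration of the machine: registers `reg 0, reg 1, …`, and memory banks
`mem 0, mem 1, …`, each of which is an array of natural numbers. -/
structure Config where
  reg : ℕ → ℕ
  mem : ℕ → ℕ → ℕ

/-- The elementary instructions. Register and bank numbers are constants of the program;
memory cells are addressed indirectly, through the content of a register.
There is no multiplication, so that unit cost per instruction is a realistic measure:
in one step the largest stored number at most doubles (up to constants of the program). -/
inductive Instr where
  /-- `reg i := c` -/
  | const (i c : ℕ)
  /-- `reg i := reg j` -/
  | copy (i j : ℕ)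
  /-- `reg i := reg j + reg k` -/
  | add (i j k : ℕ)
  /-- `reg i := max (reg j - reg k) 0` -/
  | sub (i j k : ℕ)
  /-- `reg i := mem b [reg j]` -/
  | load (i b j : ℕ)
  /-- `mem b [reg i] := reg j` -/
  | store (b i j : ℕ)

/-- The effect of an elementary instruction. -/
def Instr.exec : Instr → Config → Config
  | .const i c, s => { s with reg := Function.update s.reg i c }
  | .copy i j, s => { s with reg := Function.update s.reg i (s.reg j) }
  | .add i j k, s => { s with reg := Function.update s.reg i (s.reg j + s.reg k) }
  | .sub i j k, s => { s with reg := Function.update s.reg i (s.reg j - s.reg k) }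
  | .load i b j, s => { s with reg := Function.update s.reg i (s.mem b (s.reg j)) }
  | .store b i j, s =>
      { s with mem := Function.update s.mem b (Function.update (s.mem b) (s.reg i) (s.reg j)) }

/-- Programs: finite texts built from elementary instructions by composition, case distinction
on whether a register is nonzero, and iteration as long as a register is nonzero. -/
inductive Program where
  | instr (a : Instr)
  | seq (p q : Program)
  | branch (i : ℕ) (p q : Program)
  | loop (i : ℕ) (p : Program)

/-- `Runs p s t s'`: started in the configuration `s`, the program `p` halts in the
configuration `s'` after exactly `t` steps. Every elementary instruction and every test of a
register is one step. -/
inductive Runs : Program → Config → ℕ → Config → Prop where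
  | instr (a : Instr) (s : Config) : Runs (.instr a) s 1 (a.exec s)
  | seq {p q : Program} {s s' s'' : Config} {t t' : ℕ} :
      Runs p s t s' → Runs q s' t' s'' → Runs (.seq p q) s (t + t') s''
  | branch_nonzero {i : ℕ} {p q : Program} {s s' : Config} {t : ℕ} :
      s.reg i ≠ 0 → Runs p s t s' → Runs (.branch i p q) s (t + 1) s'
  | branch_zero {i : ℕ} {p q : Program} {s s' : Config} {t : ℕ} :
      s.reg i = 0 → Runs q s t s' → Runs (.branch i p q) s (t + 1) s'
  | loop_nonzero {i : ℕ} {p : Program} {s s' s'' : Config} {t t' : ℕ} :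
      s.reg i ≠ 0 → Runs p s t s' → Runs (.loop i p) s' t' s'' →
      Runs (.loop i p) s (t + t' + 1) s''
  | loop_zero {i : ℕ} {p : Program} {s : Config} :
      s.reg i = 0 → Runs (.loop i p) s 1 s

/-- The initial configuration for a finite sequence of numbers as input: the sequence is in
bank `0`, its number of terms is in register `0`, and everything else is `0`. -/
def initial (w : List ℕ) : Config where
  reg i := if i = 0 then w.length else 0
  mem b j := if b = 0 then w.getD j 0 else 0

/-- The length of an input: the number of bits that it takes to write down the sequence, with one
separator for every term. -/
def inputSize (w : List ℕ) : ℕ := (w.map fun x => x.size + 1).sum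

end RAM

/-- A decision problem, with set of instances `ι`, set of yes-instances `L`, and instances
presented to the machine through the encoding `enc`, is *fixed-parameter tractable* with respect
to the parameter `κ`, if a random access machine decides it in time `f (κ x) * |x| ^ c`
for a computable function `f` and a constant `c`. The machine accepts by halting with a nonzero
number in register `0`, and rejects by halting with `0` there. -/
def FixedParameterTractable {ι : Type} (enc : ι → List ℕ) (κ : ι → ℕ) (L : Set ι) : Prop :=
  ∃ (p : RAM.Program) (f : ℕ → ℕ) (c : ℕ), Computable f ∧
    ∀ x : ι, ∃ (t : ℕ) (s : RAM.Config),
      RAM.Runs p (RAM.initial (enc x)) t s ∧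
      t ≤ f (κ x) * RAM.inputSize (enc x) ^ c ∧
      (s.reg 0 ≠ 0 ↔ x ∈ L)

/-! ## Boolean matrices -/

/-- The product of matrices over the Boolean semiring: `∧` is the multiplication and
`∨` the sum. -/
def boolMul {m r n : ℕ} (U : Matrix (Fin m) (Fin r) Bool) (V : Matrix (Fin r) (Fin n) Bool) :
    Matrix (Fin m) (Fin n) Bool :=
  fun i j => decide (∃ k, (U i k && V k j) = true)

/-- The Boolean rank: the least `r` such that the matrix is a Boolean product of an `m × r` and an
`r × n` matrix. -/
noncomputable def boolRank {m n : ℕ} (A : Matrix (Fin m) (Fin n) Bool) : ℕ :=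
  sInf {r | ∃ (U : Matrix (Fin m) (Fin r) Bool) (V : Matrix (Fin r) (Fin n) Bool),
    A = boolMul U V}

/-- A binary matrix as a matrix of the integers `0` and `1`. -/
def binToInt {m n : ℕ} (A : Matrix (Fin m) (Fin n) Bool) : Matrix (Fin m) (Fin n) ℤ :=
  A.map fun b => if b then 1 else 0

/-- The `ℓ₀`-norm of a matrix: the number of nonzero entries. -/
def l0norm {m n : ℕ} (M : Matrix (Fin m) (Fin n) ℤ) : ℕ :=
  (Finset.univ.filter fun e : Fin m × Fin n => M e.1 e.2 ≠ 0).card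

/-- The number of nonzero columns of a matrix. -/
def nonzeroColumns {m n : ℕ} (M : Matrix (Fin m) (Fin n) ℤ) : ℕ :=
  (Finset.univ.filter fun j : Fin n => ∃ i, M i j ≠ 0).card

/-! ## Robust low Boolean-rank approximation -/

/-- An instance of the problem for a fixed rank bound: a binary `m × n` matrix, the budget `B` and
the bound `ℓ` on the number of outliers. -/
structure BoolApproxInstance where
  m : ℕ
  n : ℕ
  A : Matrix (Fin m) (Fin n) Bool
  B : ℕ
  ℓ : ℕ

/-- The instance as a sequence of numbers: `m, n, B, ℓ`, and then the entries of the matrix,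
row by row. -/
def BoolApproxInstance.encode (x : BoolApproxInstance) : List ℕ :=
  [x.m, x.n, x.B, x.ℓ] ++
    (List.ofFn fun i => List.ofFn fun j => if x.A i j then 1 else 0).flatten

/-- The yes-instances of Robust Low Boolean-Rank Approximation with rank bound `r`. -/
def robustLowBoolRankApprox (r : ℕ) : Set BoolApproxInstance :=
  {x | ∃ M C : Matrix (Fin x.m) (Fin x.n) Bool,
    boolRank M ≤ r ∧
    nonzeroColumns (binToInt C) ≤ x.ℓ ∧
    l0norm (binToInt x.A - binToInt M - binToInt C) ≤ x.B}

/-! Put `K = 2 ^ r`. A matrix has Boolean rank at most `r` exactly if its rows can be labelled by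
subsets of an `r`-element set so that every column is one of `K` centers: the center `s`, again a
subset, has the entry `1` in a row exactly if it meets the label of that row (`boolRank_le_iff`).
Outlier columns cost nothing. Hence the problem asks for row letters whose `K` centers cover at
least `n - ℓ` columns within total distance `B` (`mem_robustLowBoolRankApprox_iff`).

For every nonempty cluster, one of its own columns `a s` serves as an approximate center. A row
deviates if no letter produces the entries of the columns `a s` in it, or if the true letter is
strictly cheaper there than these entries. Every deviating row contributes to the cost, so there are
at most `B` of them; in all other rows the entries of the columns `a s` can replace the true
centers. Columns, deviating rows and their letters thus form a certificate that is sound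
(`Accept.solvable`) and exists for every solvable instance (`Solvable.certificate`).

Naming the deviating rows directly would cost `m ^ B` guesses. Rows without a fitting letter are
recognizable and at most `B` in number. In any other deviating row, at least half of the columns of
some cluster `s` differ from `a s` (`exists_majority_fiber`). Consider the columns within distance
`B` of `a s` that differ from it in a prescribed set of earlier deviating rows. Each of them differs
from `a s` in at most `B` rows, so at most `B * 2 ^ e` rows separate a fraction of at least `2 ^
(-e)` of them from `a s` (`count_candidate_le`); a row among these is named by a number below `B * 2
^ e`. When the set is the trace of a suitable column of the cluster, `e - 1` is the drop of a
logarithmic potential of that column, whose total drop is at most `log n` (`sum_drop_le`). Averaging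
over the majority (`exists_candidate`) bounds the sum of all `e` by `B + 2 K log n`.

In a mixed radix system all certificates therefore have codes below a function of `B` times a
polynomial in the length of the input (`codeBound_le`); the factor `(log n + 2) ^ B` is absorbed by
`pow_log_le`. The machine decodes and tests every number below this bound (`eval_search`). It is
written in a small language in which every loop runs exactly up to a limit, so that each program
takes time polynomial in the limit by structural induction. -/

namespace RAM

/-! ### Bounded expressions: semantics, compilation and running time -/

/-- Expressions over natural-number variables and memory banks. The only iteration is over the
numbers below a limit that is fixed during the evaluation. -/
inductive Ex where
  | const (c : ℕ)
  | var (i : ℕ)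
  | add (a b : Ex)
  | sub (a b : Ex)
  | mul (a b : Ex)
  | div (a b : Ex)
  | load (b : ℕ) (a : Ex)
  | ite (c a b : Ex)
  | sum (i : ℕ) (a : Ex)

/-- The value of an expression with limit `X`. Products and quotients are truncated at the
limit. -/
def Ex.eval (X : ℕ) (mem : ℕ → ℕ → ℕ) : Ex → (ℕ → ℕ) → ℕ
  | .const c, _ => c
  | .var i, v => v i
  | .add a b, v => a.eval X mem v + b.eval X mem v
  | .sub a b, v => a.eval X mem v - b.eval X mem v
  | .mul a b, v => min (a.eval X mem v) X * b.eval X mem v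
  | .div a b, v => if b.eval X mem v = 0 then X else min X (a.eval X mem v / b.eval X mem v)
  | .load k a, v => mem k (a.eval X mem v)
  | .ite c a b, v => if c.eval X mem v ≠ 0 then a.eval X mem v else b.eval X mem v
  | .sum i a, v => ∑ t ∈ Finset.range X, a.eval X mem (Function.update v i t)

/-- A strict bound on the variables of an expression. -/
def Ex.bd : Ex → ℕ
  | .const _ => 0
  | .var i => i + 1
  | .add a b => max a.bd b.bd
  | .sub a b => max a.bd b.bd
  | .mul a b => max a.bd b.bd
  | .div a b => max a.bd b.bd
  | .load _ a => a.bd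
  | .ite c a b => max c.bd (max a.bd b.bd)
  | .sum i a => max (i + 1) a.bd

/-- The program for an expression: variable `i` lives in register `i + 1`, the limit in
register `0`, and the result and the intermediate results in the registers from `d` on. -/
def Ex.compile : Ex → ℕ → Program
  | .const c, d => .instr (.const d c)
  | .var i, d => .instr (.copy d (i + 1))
  | .add a b, d => .seq (a.compile d) (.seq (b.compile (d + 1)) (.instr (.add d d (d + 1))))
  | .sub a b, d => .seq (a.compile d) (.seq (b.compile (d + 1)) (.instr (.sub d d (d + 1))))
  | .mul a b, d => .seq (a.compile d) (.seq (b.compile (d + 1))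
      (.seq (.instr (.const (d + 2) 0)) (.seq (.instr (.copy (d + 3) 0))
      (.seq (.instr (.const (d + 4) 1)) (.seq
        (.loop (d + 3) (.seq
          (.branch d
            (.seq (.instr (.add (d + 2) (d + 2) (d + 1))) (.instr (.sub d d (d + 4))))
            (.instr (.const (d + 4) 1)))
          (.instr (.sub (d + 3) (d + 3) (d + 4)))))
        (.instr (.copy d (d + 2))))))))
  | .div a b, d => .seq (a.compile d) (.seq (b.compile (d + 1))
      (.seq (.instr (.const (d + 2) 0)) (.seq (.instr (.copy (d + 3) 0))
      (.seq (.instr (.const (d + 4) 1)) (.seq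
        (.loop (d + 3) (.seq (.instr (.sub (d + 5) (d + 1) d)) (.seq
          (.branch (d + 5) (.instr (.const (d + 4) 1))
            (.seq (.instr (.add (d + 2) (d + 2) (d + 4))) (.instr (.sub d d (d + 1)))))
          (.instr (.sub (d + 3) (d + 3) (d + 4))))))
        (.instr (.copy d (d + 2))))))))
  | .load k a, d => .seq (a.compile d) (.instr (.load d k d))
  | .ite c a b, d => .seq (c.compile d) (.branch d (a.compile d) (b.compile d))
  | .sum i a, d => .seq (.instr (.copy d (i + 1))) (.seq (.instr (.const (d + 1) 0))
      (.seq (.instr (.copy (d + 2) 0)) (.seq (.instr (.const (i + 1) 0)) (.seq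
        (.loop (d + 2) (.seq (a.compile (d + 3)) (.seq (.instr (.add (d + 1) (d + 1) (d + 3)))
          (.seq (.instr (.const (d + 3) 1)) (.seq (.instr (.add (i + 1) (i + 1) (d + 3)))
          (.instr (.sub (d + 2) (d + 2) (d + 3))))))))
        (.seq (.instr (.copy (i + 1) d)) (.instr (.copy d (d + 1))))))))

/-- A bound on the number of steps of the program for an expression. -/
def Ex.cost : Ex → ℕ → ℕ
  | .const _, _ => 1
  | .var _, _ => 1
  | .add a b, X => a.cost X + b.cost X + 1
  | .sub a b, X => a.cost X + b.cost X + 1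
  | .mul a b, X => a.cost X + b.cost X + 5 + X * 5
  | .div a b, X => a.cost X + b.cost X + 5 + X * 6
  | .load _ a, X => a.cost X + 1
  | .ite c a b, X => c.cost X + a.cost X + b.cost X + 1
  | .sum _ a, X => X * (a.cost X + 4 + 1) + 7

/-- `Halts p s T Q`: started in `s`, the program `p` halts after at most `T` steps in a
configuration with the property `Q`. -/
def Halts (p : Program) (s : Config) (T : ℕ) (Q : Config → Prop) : Prop :=
  ∃ t s', Runs p s t s' ∧ t ≤ T ∧ Q s'

theorem Halts.mono {p : Program} {s : Config} {T T' : ℕ} {Q Q' : Config → Prop}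
    (h : Halts p s T Q) (hT : T ≤ T') (hQ : ∀ s', Q s' → Q' s') : Halts p s T' Q' := by
  obtain ⟨t, s', h1, h2, h3⟩ := h
  exact ⟨t, s', h1, h2.trans hT, hQ _ h3⟩

theorem Halts.instr {a : Instr} {s : Config} {Q : Config → Prop} (h : Q (a.exec s)) :
    Halts (.instr a) s 1 Q := ⟨1, _, .instr a s, le_rfl, h⟩

theorem Halts.seq {p q : Program} {s : Config} {T T' : ℕ} {R Q : Config → Prop}
    (h : Halts p s T R) (h' : ∀ s', R s' → Halts q s' T' Q) :
    Halts (.seq p q) s (T + T') Q := by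
  obtain ⟨t, s', h1, h2, h3⟩ := h
  obtain ⟨t', s'', h1', h2', h3'⟩ := h' _ h3
  exact ⟨t + t', s'', .seq h1 h1', by omega, h3'⟩

theorem Halts.instr_seq {a : Instr} {q : Program} {s : Config} {T : ℕ} {Q : Config → Prop}
    (h : Halts q (a.exec s) T Q) : Halts (.seq (.instr a) q) s (T + 1) Q := by
  obtain ⟨t, s', h1, h2, h3⟩ := h
  exact ⟨1 + t, s', .seq (.instr a s) h1, by omega, h3⟩

theorem Halts.branch {p q : Program} {i : ℕ} {s : Config} {T : ℕ} {Q : Config → Prop}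
    (h : s.reg i ≠ 0 → Halts p s T Q) (h' : s.reg i = 0 → Halts q s T Q) :
    Halts (.branch i p q) s (T + 1) Q := by
  by_cases hi : s.reg i = 0
  · obtain ⟨t, s', h1, h2, h3⟩ := h' hi
    exact ⟨t + 1, s', .branch_zero hi h1, by omega, h3⟩
  · obtain ⟨t, s', h1, h2, h3⟩ := h hi
    exact ⟨t + 1, s', .branch_nonzero hi h1, by omega, h3⟩

/-- A loop with a counter that is decremented in every pass. -/
theorem Halts.loop {p : Program} {c X T : ℕ} {I : ℕ → Config → Prop}
    (hc : ∀ j s, I j s → s.reg c = X - j)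
    (hp : ∀ j s, j < X → I j s → Halts p s T (I (j + 1))) {s : Config} (h0 : I 0 s) :
    Halts (.loop c p) s (X * (T + 1) + 1) (I X) := by
  suffices H : ∀ k j s, j + k = X → I j s → Halts (.loop c p) s (k * (T + 1) + 1) (I X) from
    H X 0 s (by omega) h0
  intro k
  induction k with
  | zero =>
    intro j s hj hI
    have := hc j s hI
    obtain rfl : j = X := by omega
    exact ⟨1, s, .loop_zero (by omega), by omega, hI⟩
  | succ k ih =>
    intro j s hj hI
    have hr := hc j s hI
    obtain ⟨t, s', h1, h2, h3⟩ := hp j s (by omega) hI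
    obtain ⟨t', s'', h1', h2', h3'⟩ := ih (j + 1) s' (by omega) h3
    exact ⟨t + t' + 1, s'', .loop_nonzero (by omega) h1 h1', by rw [Nat.succ_mul]; omega, h3'⟩

/-- The postcondition of the program for an expression. -/
def Ex.Post (d : ℕ) (val : ℕ) (s s' : Config) : Prop :=
  s'.reg d = val ∧ (∀ i < d, s'.reg i = s.reg i) ∧ s'.mem = s.mem

theorem div_step_lt {x b q : ℕ} (hb : 0 < b) (h : b ≤ x - q * b) : q + 1 ≤ x / b := by
  rw [Nat.le_div_iff_mul_le hb, Nat.succ_mul]; omega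

theorem div_step_ge {x b q : ℕ} (hb : 0 < b) (h : x - q * b < b) : x / b ≤ q := by
  have : x / b < q + 1 := by rw [Nat.div_lt_iff_lt_mul hb, Nat.succ_mul]; omega
  omega

/-- Everything below register `d` survives, so a second operand can be computed from `d + 1` on
without destroying the first one. A sum overwrites the register of its own index variable and
restores it at the end. -/
theorem Ex.halts (X : ℕ) (e : Ex) : ∀ (d : ℕ) (s : Config) (v : ℕ → ℕ), e.bd < d → s.reg 0 = X →
    (∀ i < e.bd, s.reg (i + 1) = v i) →
    Halts (e.compile d) s (e.cost X) (Ex.Post d (e.eval X s.mem v) s) := by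
  induction e with
  | const c =>
    intro d s v hd h0 hv
    exact .instr ⟨by simp [Instr.exec, Ex.eval], fun i hi => by
      simp [Instr.exec, hi.ne], rfl⟩
  | var j =>
    intro d s v hd h0 hv
    exact .instr ⟨by simp [Instr.exec, Ex.eval, hv j (by simp [Ex.bd])], fun i hi => by
      simp [Instr.exec, hi.ne], rfl⟩
  | add a b iha ihb =>
    intro d s v hd h0 hv
    simp only [Ex.bd, max_lt_iff, lt_max_iff] at hd hv
    refine (Halts.seq (iha d s v hd.1 h0 fun i hi => hv i (.inl hi)) fun s1 ⟨h1, h2, h3⟩ =>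
      Halts.seq (ihb (d + 1) s1 v (by omega) (by rw [h2 0 (by omega), h0]) fun i hi => by
        rw [h2 _ (by omega), hv i (.inr hi)]) fun s2 ⟨g1, g2, g3⟩ =>
        (.instr ?_)).mono (T := a.cost X + (b.cost X + 1)) (by simp only [Ex.cost]; omega)
          fun _ h => h
    refine ⟨?_, fun i hi => ?_, by simp [Instr.exec, g3, h3]⟩
    · simp [Instr.exec, g1, g2 d (by omega), h1, Ex.eval, h3]
    · simp [Instr.exec, hi.ne, g2 i (by omega), h2 i hi]
  | sub a b iha ihb =>
    intro d s v hd h0 hv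
    simp only [Ex.bd, max_lt_iff, lt_max_iff] at hd hv
    refine (Halts.seq (iha d s v hd.1 h0 fun i hi => hv i (.inl hi)) fun s1 ⟨h1, h2, h3⟩ =>
      Halts.seq (ihb (d + 1) s1 v (by omega) (by rw [h2 0 (by omega), h0]) fun i hi => by
        rw [h2 _ (by omega), hv i (.inr hi)]) fun s2 ⟨g1, g2, g3⟩ =>
        (.instr ?_)).mono (T := a.cost X + (b.cost X + 1)) (by simp only [Ex.cost]; omega)
          fun _ h => h
    refine ⟨?_, fun i hi => ?_, by simp [Instr.exec, g3, h3]⟩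
    · simp [Instr.exec, g1, g2 d (by omega), h1, Ex.eval, h3]
    · simp [Instr.exec, hi.ne, g2 i (by omega), h2 i hi]
  | mul a b iha ihb =>
    intro d s v hd h0 hv
    simp only [Ex.bd, max_lt_iff, lt_max_iff] at hd hv
    -- The loop always makes `X` passes. Pass `j` adds `y` only while the first factor is not
    -- exhausted, which gives `min x j * y` and hence the truncation at `X`.
    set x := a.eval X s.mem v with hx
    set y := b.eval X s.mem v with hy
    refine (Halts.seq (iha d s v hd.1 h0 fun i hi => hv i (.inl hi)) fun s1 ⟨h1, h2, h3⟩ =>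
      Halts.seq (ihb (d + 1) s1 v (by omega) (by rw [h2 0 (by omega), h0]) fun i hi => by
        rw [h2 _ (by omega), hv i (.inr hi)]) fun s2 ⟨g1, g2, g3⟩ =>
        .instr_seq (.instr_seq (.instr_seq (.seq (R := ?_) ?_ ?_)))).mono
        (T := a.cost X + (b.cost X + (X * (4 + 1) + 1 + 1 + 1 + 1 + 1)))
        (by simp only [Ex.cost]; omega) fun _ h => h
    · exact fun t => t.reg (d + 2) = min x X * y ∧ (∀ i < d, t.reg i = s.reg i) ∧ t.mem = s.mem
    · refine (Halts.loop (X := X) (I := fun j t => t.reg d = x - j ∧ t.reg (d + 1) = y ∧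
        t.reg (d + 2) = min x j * y ∧ t.reg (d + 3) = X - j ∧ t.reg (d + 4) = 1 ∧
        (∀ i < d, t.reg i = s.reg i) ∧ t.mem = s.mem) (fun _ _ h => h.2.2.2.1) ?_ ?_).mono
        le_rfl ?_
      · rintro j t hj ⟨e0, e1, e2, e3, e4, e5, e6⟩
        refine (Halts.seq (T := 3) (T' := 1) (R := fun t => t.reg d = x - (j + 1) ∧
          t.reg (d + 1) = y ∧ t.reg (d + 2) = min x (j + 1) * y ∧ t.reg (d + 3) = X - j ∧
          t.reg (d + 4) = 1 ∧ (∀ i < d, t.reg i = s.reg i) ∧ t.mem = s.mem)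
          (.branch (T := 2) (fun hne => ?_) fun hz => ?_) ?_)
        · refine .instr_seq (.instr ?_)
          have : min x (j + 1) = min x j + 1 := by omega
          simp only [Instr.exec, Function.update_apply]
          simp only [e0, e1, e2, e3, e4, e6, this]
          simp
          refine ⟨by omega, by ring, fun i hi => ?_⟩
          simp [hi.ne, show i ≠ d + 2 by omega, e5 i hi]
        · refine (Halts.instr ?_).mono (T := 1) (by omega) fun _ h => h
          have : min x (j + 1) = min x j := by omega
          simp only [Instr.exec, Function.update_apply]
          simp only [e0, e1, e2, e3, e4, e6, this]
          simp
          exact ⟨by omega, fun i hi => by simp [show i ≠ d + 4 by omega, e5 i hi]⟩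
        · rintro t ⟨e0, e1, e2, e3, e4, e5, e6⟩
          refine .instr ?_
          simp only [Instr.exec, Function.update_apply]
          simp only [e0, e1, e2, e3, e4, e6]
          simp
          exact ⟨by omega, fun i hi => by simp [show i ≠ d + 3 by omega, e5 i hi]⟩
      · simp only [Instr.exec, Function.update_apply]
        simp only [g1, g2 d (by omega), h1, h3, g3, ← hx, ← hy, g2 0 (by omega),
          h2 0 (by omega), h0]
        simp
        intro i hi
        simp [show i ≠ d + 2 by omega, show i ≠ d + 3 by omega, show i ≠ d + 4 by omega,
          g2 i (by omega), h2 i hi]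
      · rintro t ⟨e0, e1, e2, e3, e4, e5, e6⟩
        exact ⟨e2, e5, e6⟩
    · rintro t ⟨e1, e2, e3⟩
      exact .instr ⟨by simp [Instr.exec, e1, Ex.eval, ← hx, ← hy], fun i hi => by
        simp [Instr.exec, hi.ne, e2 i hi], by simp [Instr.exec, e3]⟩
  | div a b iha ihb =>
    intro d s v hd h0 hv
    simp only [Ex.bd, max_lt_iff, lt_max_iff] at hd hv
    set x := a.eval X s.mem v with hx
    set y := b.eval X s.mem v with hy
    -- The quotient after `j` subtractive passes. For `y = 0` the test never stops the subtraction,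
    -- so every pass counts; this is why division by zero has the value `X`.
    set q : ℕ → ℕ := fun j => if y = 0 then j else min j (x / y) with hq
    refine (Halts.seq (iha d s v hd.1 h0 fun i hi => hv i (.inl hi)) fun s1 ⟨h1, h2, h3⟩ =>
      Halts.seq (ihb (d + 1) s1 v (by omega) (by rw [h2 0 (by omega), h0]) fun i hi => by
        rw [h2 _ (by omega), hv i (.inr hi)]) fun s2 ⟨g1, g2, g3⟩ =>
        .instr_seq (.instr_seq (.instr_seq (.seq (R := ?_) ?_ ?_)))).mono
        (T := a.cost X + (b.cost X + (X * (5 + 1) + 1 + 1 + 1 + 1 + 1)))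
        (by simp only [Ex.cost]; omega) fun _ h => h
    · exact fun t => t.reg (d + 2) = q X ∧ (∀ i < d, t.reg i = s.reg i) ∧ t.mem = s.mem
    · refine (Halts.loop (X := X) (I := fun j t => t.reg d = x - q j * y ∧ t.reg (d + 1) = y ∧
        t.reg (d + 2) = q j ∧ t.reg (d + 3) = X - j ∧ t.reg (d + 4) = 1 ∧
        (∀ i < d, t.reg i = s.reg i) ∧ t.mem = s.mem) (fun _ _ h => h.2.2.2.1) ?_ ?_).mono
        le_rfl ?_
      · rintro j t hj ⟨e0, e1, e2, e3, e4, e5, e6⟩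
        refine Halts.instr_seq (T := 4) (Halts.seq (T := 3) (T' := 1) (R := fun t =>
          t.reg d = x - q (j + 1) * y ∧
          t.reg (d + 1) = y ∧ t.reg (d + 2) = q (j + 1) ∧ t.reg (d + 3) = X - j ∧
          t.reg (d + 4) = 1 ∧ (∀ i < d, t.reg i = s.reg i) ∧ t.mem = s.mem)
          (.branch (T := 2) (fun hne => ?_) fun hz => ?_) ?_)
        · refine (Halts.instr ?_).mono (T := 1) (by omega) fun _ h => h
          simp [Instr.exec, e0, e1] at hne
          have : q (j + 1) = q j := by
            have hy0 : 0 < y := by omega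
            have := div_step_ge (x := x) (q := q j) hy0 (by omega)
            simp only [hq, hy0.ne', if_false] at this ⊢
            omega
          simp only [Instr.exec, Function.update_apply]
          simp only [e0, e1, e2, e3, e4, e6, this]
          simp
          exact fun i hi => by simp [show i ≠ d + 4 by omega, show i ≠ d + 5 by omega, e5 i hi]
        · refine .instr_seq (.instr ?_)
          simp [Instr.exec, e0, e1] at hz
          have : q (j + 1) = q j + 1 := by
            rcases Nat.eq_zero_or_pos y with hy0 | hy0
            · simp [hq, hy0]
            · have := div_step_lt (x := x) (q := q j) hy0 (by omega)
              simp only [hq, hy0.ne', if_false] at this ⊢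
              omega
          simp only [Instr.exec, Function.update_apply]
          simp only [e0, e1, e2, e3, e4, e6, this]
          simp
          refine ⟨by rw [Nat.succ_mul]; omega, fun i hi => ?_⟩
          simp [hi.ne, show i ≠ d + 2 by omega, show i ≠ d + 5 by omega, e5 i hi]
        · rintro t ⟨e0, e1, e2, e3, e4, e5, e6⟩
          refine .instr ?_
          simp only [Instr.exec, Function.update_apply]
          simp only [e0, e1, e2, e3, e4, e6]
          simp
          exact ⟨by omega, fun i hi => by simp [show i ≠ d + 3 by omega, e5 i hi]⟩
      · have : q 0 = 0 := by simp [hq]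
        simp only [Instr.exec, Function.update_apply]
        simp only [g1, g2 d (by omega), h1, h3, g3, ← hx, ← hy, g2 0 (by omega),
          h2 0 (by omega), h0]
        simp [this]
        intro i hi
        simp [show i ≠ d + 2 by omega, show i ≠ d + 3 by omega, show i ≠ d + 4 by omega,
          g2 i (by omega), h2 i hi]
      · rintro t ⟨e0, e1, e2, e3, e4, e5, e6⟩
        exact ⟨e2, e5, e6⟩
    · rintro t ⟨e1, e2, e3⟩
      exact .instr ⟨by simp [Instr.exec, e1, Ex.eval, ← hx, ← hy, hq], fun i hi => by
        simp [Instr.exec, hi.ne, e2 i hi], by simp [Instr.exec, e3]⟩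
  | load k a iha =>
    intro d s v hd h0 hv
    refine (Halts.seq (iha d s v hd h0 hv) fun s1 ⟨h1, h2, h3⟩ => (.instr ?_))
    refine ⟨?_, fun i hi => ?_, by simp [Instr.exec, h3]⟩
    · simp [Instr.exec, h1, Ex.eval, h3]
    · simp [Instr.exec, hi.ne, h2 i hi]
  | ite c a b ihc iha ihb =>
    intro d s v hd h0 hv
    simp only [Ex.bd, max_lt_iff, lt_max_iff] at hd hv
    refine (Halts.seq (ihc d s v hd.1 h0 fun i hi => hv i (.inl hi)) fun s1 ⟨h1, h2, h3⟩ =>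
      .branch (T := a.cost X + b.cost X) (fun hne => ?_) fun hz => ?_).mono
        (by simp only [Ex.cost]; omega) fun _ h => h
    · refine (iha d s1 v (by omega) (by rw [h2 0 (by omega), h0]) fun i hi => by
        rw [h2 _ (by omega), hv i (.inr (.inl hi))]).mono (by omega) ?_
      rintro t ⟨g1, g2, g3⟩
      exact ⟨by rw [g1, Ex.eval, if_pos (h1 ▸ hne), h3], fun i hi => by rw [g2 i hi, h2 i hi],
        by rw [g3, h3]⟩
    · refine (ihb d s1 v (by omega) (by rw [h2 0 (by omega), h0]) fun i hi => by
        rw [h2 _ (by omega), hv i (.inr (.inr hi))]).mono (by omega) ?_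
      rintro t ⟨g1, g2, g3⟩
      exact ⟨by rw [g1, Ex.eval, if_neg (by simpa [h1] using hz), h3],
        fun i hi => by rw [g2 i hi, h2 i hi], by rw [g3, h3]⟩
  | sum k a iha =>
    intro d s v hd h0 hv
    simp only [Ex.bd, max_lt_iff, lt_max_iff] at hd hv
    refine (Halts.instr_seq (.instr_seq (.instr_seq (.instr_seq (.seq (T' := 2)
      (R := fun t => t.reg d = s.reg (k + 1) ∧ t.reg (d + 1) = (Ex.sum k a).eval X s.mem v ∧
        (∀ i < d, i ≠ k + 1 → t.reg i = s.reg i) ∧ t.mem = s.mem)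
        (Halts.loop (T := a.cost X + 4) (X := X)
        (I := fun j t => t.reg d = s.reg (k + 1) ∧
        t.reg (d + 1) = ∑ t ∈ Finset.range j, a.eval X s.mem (Function.update v k t) ∧
        t.reg (d + 2) = X - j ∧ t.reg (k + 1) = j ∧
        (∀ i < d, i ≠ k + 1 → t.reg i = s.reg i) ∧ t.mem = s.mem)
        (fun _ _ h => h.2.2.1) ?_ ?_ |>.mono le_rfl ?_) ?_))))).mono
        (by simp only [Ex.cost]; omega) fun _ h => h
    · rintro j t hj ⟨e0, e1, e2, e3, e4, e5⟩
      refine (Halts.seq (iha (d + 3) t (Function.update v k j) (by omega)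
        (by rw [e4 0 (by omega) (by omega), h0]) fun i hi => ?_) (T' := 4) ?_)
      · by_cases hik : i = k
        · simp [hik, e3]
        · simp [hik, e4 (i + 1) (by omega) (by omega), hv i (.inr hi)]
      · rintro t' ⟨g1, g2, g3⟩
        refine .instr_seq (.instr_seq (.instr_seq (.instr ?_)))
        have hkd : k + 1 ≠ d := by omega
        simp only [Instr.exec, Function.update_apply]
        simp only [g1, g3, g2 d (by omega), g2 (d + 1) (by omega), g2 (d + 2) (by omega),
          g2 (k + 1) (by omega), e0, e1, e2, e3, e5]
        simp [hkd.symm, show k ≠ d by omega, show k ≠ d + 1 by omega, show k ≠ d + 2 by omega,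
          show d + 1 ≠ k by omega, show d + 2 ≠ k by omega, show d ≠ k by omega]
        refine ⟨by rw [Finset.sum_range_succ], by omega, fun i hi hik => ?_⟩
        simp [hik, show i ≠ d + 1 by omega, show i ≠ d + 2 by omega, show i ≠ d + 3 by omega,
          g2 i (by omega), e4 i hi hik]
    · have hkd : k + 1 ≠ d := by omega
      simp only [Instr.exec, Function.update_apply]
      simp [hkd.symm,
          show d + 1 ≠ k by omega, show d ≠ k by omega,
          show 0 ≠ d by omega, h0]
      intro i hi hik
      simp [hik, show i ≠ d + 1 by omega, show i ≠ d + 2 by omega, hi.ne]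
    · rintro t ⟨e0, e1, e2, e3, e4, e5⟩
      exact ⟨e0, by rw [e1, Ex.eval], e4, e5⟩
    · rintro t ⟨e0, e1, e2, e3⟩
      refine .instr_seq (.instr ?_)
      refine ⟨?_, fun i hi => ?_, by simp [Instr.exec, e3]⟩
      · simp [Instr.exec, e1, show d ≠ k by omega]
      · by_cases hik : i = k + 1
        · simp [Instr.exec, Function.update_apply, hik, show k + 1 ≠ d by omega, e0]
        · simp [Instr.exec, Function.update_apply, hik, hi.ne, e2 i hi hik]

/-- Polynomial growth. -/
def PolyBounded (g : ℕ → ℕ) : Prop := ∃ C k, ∀ X, g X ≤ C * (X + 1) ^ k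

theorem PolyBounded.const (c : ℕ) : PolyBounded fun _ => c := ⟨c, 0, fun X => by simp⟩

theorem PolyBounded.add {g h : ℕ → ℕ} (hg : PolyBounded g) (hh : PolyBounded h) :
    PolyBounded fun X => g X + h X := by
  obtain ⟨C, k, hC⟩ := hg
  obtain ⟨C', k', hC'⟩ := hh
  refine ⟨C + C', max k k', fun X => ?_⟩
  have h1 := Nat.pow_le_pow_right (n := X + 1) (by omega) (le_max_left k k')
  have h2 := Nat.pow_le_pow_right (n := X + 1) (by omega) (le_max_right k k')
  calc _ ≤ C * (X + 1) ^ k + C' * (X + 1) ^ k' := Nat.add_le_add (hC X) (hC' X)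
    _ ≤ C * (X + 1) ^ max k k' + C' * (X + 1) ^ max k k' := by gcongr
    _ = _ := by ring

theorem PolyBounded.limit_mul {g : ℕ → ℕ} (hg : PolyBounded g) :
    PolyBounded fun X => X * g X := by
  obtain ⟨C, k, hC⟩ := hg
  refine ⟨C, k + 1, fun X => ?_⟩
  calc X * g X ≤ (X + 1) * (C * (X + 1) ^ k) := Nat.mul_le_mul (by omega) (hC X)
    _ = _ := by ring

theorem Ex.cost_polyBounded (e : Ex) : PolyBounded e.cost := by
  induction e with
  | const c => exact .const 1
  | var i => exact .const 1
  | add a b iha ihb => exact (iha.add ihb).add (.const 1)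
  | sub a b iha ihb => exact (iha.add ihb).add (.const 1)
  | mul a b iha ihb => exact ((iha.add ihb).add (.const 5)).add (.limit_mul (.const 5))
  | div a b iha ihb => exact ((iha.add ihb).add (.const 5)).add (.limit_mul (.const 6))
  | load k a iha => exact iha.add (.const 1)
  | ite c a b ihc iha ihb => exact ((ihc.add iha).add ihb).add (.const 1)
  | sum i a iha => exact (.add (.limit_mul ((iha.add (.const 4)).add (.const 1))) (.const 7))

end RAM

/-! ### Statements with bounded loops: semantics, compilation and running time -/

namespace RAM

/-- Statements; the only iteration is over the numbers below the limit. -/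
inductive Stmt where
  | skip
  | assign (i : ℕ) (e : Ex)
  | store (b : ℕ) (e e' : Ex)
  | seq (p q : Stmt)
  | ite (e : Ex) (p q : Stmt)
  | loop (i : ℕ) (p : Stmt)

/-- `f` applied for the indices `0, …, k - 1` in this order. -/
def iterate {α : Type} (f : ℕ → α → α) : ℕ → α → α
  | 0, x => x
  | k + 1, x => f k (iterate f k x)

/-- Assignment of a variable. -/
def Config.setVar (σ : Config) (i x : ℕ) : Config :=
  { σ with reg := Function.update σ.reg i x }

/-- Assignment of a memory cell. -/
def Config.setMem (σ : Config) (b i x : ℕ) : Config :=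
  { σ with mem := Function.update σ.mem b (Function.update (σ.mem b) i x) }

/-- The effect of a statement with limit `X`, where the registers of the configuration are the
variables. -/
def Stmt.eval (X : ℕ) : Stmt → Config → Config
  | .skip, σ => σ
  | .assign i e, σ => σ.setVar i (e.eval X σ.mem σ.reg)
  | .store b e e', σ => σ.setMem b (e.eval X σ.mem σ.reg) (e'.eval X σ.mem σ.reg)
  | .seq p q, σ => q.eval X (p.eval X σ)
  | .ite e p q, σ => if e.eval X σ.mem σ.reg ≠ 0 then p.eval X σ else q.eval X σ
  | .loop i p, σ => iterate (fun t τ => p.eval X (τ.setVar i t)) X σ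

/-- A strict bound on the variables of a statement. -/
def Stmt.bd : Stmt → ℕ
  | .skip => 0
  | .assign i e => max (i + 1) e.bd
  | .store _ e e' => max e.bd e'.bd
  | .seq p q => max p.bd q.bd
  | .ite e p q => max e.bd (max p.bd q.bd)
  | .loop i p => max (i + 1) p.bd

/-- The program for a statement. -/
def Stmt.compile : Stmt → ℕ → Program
  | .skip, d => .instr (.const d 0)
  | .assign i e, d => .seq (e.compile d) (.instr (.copy (i + 1) d))
  | .store b e e', d => .seq (e.compile d) (.seq (e'.compile (d + 1)) (.instr (.store b d (d + 1))))
  | .seq p q, d => .seq (p.compile d) (q.compile d)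
  | .ite e p q, d => .seq (e.compile d) (.branch d (p.compile d) (q.compile d))
  | .loop i p, d => .seq (.instr (.const d 0)) (.seq (.instr (.copy (d + 1) 0))
      (.loop (d + 1) (.seq (.instr (.copy (i + 1) d)) (.seq (p.compile (d + 2))
        (.seq (.instr (.const (d + 2) 1)) (.seq (.instr (.add d d (d + 2)))
          (.instr (.sub (d + 1) (d + 1) (d + 2)))))))))

/-- A bound on the number of steps of the program for a statement. -/
def Stmt.cost : Stmt → ℕ → ℕ
  | .skip, _ => 1
  | .assign _ e, X => e.cost X + 1
  | .store _ e e', X => e.cost X + e'.cost X + 1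
  | .seq p q, X => p.cost X + q.cost X
  | .ite e p q, X => e.cost X + (p.cost X + q.cost X) + 1
  | .loop _ p, X => X * (p.cost X + 4 + 1) + 3

theorem Stmt.cost_polyBounded (p : Stmt) : PolyBounded p.cost := by
  induction p with
  | skip => exact .const 1
  | assign i e => exact e.cost_polyBounded.add (.const 1)
  | store b e e' => exact (e.cost_polyBounded.add e'.cost_polyBounded).add (.const 1)
  | seq p q ihp ihq => exact ihp.add ihq
  | ite e p q ihp ihq => exact (e.cost_polyBounded.add (ihp.add ihq)).add (.const 1)
  | loop i p ih => exact .add (.limit_mul ((ih.add (.const 4)).add (.const 1))) (.const 3)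

/-- The machine configuration `s` represents the configuration `σ` of the variables below `D`. -/
structure Represents (D X : ℕ) (σ s : Config) : Prop where
  limit : s.reg 0 = X
  var : ∀ i < D, s.reg (i + 1) = σ.reg i
  mem : s.mem = σ.mem

/-- The second conclusion, on the registers strictly between `D` and `d`, protects the counters of
the enclosing loops: the body of a loop is compiled with `d + 2`, the counters being `d` and `d +
1`. -/
theorem Stmt.halts {D X : ℕ} (p : Stmt) : ∀ (d : ℕ) (σ s : Config), p.bd ≤ D → D < d →
    Represents D X σ s → Halts (p.compile d) s (p.cost X) fun s' =>
      Represents D X (p.eval X σ) s' ∧ ∀ i, D < i → i < d → s'.reg i = s.reg i := by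
  have expr : ∀ (e : Ex) (d : ℕ) (σ s : Config), e.bd ≤ D → D < d → Represents D X σ s →
      Halts (e.compile d) s (e.cost X) (Ex.Post d (e.eval X σ.mem σ.reg) s) := by
    intro e d σ s he hd hs
    have := e.halts X d s σ.reg (by omega) hs.limit fun i hi => hs.var i (by omega)
    rwa [hs.mem] at this
  have post : ∀ {d val : ℕ} {σ s s' : Config}, D < d → Represents D X σ s → Ex.Post d val s s' →
      Represents D X σ s' := by
    rintro d val σ s s' hd hs ⟨h1, h2, h3⟩
    exact ⟨by rw [h2 0 (by omega), hs.limit], fun i hi => by rw [h2 _ (by omega), hs.var i hi],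
      by rw [h3, hs.mem]⟩
  induction p with
  | skip =>
    intro d σ s hp hd hs
    refine .instr ⟨⟨?_, fun i hi => ?_, hs.mem⟩, fun i hi hid => ?_⟩
    · simp [Instr.exec, show 0 ≠ d by omega, hs.limit]
    · simp [Instr.exec, show i + 1 ≠ d by omega, hs.var i hi, Stmt.eval]
    · simp [Instr.exec, hid.ne]
  | assign j e =>
    intro d σ s hp hd hs
    simp only [Stmt.bd, max_le_iff] at hp
    refine Halts.seq (expr e d σ s hp.2 hd hs) fun s1 h1 => .instr ?_
    have hs1 := post hd hs h1
    refine ⟨⟨?_, fun i hi => ?_, hs1.mem⟩, fun i hi hid => ?_⟩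
    · simp [Instr.exec, hs1.limit]
    · by_cases hij : i = j
      · simp [Instr.exec, hij, Stmt.eval, h1.1, Config.setVar]
      · simp [Instr.exec, hij, hs1.var i hi, Stmt.eval, Config.setVar]
    · simp [Instr.exec, show i ≠ j + 1 by omega, h1.2.1 i hid]
  | store b e e' =>
    intro d σ s hp hd hs
    simp only [Stmt.bd, max_le_iff] at hp
    refine (Halts.seq (expr e d σ s hp.1 hd hs) fun s1 h1 => Halts.seq
      (expr e' (d + 1) σ s1 hp.2 (by omega) (post hd hs h1)) fun s2 h2 => .instr ?_).mono
      (by simp only [Stmt.cost]; omega) fun _ h => h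
    have hs2 := post (by omega) (post hd hs h1) h2
    refine ⟨⟨hs2.limit, fun i hi => hs2.var i hi, ?_⟩, fun i hi hid => ?_⟩
    · simp [Instr.exec, Stmt.eval, Config.setMem, hs2.mem, h2.1, h2.2.1 d (by omega), h1.1]
    · simp [Instr.exec, h2.2.1 i (by omega), h1.2.1 i hid]
  | seq p q ihp ihq =>
    intro d σ s hp hd hs
    simp only [Stmt.bd, max_le_iff] at hp
    refine Halts.seq (ihp d σ s hp.1 hd hs) fun s1 h1 => (ihq d _ s1 hp.2 hd h1.1).mono le_rfl ?_
    exact fun s2 h2 => ⟨h2.1, fun i hi hid => by rw [h2.2 i hi hid, h1.2 i hi hid]⟩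
  | ite e p q ihp ihq =>
    intro d σ s hp hd hs
    simp only [Stmt.bd, max_le_iff] at hp
    refine (Halts.seq (expr e d σ s hp.1 hd hs) fun s1 h1 =>
      .branch (T := p.cost X + q.cost X) (fun hne => ?_) fun hz => ?_).mono
      (by simp only [Stmt.cost]; omega) fun _ h => h
    · refine (ihp d σ s1 hp.2.1 hd (post hd hs h1)).mono (by omega) fun s2 h2 => ⟨?_, ?_⟩
      · rw [Stmt.eval, if_pos (h1.1 ▸ hne)]
        exact h2.1
      · exact fun i hi hid => by rw [h2.2 i hi hid, h1.2.1 i hid]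
    · refine (ihq d σ s1 hp.2.2 hd (post hd hs h1)).mono (by omega) fun s2 h2 => ⟨?_, ?_⟩
      · rw [Stmt.eval, if_neg (by simpa [h1.1] using hz)]
        exact h2.1
      · exact fun i hi hid => by rw [h2.2 i hi hid, h1.2.1 i hid]
  | loop k p ih =>
    intro d σ s hp hd hs
    simp only [Stmt.bd, max_le_iff] at hp
    refine (Halts.instr_seq (.instr_seq (Halts.loop (T := p.cost X + 4) (X := X)
      (I := fun j t => Represents D X (iterate (fun t τ => p.eval X (τ.setVar k t)) j σ) t ∧
        t.reg d = j ∧ t.reg (d + 1) = X - j ∧ ∀ i, D < i → i < d → t.reg i = s.reg i)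
        (fun _ _ h => h.2.2.1) ?_ ?_))).mono (by simp only [Stmt.cost]; omega)
        fun t h => ⟨h.1, h.2.2.2⟩
    · rintro j t hj ⟨e0, e1, e2, e3⟩
      refine .instr_seq (Halts.seq (T' := 3) (ih (d + 2) ((iterate (fun t τ =>
        p.eval X (τ.setVar k t)) j σ).setVar k j) _ hp.2 (by omega) ⟨?_, fun i hi => ?_, ?_⟩)
        fun t' h => .instr_seq (.instr_seq (.instr ⟨⟨?_, fun i hi => ?_, ?_⟩, ?_, ?_,
          fun i hi hid => ?_⟩)))
      · simp [Instr.exec, e0.limit]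
      · by_cases hik : i = k
        · simp [Instr.exec, hik, Config.setVar, e1]
        · simp [Instr.exec, hik, Config.setVar, e0.var i hi]
      · simp [Instr.exec, Config.setVar, e0.mem]
      · simp [Instr.exec, h.1.limit, show 0 ≠ d by omega]
      · simp [Instr.exec, h.1.var i hi, show i + 1 ≠ d by omega,
          show i ≠ d by omega, show i ≠ d + 1 by omega, iterate]
      · simp [Instr.exec, h.1.mem, iterate]
      · have := h.2 d (by omega) (by omega)
        simp [Instr.exec, show d ≠ k + 1 by omega, e1] at this
        simp [Instr.exec, this]
      · have := h.2 (d + 1) (by omega) (by omega)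
        simp [Instr.exec, show d ≠ k by omega, e2] at this
        simp [Instr.exec, this]
        omega
      · have := h.2 i (by omega) (by omega)
        simp [Instr.exec, show i ≠ k + 1 by omega, e3 i hi hid] at this
        simp [Instr.exec, this, hid.ne, show i ≠ d + 1 by omega,
          show i ≠ d + 2 by omega]
    · refine ⟨⟨?_, fun i hi => ?_, ?_⟩, ?_, ?_, fun i hi hid => ?_⟩
      · simp [Instr.exec, show 0 ≠ d by omega, hs.limit]
      · simp [Instr.exec, Function.update_apply, show i + 1 ≠ d by omega, show i ≠ d by omega,
          hs.var i hi, iterate]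
      · simp [Instr.exec, hs.mem, iterate]
      · simp [Instr.exec, Function.update_apply]
      · simp [Instr.exec, show 0 ≠ d by omega, hs.limit]
      · simp [Instr.exec, Function.update_apply, hid.ne, show i ≠ d + 1 by omega]

/-- The variable `i` is not assigned by the statement. -/
def Stmt.KeepsVar (i : ℕ) : Stmt → Prop
  | .skip => True
  | .assign j _ => i ≠ j
  | .store _ _ _ => True
  | .seq p q => p.KeepsVar i ∧ q.KeepsVar i
  | .ite _ p q => p.KeepsVar i ∧ q.KeepsVar i
  | .loop j p => i ≠ j ∧ p.KeepsVar i

/-- The statement does not write into the bank `b`. -/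
def Stmt.KeepsBank (b : ℕ) : Stmt → Prop
  | .skip => True
  | .assign _ _ => True
  | .store c _ _ => b ≠ c
  | .seq p q => p.KeepsBank b ∧ q.KeepsBank b
  | .ite _ p q => p.KeepsBank b ∧ q.KeepsBank b
  | .loop _ p => p.KeepsBank b

theorem iterate_induction {α : Type} {f : ℕ → α → α} {x : α} (I : ℕ → α → Prop) (h0 : I 0 x)
    {X : ℕ} (h : ∀ j y, j < X → I j y → I (j + 1) (f j y)) : I X (iterate f X x) := by
  suffices H : ∀ k ≤ X, I k (iterate f k x) from H X le_rfl
  intro k hk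
  induction k with
  | zero => exact h0
  | succ k ih => exact h k _ hk (ih (by omega))

theorem Stmt.eval_reg {X i : ℕ} {p : Stmt} (hp : p.KeepsVar i) (σ : Config) :
    (p.eval X σ).reg i = σ.reg i := by
  induction p generalizing σ with
  | skip => rfl
  | assign j e => simp [Stmt.eval, Config.setVar, Function.update_of_ne hp]
  | store b e e' => rfl
  | seq p q ihp ihq => rw [Stmt.eval, ihq hp.2, ihp hp.1]
  | ite e p q ihp ihq =>
    rw [Stmt.eval]
    split_ifs
    · exact ihp hp.1 σ
    · exact ihq hp.2 σ
  | loop j p ih =>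
    refine iterate_induction (fun _ (τ : Config) => τ.reg i = σ.reg i) rfl fun t τ _ h => ?_
    rw [ih hp.2, ← h]
    simp [Config.setVar, Function.update_of_ne hp.1]

theorem Stmt.eval_mem {X b : ℕ} {p : Stmt} (hp : p.KeepsBank b) (σ : Config) :
    (p.eval X σ).mem b = σ.mem b := by
  induction p generalizing σ with
  | skip => rfl
  | assign j e => rfl
  | store c e e' => simp [Stmt.eval, Config.setMem, Function.update_of_ne hp]
  | seq p q ihp ihq => rw [Stmt.eval, ihq hp.2, ihp hp.1]
  | ite e p q ihp ihq =>
    rw [Stmt.eval]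
    split_ifs
    · exact ihp hp.1 σ
    · exact ihq hp.2 σ
  | loop j p ih =>
    refine iterate_induction (fun _ (τ : Config) => τ.mem b = σ.mem b) rfl fun t τ _ h => ?_
    rw [ih hp, ← h]
    rfl

end RAM

/-! ### The clustering problem and the soundness of certificates -/

/-- Clustering of the columns of `A` around centers whose rows are prescribed by the rows of `T`:
every row `l < m` gets a letter `w < K`, and then `T w s` is the entry of the center number `s` in
this row. At least `p` columns are to be covered within the total distance `B`. -/
structure ClusterInstance where
  K : ℕ
  m : ℕ
  n : ℕ
  B : ℕ
  p : ℕ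
  A : ℕ → ℕ → ℕ
  T : ℕ → ℕ → ℕ

namespace ClusterInstance

open Finset

/-- The number of rows below `m` with a property. -/
noncomputable def count (m : ℕ) (P : ℕ → Prop) : ℕ := by
  classical exact #{l ∈ range m | P l}

theorem count_mono {m : ℕ} {P Q : ℕ → Prop} (h : ∀ l < m, P l → Q l) : count m P ≤ count m Q := by
  classical
  unfold count
  refine card_le_card fun l hl => ?_
  simp only [mem_filter, mem_range] at hl ⊢
  exact ⟨hl.1, h l hl.1 hl.2⟩

theorem count_le (m : ℕ) (P : ℕ → Prop) : count m P ≤ m := by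
  classical
  exact (card_filter_le _ _).trans (card_range m).le

theorem count_pos {m : ℕ} {P : ℕ → Prop} {l : ℕ} (hl : l < m) (h : P l) : 0 < count m P := by
  classical
  exact card_pos.2 ⟨l, by simp [hl, h]⟩

theorem count_congr {m : ℕ} {P Q : ℕ → Prop} (h : ∀ l < m, P l ↔ Q l) : count m P = count m Q :=
  le_antisymm (count_mono fun l hl => (h l hl).1) (count_mono fun l hl => (h l hl).2)

variable (I : ClusterInstance)

/-- The distance of the column `j` to the center `s` for the row letters `w`. -/
noncomputable def dist (w : ℕ → ℕ) (s j : ℕ) : ℕ :=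
  count I.m fun l => I.A l j ≠ I.T (w l) s

/-- There are centers and at least `p` columns within the total distance `B` of the centers. -/
def Solvable : Prop :=
  ∃ w : ℕ → ℕ, (∀ l < I.m, w l < I.K) ∧ ∃ N ⊆ range I.n, ∃ σ : ℕ → ℕ, (∀ j ∈ N, σ j < I.K) ∧
    I.p ≤ N.card ∧ ∑ j ∈ N, I.dist w (σ j) j ≤ I.B

/-- The entries of the row `l` in the columns `a s` with `a s < n` come from a letter. -/
def Consistent (a : ℕ → ℕ) (l : ℕ) : Prop :=
  ∃ w < I.K, ∀ s < I.K, a s < I.n → I.T w s = I.A l (a s)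

/-- The entry of the center `s` in the row `l`: that of the column `a s`, except for the rows with
`W l ≠ 0`, which have the letter `W l - 1`. -/
def center (a W : ℕ → ℕ) (s l : ℕ) : ℕ :=
  if W l = 0 then I.A l (a s) else I.T (W l - 1) s

/-- The column `j` has distance at most `δ` to one of the centers. -/
def Near (a W : ℕ → ℕ) (δ j : ℕ) : Prop :=
  ∃ s < I.K, a s < I.n ∧ count I.m (fun l => I.A l j ≠ I.center a W s l) ≤ δ

/-- A certificate of solvability that is easy to check. The second condition says that the `p`
smallest distances of columns to the centers have the sum at most `B`. -/
def Accept (a W : ℕ → ℕ) : Prop :=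
  (∀ l < I.m, (W l = 0 ∧ I.Consistent a l) ∨ (W l ≠ 0 ∧ W l ≤ I.K)) ∧
    ∑ δ ∈ range I.m, (I.p - count I.n (I.Near a W δ)) ≤ I.B

/-- Layer-cake summation. It turns a sum of distances into counts over thresholds, so that the `p`
smallest distances can be summed without sorting. -/
theorem sum_eq_sum_card_lt (N : Finset ℕ) (d : ℕ → ℕ) (m : ℕ) (h : ∀ j ∈ N, d j ≤ m) :
    ∑ j ∈ N, d j = ∑ δ ∈ range m, #{j ∈ N | δ < d j} := by
  simp only [card_filter]
  rw [sum_comm]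
  refine sum_congr rfl fun j hj => ?_
  rw [← card_filter]
  have : {δ ∈ range m | δ < d j} = range (d j) := by
    ext δ
    simp only [mem_filter, mem_range]
    have := h j hj
    omega
  rw [this, card_range]

theorem exists_smallest (S : Finset ℕ) (d : ℕ → ℕ) : ∀ p ≤ S.card, ∃ N ⊆ S, N.card = p ∧
    ∀ j ∈ N, ∀ j' ∈ S, j' ∉ N → d j ≤ d j' := by
  intro p
  induction p with
  | zero => exact fun _ => ⟨∅, by simp⟩
  | succ p ih =>
    intro hp
    obtain ⟨N, hN, hc, h⟩ := ih (by omega)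
    have hne : (S \ N).Nonempty := by
      rw [← card_pos, card_sdiff_of_subset hN]
      omega
    obtain ⟨x, hx, hmin⟩ := exists_min_image (S \ N) d hne
    rw [mem_sdiff] at hx
    refine ⟨insert x N, insert_subset hx.1 hN, by rw [card_insert_of_notMem hx.2, hc], ?_⟩
    intro j hj j' hj' hn
    rw [mem_insert, not_or] at hn
    rcases mem_insert.1 hj with rfl | hj
    · exact hmin j' (mem_sdiff.2 ⟨hj', hn.2⟩)
    · exact h j hj j' hj' hn.2

variable {I}

/-- Each row has a letter that realizes `center` at all `s` with `a s < n`. With these letters, each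
column goes to its nearest center and the `p` columns of smallest distance are kept. Centers with `a
s ≥ n` are not used by `Near`; they can only decrease the distances. -/
theorem Accept.solvable {a W : ℕ → ℕ} (hK : 0 < I.K) (hp : I.p ≤ I.n) (h : I.Accept a W) :
    I.Solvable := by
  classical
  obtain ⟨h1, h2⟩ := h
  have hw : ∀ l, ∃ w, l < I.m → w < I.K ∧ ∀ s < I.K, a s < I.n → I.T w s = I.center a W s l := by
    intro l
    by_cases hl : l < I.m
    · rcases h1 l hl with ⟨h0, w, hw, h⟩ | ⟨h0, h⟩
      · exact ⟨w, fun _ => ⟨hw, fun s hs ha => by rw [center, if_pos h0, h s hs ha]⟩⟩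
      · exact ⟨W l - 1, fun _ => ⟨by omega, fun s _ _ => by rw [center, if_neg h0]⟩⟩
    · exact ⟨0, fun h => absurd h hl⟩
  choose w hw using hw
  have hσ : ∀ j, ∃ s < I.K, ∀ s' < I.K, I.dist w s j ≤ I.dist w s' j := by
    intro j
    obtain ⟨s, hs, h⟩ := exists_min_image (range I.K) (fun s => I.dist w s j) ⟨0, by simpa⟩
    exact ⟨s, mem_range.1 hs, fun s' hs' => h s' (mem_range.2 hs')⟩
  choose σ hσ hmin using hσ
  obtain ⟨N, hN, hc, hsm⟩ := exists_smallest (range I.n) (fun j => I.dist w (σ j) j) I.p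
    (by simpa using hp)
  refine ⟨w, fun l hl => (hw l hl).1, N, hN, σ, fun j _ => hσ j, hc.ge, ?_⟩
  rw [sum_eq_sum_card_lt N (fun j => I.dist w (σ j) j) I.m fun j _ => count_le _ _]
  refine (sum_le_sum fun δ _ => ?_).trans h2
  have hnear : count I.n (I.Near a W δ) ≤ #{j ∈ range I.n | I.dist w (σ j) j ≤ δ} := by
    refine card_le_card fun j hj => ?_
    simp only [mem_filter] at hj ⊢
    refine ⟨hj.1, ?_⟩
    obtain ⟨s, hs, ha, hle⟩ := hj.2
    refine (hmin j s hs).trans (le_trans (count_mono fun l hl hne => ?_) hle)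
    rwa [← (hw l hl).2 s hs ha]
  -- If a selected column has distance above `δ`, then by minimality all columns of distance at most
  -- `δ` are selected, and at most `p - count` selected columns remain above `δ`.
  by_cases hex : ∃ j ∈ N, δ < I.dist w (σ j) j
  · obtain ⟨j0, hj0, hlt⟩ := hex
    have hsub : {j ∈ range I.n | I.dist w (σ j) j ≤ δ} ⊆ {j ∈ N | ¬ δ < I.dist w (σ j) j} := by
      intro j hj
      simp only [mem_filter] at hj ⊢
      refine ⟨?_, by omega⟩
      by_contra hjN
      have := hsm j0 hj0 j hj.1 hjN
      omega
    have := card_le_card hsub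
    have := card_filter_add_card_filter_not (s := N) (fun j => δ < I.dist w (σ j) j)
    omega
  · rw [filter_false_of_mem fun j hj hlt => hex ⟨j, hj, hlt⟩]
    simp

/-- The checked quantity is a lower bound for the cost of every assignment of at least `p` columns:
at each threshold `δ`, the columns of `N` that are not above `δ` are counted by `Near`. -/
theorem sum_sub_count_near_le {a W σ : ℕ → ℕ} {N : Finset ℕ} (hN : N ⊆ range I.n)
    (hσ : ∀ j ∈ N, σ j < I.K ∧ a (σ j) < I.n) (hp : I.p ≤ N.card) :
    ∑ δ ∈ range I.m, (I.p - count I.n (I.Near a W δ)) ≤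
      ∑ j ∈ N, count I.m (fun l => I.A l j ≠ I.center a W (σ j) l) := by
  classical
  rw [sum_eq_sum_card_lt N _ I.m fun j _ => count_le _ _]
  refine sum_le_sum fun δ _ => ?_
  have hsub : {j ∈ N | ¬ δ < count I.m (fun l => I.A l j ≠ I.center a W (σ j) l)} ⊆
      {j ∈ range I.n | I.Near a W δ j} := by
    intro j hj
    simp only [mem_filter, not_lt] at hj ⊢
    exact ⟨hN hj.1, σ j, (hσ j hj.1).1, (hσ j hj.1).2, hj.2⟩
  have h1 := card_le_card hsub
  have h2 := card_filter_add_card_filter_not (s := N)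
    (fun j => δ < count I.m (fun l => I.A l j ≠ I.center a W (σ j) l))
  have h3 : count I.n (I.Near a W δ) = #{j ∈ range I.n | I.Near a W δ j} := rfl
  omega

/-! ### Close columns and candidate rows -/

variable (I)

/-- The column `x` has distance at most `B` to the column `a s`. -/
def Close (a : ℕ → ℕ) (s x : ℕ) : Prop :=
  count I.m (fun l => I.A l x ≠ I.A l (a s)) ≤ I.B

/-- The number of columns close to `a s` that differ from it in the rows `V k`, where `k < i` runs
over the binary digits `1` of `q`. -/
noncomputable def deg (a V : ℕ → ℕ) (i s q : ℕ) : ℕ :=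
  count I.n fun x => I.Close a s x ∧ ∀ k < i, q.testBit k → I.A (V k) x ≠ I.A (V k) (a s)

/-- The number of columns counted by `deg` that also differ from the column `a s` in the
row `v`. -/
noncomputable def degWith (a V : ℕ → ℕ) (i s q v : ℕ) : ℕ :=
  count I.n fun x => (I.Close a s x ∧ ∀ k < i, q.testBit k → I.A (V k) x ≠ I.A (V k) (a s)) ∧
    I.A v x ≠ I.A v (a s)

/-- The rows among which the next row is chosen. -/
def Candidate (a V : ℕ → ℕ) (i s q e v : ℕ) : Prop :=
  if s < I.K then I.deg a V i s q ≤ 2 ^ e * I.degWith a V i s q v else ¬ I.Consistent a v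

variable {I}

theorem sum_card_filter_comm (S S' : Finset ℕ) (R : ℕ → ℕ → Prop) [∀ v x, Decidable (R v x)] :
    ∑ v ∈ S', #{x ∈ S | R v x} = ∑ x ∈ S, #{v ∈ S' | R v x} := by
  simp only [card_filter]
  exact sum_comm

/-- Double counting of pairs of a row and a close column: a close column differs from `a s` in at
most `B` rows. -/
theorem sum_degWith_le (a V : ℕ → ℕ) (i s q : ℕ) :
    ∑ v ∈ range I.m, I.degWith a V i s q v ≤ I.B * I.deg a V i s q := by
  classical
  simp only [degWith, deg, count, ← filter_filter]
  rw [sum_card_filter_comm, mul_comm, ← smul_eq_mul]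
  refine sum_le_card_nsmul _ _ _ fun x hx => ?_
  have h : I.Close a s x := (mem_filter.1 (mem_filter.1 hx).1).2
  unfold Close count at h
  refine (Nat.le_of_eq ?_).trans h
  congr

/-- A Markov inequality: every candidate row accounts for at least a fraction `2 ^ (-e)` of the
`deg` columns, while all rows together account for at most `B * deg` incidences. -/
theorem count_candidate_le {a V : ℕ → ℕ} {i s q e : ℕ} (hs : s < I.K)
    (hd : 0 < I.deg a V i s q) : count I.m (I.Candidate a V i s q e) ≤ I.B * 2 ^ e := by
  classical
  refine Nat.le_of_mul_le_mul_right ?_ hd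
  calc count I.m (I.Candidate a V i s q e) * I.deg a V i s q
      = ∑ v ∈ range I.m with I.Candidate a V i s q e v, I.deg a V i s q := by
        rw [sum_const, smul_eq_mul]; rfl
    _ ≤ ∑ v ∈ range I.m with I.Candidate a V i s q e v, 2 ^ e * I.degWith a V i s q v := by
        refine sum_le_sum fun v hv => ?_
        have := (mem_filter.1 hv).2
        rwa [Candidate, if_pos hs] at this
    _ ≤ ∑ v ∈ range I.m, 2 ^ e * I.degWith a V i s q v :=
        sum_le_sum_of_subset (filter_subset _ _)
    _ = 2 ^ e * ∑ v ∈ range I.m, I.degWith a V i s q v := by rw [mul_sum]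
    _ ≤ 2 ^ e * (I.B * I.deg a V i s q) := by gcongr; exact sum_degWith_le a V i s q
    _ = I.B * 2 ^ e * I.deg a V i s q := by ring

theorem count_lt_count {m v : ℕ} {P : ℕ → Prop} (hv : v < m) (h : P v) :
    count v P < count m P := by
  classical
  refine card_lt_card ⟨?_, fun hsub => ?_⟩
  · intro l hl
    simp only [mem_filter, mem_range] at hl ⊢
    exact ⟨by omega, hl.2⟩
  · have : v ∈ {l ∈ range m | P l} := by simp [hv, h]
    simpa using hsub this

/-- The extra `1` in the exponent pays for rounding down the logarithms. It is the origin of `e =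
drop + 1`. -/
theorem le_two_pow_log_sub_mul {x y : ℕ} (hy : 0 < y) (hxy : y ≤ x) :
    x ≤ 2 ^ (Nat.log 2 x - Nat.log 2 y + 1) * y := by
  have h1 : x < 2 ^ (Nat.log 2 x + 1) := Nat.lt_pow_succ_log_self (by norm_num) x
  have h2 : 2 ^ Nat.log 2 y ≤ y := Nat.pow_log_le_self 2 hy.ne'
  have h3 : Nat.log 2 y ≤ Nat.log 2 x := Nat.log_mono_right hxy
  calc x ≤ 2 ^ (Nat.log 2 x + 1) := h1.le
    _ = 2 ^ (Nat.log 2 x - Nat.log 2 y + 1) * 2 ^ Nat.log 2 y := by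
        rw [← pow_add]; congr 1; omega
    _ ≤ _ := by gcongr

end ClusterInstance

/-! ### Completeness: short certificates by a logarithmic potential -/

namespace ClusterInstance

open Finset

variable {I : ClusterInstance}

variable (I) in
/-- The number of close columns that differ from `a s` in all rows `V k`, `k < i`, in which the
column `j` differs from it. -/
noncomputable def degTrace (a V : ℕ → ℕ) (s i j : ℕ) : ℕ :=
  count I.n fun x => I.Close a s x ∧
    ∀ k < i, I.A (V k) j ≠ I.A (V k) (a s) → I.A (V k) x ≠ I.A (V k) (a s)

theorem degTrace_pos {a V : ℕ → ℕ} {s i j : ℕ} (hj : j < I.n) (h : I.Close a s j) :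
    0 < I.degTrace a V s i j :=
  count_pos hj ⟨h, fun _ _ h => h⟩

theorem degTrace_succ_le (a V : ℕ → ℕ) (s i j : ℕ) :
    I.degTrace a V s (i + 1) j ≤ I.degTrace a V s i j :=
  count_mono fun _ _ h => ⟨h.1, fun k hk => h.2 k (by omega)⟩

variable (I) in
/-- The decrease of the logarithm of `degTrace` in step `i`. -/
noncomputable def drop (a V : ℕ → ℕ) (s i j : ℕ) : ℕ :=
  Nat.log 2 (I.degTrace a V s i j) - Nat.log 2 (I.degTrace a V s (i + 1) j)

/-- The drops telescope. Truncated subtraction is harmless because `degTrace` is antitone in the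
step. -/
theorem sum_drop_le (a V : ℕ → ℕ) (s j t : ℕ) :
    ∑ i ∈ range t, I.drop a V s i j ≤ Nat.log 2 I.n := by
  suffices H : ∑ i ∈ range t, I.drop a V s i j + Nat.log 2 (I.degTrace a V s t j) ≤
      Nat.log 2 I.n by omega
  induction t with
  | zero =>
    rw [sum_range_zero, zero_add]
    exact Nat.log_mono_right (count_le _ _)
  | succ t ih =>
    have := Nat.log_mono_right (b := 2) (degTrace_succ_le (I := I) a V s t j)
    rw [sum_range_succ]
    unfold drop at ih ⊢
    omega

/-- Among the columns that differ from `a s` in the new row, the one with the smallest drop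
determines the mask and the exponent. These columns are at least half of the cluster, so the
smallest drop is at most twice the average over the whole cluster. -/
theorem exists_candidate {a V : ℕ → ℕ} {s i : ℕ} (hs : s < I.K) (hi : i < I.B) {N : Finset ℕ}
    (hN : N ⊆ range I.n) (hne : N.Nonempty) (hclose : ∀ j ∈ N, I.Close a s j)
    (hmaj : N.card ≤ 2 * #{j ∈ N | I.A (V i) j ≠ I.A (V i) (a s)}) :
    ∃ q e, q < 2 ^ I.B ∧ e ≤ Nat.log 2 I.n + 1 ∧ I.Candidate a V i s q e (V i) ∧
      count I.m (I.Candidate a V i s q e) ≤ I.B * 2 ^ e ∧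
      N.card * (e - 1) ≤ 2 * ∑ j ∈ N, I.drop a V s i j := by
  classical
  set M := {j ∈ N | I.A (V i) j ≠ I.A (V i) (a s)} with hM
  have hMne : M.Nonempty := by
    rw [← card_pos]
    have := hne.card_pos
    omega
  obtain ⟨j, hj, hmin⟩ := exists_min_image M (I.drop a V s i) hMne
  rw [hM, mem_filter] at hj
  have hjn : j < I.n := mem_range.1 (hN hj.1)
  -- The mask is the trace of `j` on the earlier rows. It makes `deg` equal to `degTrace` at step
  -- `i`, and `degWith` for the row `V i` equal to `degTrace` at step `i + 1`.
  let q := Nat.ofBits fun k : Fin i => decide (I.A (V k) j ≠ I.A (V k) (a s))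
  have hq : ∀ k < i, q.testBit k = true ↔ I.A (V k) j ≠ I.A (V k) (a s) := fun k hk => by
    rw [Nat.testBit_ofBits_lt _ _ hk]
    simp
  have hdeg : I.deg a V i s q = I.degTrace a V s i j := by
    refine count_congr fun x hx => and_congr_right fun _ => forall₂_congr fun k hk => ?_
    rw [hq k hk]
  have hdegWith : I.degWith a V i s q (V i) = I.degTrace a V s (i + 1) j := by
    refine count_congr fun x hx => ?_
    rw [and_assoc]
    refine and_congr_right fun _ => ⟨fun h k hk hk' => ?_, fun h => ⟨fun k hk hk' => ?_, ?_⟩⟩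
    · rcases Nat.lt_succ_iff_lt_or_eq.1 hk with hk | rfl
      · exact h.1 k hk ((hq k hk).2 hk')
      · exact h.2
    · exact h k (by omega) ((hq k hk).1 hk')
    · exact h i (by omega) hj.2
  have hpos : ∀ k, 0 < I.degTrace a V s k j := fun k => degTrace_pos hjn (hclose j hj.1)
  refine ⟨q, I.drop a V s i j + 1, ?_, ?_, ?_, count_candidate_le hs (hdeg ▸ hpos i), ?_⟩
  · exact (Nat.ofBits_lt_two_pow _).trans_le (Nat.pow_le_pow_right (by norm_num) hi.le)
  · have h : I.degTrace a V s i j ≤ I.n := count_le _ _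
    have := Nat.log_mono_right (b := 2) h
    unfold drop
    omega
  · rw [Candidate, if_pos hs, hdeg, hdegWith]
    exact le_two_pow_log_sub_mul (hpos _) (degTrace_succ_le a V s i j)
  · rw [Nat.add_sub_cancel]
    calc N.card * I.drop a V s i j ≤ 2 * M.card * I.drop a V s i j := by gcongr
      _ = 2 * (M.card • I.drop a V s i j) := by rw [smul_eq_mul, mul_assoc]
      _ ≤ 2 * ∑ j ∈ M, I.drop a V s i j := by
        gcongr
        exact card_nsmul_le_sum _ _ _ hmin
      _ ≤ 2 * ∑ j ∈ N, I.drop a V s i j := by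
        gcongr
        exact filter_subset _ _

/-- The data that determine one deviating row and its letter. -/
structure Digits where
  s : ℕ
  q : ℕ
  w : ℕ
  e : ℕ
  p : ℕ

variable (I) in
/-- The digits `g` determine the row `V i` from the rows `V k` with `k < i`. -/
structure ValidStep (a V : ℕ → ℕ) (i : ℕ) (g : Digits) : Prop where
  s_le : g.s ≤ I.K
  q_lt : g.q < 2 ^ I.B
  w_pos : 0 < g.w
  w_le : g.w ≤ I.K
  e_le : g.e ≤ Nat.log 2 I.n + 1
  p_lt : g.p < I.B * 2 ^ g.e
  row_lt : V i < I.m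
  cand : I.Candidate a V i g.s g.q g.e (V i)
  rank : count (V i) (I.Candidate a V i g.s g.q g.e) = g.p

variable (I) in
/-- Columns `a` and deviating rows `V i`, `i < t`, with letters, that form a certificate and can be
encoded by few digits. -/
structure Certificate (a W V : ℕ → ℕ) (t : ℕ) (g : ℕ → Digits) : Prop where
  accept : I.Accept a W
  a_le : ∀ s, a s ≤ I.n
  t_le : t ≤ I.B
  valid : ∀ i < t, I.ValidStep a V i (g i)
  letter : ∀ i < t, W (V i) = (g i).w
  letter_zero : ∀ l < I.m, (∀ i < t, V i ≠ l) → W l = 0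
  sum_le : ∑ i ∈ range t, (g i).e ≤ I.B + 2 * I.K * Nat.log 2 I.n

theorem exists_enum (D : Finset ℕ) : ∃ V : ℕ → ℕ, (∀ i < D.card, V i ∈ D) ∧
    ∀ l ∈ D, ∃ i < D.card, V i = l := by
  refine ⟨fun i => if h : i < D.card then D.equivFin.symm ⟨i, h⟩ else 0, fun i hi => ?_,
    fun l hl => ⟨D.equivFin ⟨l, hl⟩, (D.equivFin ⟨l, hl⟩).2, by simp⟩⟩
  simp [hi]

/-- The triangle inequality through the common center. For distinct columns both distances occur in
the total cost, so their sum is at most `B` rather than `2 * B`. -/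
theorem dist_le_of_mem {w σ : ℕ → ℕ} {N : Finset ℕ} {b j : ℕ}
    (h : ∑ j ∈ N, I.dist w (σ j) j ≤ I.B) (hb : b ∈ N) (hj : j ∈ N) (hσ : σ b = σ j) :
    count I.m (fun l => I.A l j ≠ I.A l b) ≤ I.B := by
  classical
  by_cases hjb : j = b
  · subst hjb
    simp [count]
  · have h1 : I.dist w (σ j) j + I.dist w (σ b) b ≤ I.B := by
      refine le_trans ?_ h
      rw [← sum_pair (f := fun j => I.dist w (σ j) j) hjb]
      exact sum_le_sum_of_subset fun x hx => by
        rcases mem_insert.1 hx with rfl | hx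
        · exact hj
        · rwa [mem_singleton.1 hx]
    unfold dist count at h1
    unfold count
    refine le_trans (le_trans (card_le_card fun l hl => ?_) (card_union_le _ _)) h1
    simp only [mem_union, mem_filter] at hl ⊢
    by_contra hcon
    simp only [not_or, not_and, not_not] at hcon
    exact hl.2 ((hcon.1 hl.1).trans (by rw [hcon.2 hl.1, hσ]))

/-- If `γ` is cheaper than `β` in total, it is cheaper on some fiber. There `γ s ≠ β s`, so the
columns that agree with `β s` disagree with `γ s` and are fewer than those that disagree with `β s`.
-/
theorem exists_majority_fiber {K : ℕ} {σ : ℕ → ℕ} {N : Finset ℕ} (hσ : ∀ j ∈ N, σ j < K)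
    {α β γ : ℕ → ℕ} (h : #{j ∈ N | α j ≠ γ (σ j)} < #{j ∈ N | α j ≠ β (σ j)}) :
    ∃ s < K, {j ∈ N | σ j = s}.Nonempty ∧
      #{j ∈ N | σ j = s} ≤ 2 * #{j ∈ {j ∈ N | σ j = s} | α j ≠ β s} := by
  classical
  have hfib : ∀ (P : ℕ → ℕ → Prop) [∀ s j, Decidable (P s j)], #{j ∈ N | P (σ j) j} =
      ∑ s ∈ range K, #{j ∈ {j ∈ N | σ j = s} | P s j} := by
    intro P _
    rw [card_eq_sum_card_fiberwise (f := σ) (t := range K) fun j hj => by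
      simpa using hσ j (mem_filter.1 hj).1]
    refine sum_congr rfl fun s _ => congrArg card ?_
    ext j
    simp only [mem_filter]
    constructor
    · rintro ⟨⟨h1, h2⟩, rfl⟩
      exact ⟨⟨h1, rfl⟩, h2⟩
    · rintro ⟨⟨h1, rfl⟩, h2⟩
      exact ⟨⟨h1, h2⟩, rfl⟩
  have h1 := hfib fun s j => α j ≠ γ s
  have h2 := hfib fun s j => α j ≠ β s
  have : ∃ s ∈ range K, #{j ∈ {j ∈ N | σ j = s} | α j ≠ γ s} <
      #{j ∈ {j ∈ N | σ j = s} | α j ≠ β s} := by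
    by_contra! hcon
    have := sum_le_sum hcon
    omega
  obtain ⟨s, hs, hlt⟩ := this
  refine ⟨s, mem_range.1 hs, ?_, ?_⟩
  · exact (card_pos.1 (lt_of_le_of_lt (Nat.zero_le _) hlt)).mono (filter_subset _ _)
  · have hne : γ s ≠ β s := by
      intro heq
      simp only [heq, lt_irrefl] at hlt
    have hsub : {j ∈ {j ∈ N | σ j = s} | ¬ α j ≠ β s} ⊆ {j ∈ {j ∈ N | σ j = s} | α j ≠ γ s} := by
      intro j hj
      simp only [mem_filter, not_not] at hj ⊢
      exact ⟨hj.1, by rw [hj.2]; exact hne.symm⟩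
    have := card_le_card hsub
    have := card_filter_add_card_filter_not (s := {j ∈ N | σ j = s}) (fun j => α j ≠ β s)
    omega

/-- The deviating rows may be listed in any order, since the potential argument works for every
order. -/
theorem Solvable.certificate (h : I.Solvable) : ∃ a W V t g, I.Certificate a W V t g := by
  classical
  obtain ⟨w, hw, N, hN, σ, hσ, hp, hcost⟩ := h
  -- The value `n` stands for an empty cluster.
  have ha : ∀ s, ∃ x, x ≤ I.n ∧ (x < I.n → x ∈ N ∧ σ x = s) ∧ ∀ j ∈ N, σ j = s → x < I.n := by
    intro s
    by_cases hs : ∃ j ∈ N, σ j = s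
    · obtain ⟨j, hj, hjs⟩ := hs
      have hjn := mem_range.1 (hN hj)
      exact ⟨j, hjn.le, fun _ => ⟨hj, hjs⟩, fun _ _ _ => hjn⟩
    · exact ⟨I.n, le_rfl, fun h => absurd h (lt_irrefl _), fun j hj hjs => absurd ⟨j, hj, hjs⟩ hs⟩
  choose a ha_le ha_mem ha_lt using ha
  have hclose : ∀ j ∈ N, I.Close a (σ j) j := fun j hj =>
    have := ha_mem (σ j) (ha_lt _ j hj rfl)
    dist_le_of_mem hcost this.1 hj this.2
  -- The deviating rows. In each of them some covered column disagrees with its true center: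
  -- otherwise the true letter would fit the columns `a s`, and these would be as cheap as the
  -- centers.
  set D := {l ∈ range I.m | ¬ I.Consistent a l ∨
    #{j ∈ N | I.A l j ≠ I.T (w l) (σ j)} < #{j ∈ N | I.A l j ≠ I.A l (a (σ j))}} with hD
  have hcomm : ∑ l ∈ range I.m, #{j ∈ N | I.A l j ≠ I.T (w l) (σ j)} ≤ I.B := by
    rw [sum_card_filter_comm]
    refine le_trans (sum_le_sum fun j _ => le_of_eq ?_) hcost
    unfold dist count
    congr
  have hDcard : D.card ≤ I.B := by
    refine le_trans ?_ hcomm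
    rw [card_eq_sum_ones]
    refine le_trans (sum_le_sum fun l hl => ?_) (sum_le_sum_of_subset (filter_subset _ _))
    rw [Nat.one_le_iff_ne_zero, Ne, card_eq_zero, filter_eq_empty_iff]
    intro hall
    simp only [not_not] at hall
    rw [mem_filter] at hl
    rcases hl.2 with hl2 | hl2
    · refine hl2 ⟨w l, hw l (mem_range.1 hl.1), fun s hs has => ?_⟩
      have := ha_mem s has
      rw [hall this.1, this.2]
    · rw [filter_false_of_mem (p := fun j => I.A l j ≠ I.A l (a (σ j))) fun j hj => ?_] at hl2
      · simp at hl2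
      · have := ha_mem (σ j) (ha_lt _ j hj rfl)
        rw [not_not, hall hj, hall this.1, this.2]
  -- Letters are shifted by one because `0` marks a row that does not deviate.
  set W : ℕ → ℕ := fun l => if l ∈ D then w l + 1 else 0 with hW
  have hcons : ∀ l < I.m, l ∉ D → I.Consistent a l := fun l hl hlD => by
    by_contra hcon
    exact hlD (mem_filter.2 ⟨mem_range.2 hl, .inl hcon⟩)
  have haccept : I.Accept a W := by
    constructor
    · intro l hl
      by_cases hlD : l ∈ D
      · right
        simp only [hW, if_pos hlD]
        have := hw l hl
        omega
      · exact .inl ⟨by simp only [hW, if_neg hlD], hcons l hl hlD⟩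
    · refine (sum_sub_count_near_le (σ := σ) hN (fun j hj => ⟨hσ j hj, ha_lt _ j hj rfl⟩) hp).trans
        (le_trans ?_ hcomm)
      unfold count
      rw [← sum_card_filter_comm]
      refine sum_le_sum fun l hl => ?_
      by_cases hlD : l ∈ D
      · simp [center, hW, hlD]
      · simp only [center, hW, hlD, if_false, if_true]
        by_contra hcon
        exact hlD (mem_filter.2 ⟨hl, .inr (by convert lt_of_not_ge hcon)⟩)
  obtain ⟨V, hVD, hDV⟩ := exists_enum D
  have hstep : ∀ i, ∃ g : Digits, i < D.card → I.ValidStep a V i g ∧ g.w = w (V i) + 1 ∧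
      (g.s = I.K ∧ g.e = 0 ∨ g.s < I.K ∧ {j ∈ N | σ j = g.s}.Nonempty ∧
        #{j ∈ N | σ j = g.s} * (g.e - 1) ≤
          2 * ∑ j ∈ N with σ j = g.s, I.drop a V g.s i j) := by
    intro i
    by_cases hi : i < D.card
    swap
    · exact ⟨⟨0, 0, 0, 0, 0⟩, fun h => absurd h hi⟩
    have hVi := mem_filter.1 (hVD i hi)
    have hVm := mem_range.1 hVi.1
    have hwV := hw _ hVm
    by_cases hc : I.Consistent a (V i)
    · obtain ⟨s, hs, hne, hmaj⟩ := exists_majority_fiber hσ (β := fun s => I.A (V i) (a s))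
        (γ := fun s => I.T (w (V i)) s) (α := I.A (V i)) (hVi.2.resolve_left (not_not.2 hc))
      obtain ⟨q, e, hq, he, hcand, hcount, hsum⟩ := exists_candidate hs (hi.trans_le hDcard)
        ((filter_subset _ _).trans hN) hne (a := a) (fun j hj => by
          have := mem_filter.1 hj
          exact this.2 ▸ hclose j this.1) hmaj
      exact ⟨⟨s, q, w (V i) + 1, e, count (V i) (I.Candidate a V i s q e)⟩, fun _ =>
        ⟨⟨hs.le, hq, Nat.succ_pos _, hwV, he, (count_lt_count hVm hcand).trans_le hcount, hVm,
          hcand, rfl⟩, rfl, .inr ⟨hs, hne, hsum⟩⟩⟩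
    -- The index `K`, which is not a center, marks an inconsistent row. All inconsistent rows lie in
    -- `D`, so the rank is below `B` and the exponent `0` suffices.
    · have hcand : I.Candidate a V i I.K 0 0 (V i) := by
        rwa [Candidate, if_neg (lt_irrefl _)]
      refine ⟨⟨I.K, 0, w (V i) + 1, 0, count (V i) (I.Candidate a V i I.K 0 0)⟩, fun _ =>
        ⟨⟨le_rfl, Nat.two_pow_pos _, Nat.succ_pos _, hwV, Nat.zero_le _, ?_, hVm,
          hcand, rfl⟩, rfl, .inl ⟨rfl, rfl⟩⟩⟩
      refine (count_lt_count hVm hcand).trans_le ?_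
      rw [pow_zero, mul_one]
      refine le_trans (card_le_card fun l hl => ?_) hDcard
      rw [mem_filter] at hl
      refine mem_filter.2 ⟨hl.1, .inl ?_⟩
      have := hl.2
      rwa [Candidate, if_neg (lt_irrefl _)] at this
  choose g hg using hstep
  refine ⟨a, W, V, D.card, g, haccept, ha_le, hDcard, fun i hi => (hg i hi).1, fun i hi => ?_,
    fun l _ hV => ?_, ?_⟩
  · rw [(hg i hi).2.1]
    simp [hW, hVD i hi]
  · have : l ∉ D := fun hl => by
      obtain ⟨i, hi, h⟩ := hDV l hl
      exact hV i hi h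
    simp [hW, this]
  · have hfiber : ∀ s ∈ range I.K, ∑ i ∈ range D.card with (g i).s = s, ((g i).e - 1) ≤
        2 * Nat.log 2 I.n := by
      intro s hs
      rcases eq_empty_or_nonempty {i ∈ range D.card | (g i).s = s} with h0 | ⟨i0, hi0⟩
      · simp [h0]
      rw [mem_filter, mem_range] at hi0
      have hne : {j ∈ N | σ j = s}.Nonempty := by
        rcases (hg i0 hi0.1).2.2 with h | h
        · have := mem_range.1 hs
          omega
        · exact hi0.2 ▸ h.2.1
      -- After multiplication by the size of the cluster, the sums over steps and over columns can
      -- be exchanged, and the drops telescope for each column separately.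
      refine Nat.le_of_mul_le_mul_left ?_ hne.card_pos
      rw [mul_sum]
      calc ∑ i ∈ range D.card with (g i).s = s, #{j ∈ N | σ j = s} * ((g i).e - 1)
          ≤ ∑ i ∈ range D.card with (g i).s = s, 2 * ∑ j ∈ N with σ j = s, I.drop a V s i j := by
            refine sum_le_sum fun i hi => ?_
            rw [mem_filter, mem_range] at hi
            rcases (hg i hi.1).2.2 with h | h
            · simp [h.2]
            · simpa only [hi.2] using h.2.2
        _ ≤ ∑ i ∈ range D.card, 2 * ∑ j ∈ N with σ j = s, I.drop a V s i j :=
            sum_le_sum_of_subset (filter_subset _ _)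
        _ = 2 * ∑ j ∈ N with σ j = s, ∑ i ∈ range D.card, I.drop a V s i j := by
            rw [← mul_sum, sum_comm]
        _ ≤ 2 * ∑ j ∈ N with σ j = s, Nat.log 2 I.n := by
            gcongr with j hj
            exact sum_drop_le a V s j _
        _ = #{j ∈ N | σ j = s} * (2 * Nat.log 2 I.n) := by
            rw [sum_const, smul_eq_mul]
            ring
    -- Each exponent is at most `1 + (e - 1)`. The ones add up to at most `B`, and each of the `K`
    -- clusters contributes at most `2 log n`.
    calc ∑ i ∈ range D.card, (g i).e
        ≤ ∑ i ∈ range D.card, (1 + if (g i).s ∈ range I.K then (g i).e - 1 else 0) := by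
          refine sum_le_sum fun i hi => ?_
          rcases (hg i (mem_range.1 hi)).2.2 with h | h
          · simp [h.2]
          · rw [if_pos (mem_range.2 h.1)]
            omega
      _ = D.card + ∑ i ∈ range D.card with (g i).s ∈ range I.K, ((g i).e - 1) := by
          rw [sum_add_distrib, sum_filter]
          simp
      _ = D.card + ∑ s ∈ range I.K, ∑ i ∈ range D.card with (g i).s = s, ((g i).e - 1) := by
          rw [← sum_fiberwise_of_maps_to (t := range I.K) (g := fun i => (g i).s)
            fun i hi => (mem_filter.1 hi).2]
          congr 1
          refine sum_congr rfl fun s hs => ?_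
          rw [filter_filter]
          refine sum_congr (filter_congr fun i _ => ?_) fun _ _ => rfl
          exact ⟨fun h => h.2, fun h => ⟨h ▸ hs, h⟩⟩
      _ ≤ I.B + ∑ s ∈ range I.K, 2 * Nat.log 2 I.n := Nat.add_le_add hDcard (sum_le_sum hfiber)
      _ = _ := by
          rw [sum_const, card_range, smul_eq_mul]
          ring

/-! ### Mixed radix codes, with bases that may vary from digit to digit -/

/-- Digits are combined into a number from the last one to the first one. -/
theorem exists_code (t z β : ℕ) (hz : z < β) (h : ℕ → ℕ → ℕ) (b : ℕ → ℕ)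
    (hb : ∀ i < t, ∀ x β, x < β → h i x < b i * β) :
    ∃ y : ℕ → ℕ, (∀ i < t, y i = h i (y (i + 1))) ∧ (∀ i, t ≤ i → y i = z) ∧
      y 0 < (∏ i ∈ range t, b i) * β := by
  induction t generalizing h b with
  | zero => exact ⟨fun _ => z, fun i hi => absurd hi (Nat.not_lt_zero i), fun _ _ => rfl, by simpa⟩
  | succ t ih =>
    obtain ⟨y, h1, h2, h3⟩ := ih (fun i => h (i + 1)) (fun i => b (i + 1))
      fun i hi => hb (i + 1) (by omega)
    refine ⟨fun i => Nat.casesOn i (h 0 (y 0)) y, fun i hi => ?_, fun i hi => ?_, ?_⟩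
    · cases i with
      | zero => rfl
      | succ i => exact h1 i (by omega)
    · cases i with
      | zero => omega
      | succ i => exact h2 i (by omega)
    · rw [prod_range_succ', mul_comm _ (b 0), mul_assoc]
      exact hb 0 (by omega) _ _ h3

end ClusterInstance

/-! ### Expressions that evaluate candidates and check certificates -/

namespace RAM

open ClusterInstance Finset

namespace Ex

/-- The expression is true, i.e. its value is not zero. -/
def Holds (X : ℕ) (mem : ℕ → ℕ → ℕ) (e : Ex) (v : ℕ → ℕ) : Prop := e.eval X mem v ≠ 0

def not (a : Ex) : Ex := .sub (.const 1) a

def and (a b : Ex) : Ex := .ite a (.ite b (.const 1) (.const 0)) (.const 0)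

def or (a b : Ex) : Ex := .ite a (.const 1) b

def le (a b : Ex) : Ex := .not (.sub a b)

def lt (a b : Ex) : Ex := .le (.add a (.const 1)) b

def eq (a b : Ex) : Ex := .and (.le a b) (.le b a)

def mod (a b : Ex) : Ex := .sub a (.mul (.div a b) b)

/-- The number of values of the variable `i` below `b` with the property `e`. -/
def cnt (i : ℕ) (b e : Ex) : Ex := .sum i (.and (.lt (.var i) b) e)

/-- All values of the variable `i` below `b` have the property `e`. -/
def all (i : ℕ) (b e : Ex) : Ex := .not (.cnt i b (.not e))

variable {X : ℕ} {mem : ℕ → ℕ → ℕ} {v : ℕ → ℕ} {a b c e : Ex}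

theorem eval_ite [Decidable (c.Holds X mem v)] : (Ex.ite c a b).eval X mem v =
    if c.Holds X mem v then a.eval X mem v else b.eval X mem v := by
  simp only [Ex.eval, Holds]
  split_ifs <;> simp_all

theorem holds_ite [Decidable (c.Holds X mem v)] : (Ex.ite c a b).Holds X mem v ↔
    if c.Holds X mem v then a.Holds X mem v else b.Holds X mem v := by
  simp only [Holds, Ex.eval]
  split_ifs <;> simp_all

theorem holds_not : a.not.Holds X mem v ↔ ¬ a.Holds X mem v := by
  simp only [Holds, Ex.not, Ex.eval]
  omega

theorem holds_and : (a.and b).Holds X mem v ↔ a.Holds X mem v ∧ b.Holds X mem v := by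
  simp only [Holds, Ex.and, Ex.eval]
  split_ifs <;> simp_all

theorem eval_and [Decidable (a.Holds X mem v ∧ b.Holds X mem v)] : (a.and b).eval X mem v =
    if a.Holds X mem v ∧ b.Holds X mem v then 1 else 0 := by
  simp only [Holds, Ex.and, Ex.eval]
  split_ifs <;> simp_all

theorem holds_or : (a.or b).Holds X mem v ↔ a.Holds X mem v ∨ b.Holds X mem v := by
  simp only [Holds, Ex.or, Ex.eval]
  split_ifs <;> simp_all

theorem holds_le : (a.le b).Holds X mem v ↔ a.eval X mem v ≤ b.eval X mem v := by
  rw [le, holds_not, Holds, Ex.eval]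
  omega

theorem holds_lt : (a.lt b).Holds X mem v ↔ a.eval X mem v < b.eval X mem v := by
  simp only [lt, holds_le, Ex.eval]
  omega

theorem holds_eq : (a.eq b).Holds X mem v ↔ a.eval X mem v = b.eval X mem v := by
  simp only [eq, holds_and, holds_le]
  omega

theorem eval_div (ha : a.eval X mem v ≤ X) (hb : 0 < b.eval X mem v) :
    (a.div b).eval X mem v = a.eval X mem v / b.eval X mem v := by
  rw [Ex.eval, if_neg hb.ne']
  exact min_eq_right ((Nat.div_le_self _ _).trans ha)

theorem eval_mod (ha : a.eval X mem v ≤ X) (hb : 0 < b.eval X mem v) :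
    (a.mod b).eval X mem v = a.eval X mem v % b.eval X mem v := by
  rw [mod, Ex.eval, Ex.eval, eval_div ha hb, min_eq_left ((Nat.div_le_self _ _).trans ha),
    Nat.mod_eq_sub, mul_comm]

theorem eval_mul (ha : a.eval X mem v ≤ X) :
    (a.mul b).eval X mem v = a.eval X mem v * b.eval X mem v := by
  rw [Ex.eval, min_eq_left ha]

theorem eval_cnt {i N : ℕ} {P : ℕ → Prop} (hN : N ≤ X)
    (hb : ∀ t, b.eval X mem (Function.update v i t) = N)
    (hP : ∀ t < N, e.Holds X mem (Function.update v i t) ↔ P t) :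
    (cnt i b e).eval X mem v = count N P := by
  classical
  simp only [cnt, Ex.eval, eval_and, holds_lt, hb, Function.update_self]
  rw [← card_filter, count]
  congr 1
  ext t
  simp only [mem_filter, mem_range]
  constructor
  · rintro ⟨h1, h2, h3⟩
    exact ⟨h2, (hP t h2).1 h3⟩
  · rintro ⟨h2, h3⟩
    exact ⟨by omega, h2, (hP t h2).2 h3⟩

theorem count_ne_zero {N : ℕ} {P : ℕ → Prop} : count N P ≠ 0 ↔ ∃ t < N, P t := by
  constructor
  · intro h
    by_contra! hcon
    have : count N P ≤ count N fun _ => False := count_mono hcon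
    simp [count] at this
    exact h (by simpa [count] using this)
  · rintro ⟨t, ht, h⟩
    exact (count_pos ht h).ne'

theorem holds_cnt {i N : ℕ} {P : ℕ → Prop} (hN : N ≤ X)
    (hb : ∀ t, b.eval X mem (Function.update v i t) = N)
    (hP : ∀ t < N, e.Holds X mem (Function.update v i t) ↔ P t) :
    (cnt i b e).Holds X mem v ↔ ∃ t < N, P t := by
  rw [Holds, eval_cnt hN hb hP, count_ne_zero]

theorem holds_all {i N : ℕ} {P : ℕ → Prop} (hN : N ≤ X)
    (hb : ∀ t, b.eval X mem (Function.update v i t) = N)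
    (hP : ∀ t < N, e.Holds X mem (Function.update v i t) ↔ P t) :
    (all i b e).Holds X mem v ↔ ∀ t < N, P t := by
  rw [all, holds_not, holds_cnt (P := fun t => ¬ P t) hN hb fun t ht => by
    rw [holds_not, hP t ht]]
  push Not
  rfl

end Ex

/-- The variables `0, …, 3` and the banks `0`, `4`, `5` contain the data of the instance `I`. -/
structure Ctx (I : ClusterInstance) (X : ℕ) (mem : ℕ → ℕ → ℕ) (v : ℕ → ℕ) : Prop where
  m_eq : v 0 = I.m
  n_eq : v 1 = I.n
  B_eq : v 2 = I.B
  p_eq : v 1 - v 3 = I.p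
  m_le : I.m ≤ X
  n_lt : I.n + 1 < X
  n_pos : 0 < I.n
  B_lt : I.B < X
  K_lt : I.K < X
  entry_eq : ∀ l j, mem 0 (4 + (I.n * l + j)) = I.A l j
  table_eq : ∀ w s, mem 5 (I.K * w + s) = I.T w s
  pow_eq : ∀ t < X, mem 4 t = 2 ^ t

namespace Ctx

open Ex

variable {I : ClusterInstance} {X : ℕ} {mem : ℕ → ℕ → ℕ} {v : ℕ → ℕ}

theorem upd (h : Ctx I X mem v) {i : ℕ} (hi : 4 ≤ i) (x : ℕ) :
    Ctx I X mem (Function.update v i x) := by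
  have : ∀ k < 4, Function.update v i x k = v k := fun k hk =>
    Function.update_of_ne (by omega) _ _
  constructor <;> first
    | rw [this _ (by norm_num)]; first | exact h.m_eq | exact h.n_eq | exact h.B_eq
    | rw [this 1 (by norm_num), this 3 (by norm_num)]; exact h.p_eq
    | skip
  exacts [h.m_le, h.n_lt, h.n_pos, h.B_lt, h.K_lt, h.entry_eq, h.table_eq, h.pow_eq]

end Ctx

namespace Ex

/-- The entry in the row `l` and the column `j`. -/
def entry (l j : Ex) : Ex := .load 0 (.add (.const 4) (.add (.mul (.var 1) l) j))

/-- The entry of the table of letters. -/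
def table (K : ℕ) (w s : Ex) : Ex := .load 5 (.add (.mul (.const K) w) s)

def ne (a b : Ex) : Ex := .not (.eq a b)

/-- `Close` for the center in variable `8` and the column in variable `21`. -/
def close : Ex := .le (.cnt 20 (.var 0)
  (.ne (.entry (.var 20) (.var 21)) (.entry (.var 20) (.load 1 (.var 8))))) (.var 2)

/-- The column in variable `21` is counted by `deg`, for the center in variable `8`, the step in
variable `6` and the mask in variable `9`. -/
def inDeg : Ex := .and close (.all 22 (.var 6)
  (.or (.not (.mod (.div (.var 9) (.load 4 (.var 22))) (.const 2)))
    (.ne (.entry (.load 2 (.var 22)) (.var 21))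
      (.entry (.load 2 (.var 22)) (.load 1 (.var 8))))))

def deg : Ex := .cnt 21 (.var 1) inDeg

/-- `degWith` for the row in variable `c`. -/
def degWith (c : ℕ) : Ex := .cnt 21 (.var 1) (.and inDeg
  (.ne (.entry (.var c) (.var 21)) (.entry (.var c) (.load 1 (.var 8)))))

/-- `Consistent` for the row in variable `c`. -/
def consistent (K c : ℕ) : Ex := .cnt 24 (.const K) (.all 25 (.const K)
  (.or (.not (.lt (.load 1 (.var 25)) (.var 1)))
    (.eq (.table K (.var 24) (.var 25)) (.entry (.var c) (.load 1 (.var 25))))))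

/-- `Candidate` for the row in variable `c`. -/
def candidate (K c : ℕ) : Ex := .ite (.lt (.var 8) (.const K))
  (.le deg (.mul (degWith c) (.load 4 (.var 11)))) (.not (consistent K c))

/-- The candidate whose rank is in variable `12`. -/
def select (K : ℕ) : Ex := .sum 27 (.ite (.and (.lt (.var 27) (.var 0)) (.and (candidate K 27)
  (.eq (.cnt 26 (.var 27) (candidate K 26)) (.var 12)))) (.var 27) (.const 0))

/-- The entry of the center in variable `28` in the row in variable `20`. -/
def center (K : ℕ) : Ex := .ite (.load 3 (.var 20))
  (.table K (.sub (.load 3 (.var 20)) (.const 1)) (.var 28))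
  (.entry (.var 20) (.load 1 (.var 28)))

/-- `Near` for the distance in variable `29` and the column in variable `30`. -/
def near (K : ℕ) : Ex := .cnt 28 (.const K) (.and (.lt (.load 1 (.var 28)) (.var 1))
  (.le (.cnt 20 (.var 0) (.ne (.entry (.var 20) (.var 30)) (center K))) (.var 29)))

def accept (K : ℕ) : Ex := .and
  (.all 23 (.var 0) (.ite (.load 3 (.var 23)) (.le (.load 3 (.var 23)) (.const K))
    (consistent K 23)))
  (.le (.sum 29 (.ite (.lt (.var 29) (.var 0))
    (.sub (.sub (.var 1) (.var 3)) (.cnt 30 (.var 1) (near K))) (.const 0))) (.var 2))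

/-- The number of possible values of the digit `e`. -/
def logBase : Ex := .add (.const 1) (.cnt 24 (.var 1) (.le (.load 4 (.var 24)) (.var 1)))

end Ex

namespace Ctx

open Ex

variable {I : ClusterInstance} {X : ℕ} {mem : ℕ → ℕ → ℕ} {v : ℕ → ℕ}

theorem eval_entry (h : Ctx I X mem v) (l j : Ex) :
    (entry l j).eval X mem v = I.A (l.eval X mem v) (j.eval X mem v) := by
  have hn : (Ex.var 1).eval X mem v ≤ X := by
    simp only [Ex.eval, h.n_eq]
    exact (Nat.le_succ _).trans h.n_lt.le
  rw [← h.entry_eq]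
  change mem 0 (4 + (((Ex.var 1).mul l).eval X mem v + j.eval X mem v)) = _
  rw [eval_mul hn]
  simp only [Ex.eval, h.n_eq]

theorem eval_table (h : Ctx I X mem v) (w s : Ex) :
    (table I.K w s).eval X mem v = I.T (w.eval X mem v) (s.eval X mem v) := by
  rw [← h.table_eq]
  change mem 5 (((Ex.const I.K).mul w).eval X mem v + s.eval X mem v) = _
  rw [eval_mul (by simpa only [Ex.eval] using h.K_lt.le)]
  simp only [Ex.eval]

theorem holds_ne {a b : Ex} :
    (Ex.ne a b).Holds X mem v ↔ a.eval X mem v ≠ b.eval X mem v := by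
  rw [Ex.ne, holds_not, holds_eq]

theorem n_le (h : Ctx I X mem v) : I.n ≤ X := (Nat.le_succ _).trans h.n_lt.le

theorem holds_close (h : Ctx I X mem v) :
    close.Holds X mem v ↔ I.Close (mem 1) (v 8) (v 21) := by
  rw [close, holds_le, eval_cnt (P := fun l => I.A l (v 21) ≠ I.A l (mem 1 (v 8))) h.m_le
    (fun t => by simp [Ex.eval, h.m_eq]) fun t ht => ?_]
  · simp only [Ex.eval, h.B_eq, Close]
  · rw [holds_ne, (h.upd (by norm_num) t).eval_entry, (h.upd (by norm_num) t).eval_entry]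
    simp [Ex.eval]

/-- Bits of the mask are read by dividing by a tabulated power of two. The bounds keep the exponent
inside the table and the quotient untruncated. -/
theorem holds_inDeg (h : Ctx I X mem v) (hi : v 6 ≤ I.B) (hq : v 9 ≤ X) :
    inDeg.Holds X mem v ↔ I.Close (mem 1) (v 8) (v 21) ∧ ∀ k < v 6, (v 9).testBit k →
      I.A (mem 2 k) (v 21) ≠ I.A (mem 2 k) (mem 1 (v 8)) := by
  rw [inDeg, holds_and, h.holds_close, holds_all (N := v 6) (P := fun k => (v 9).testBit k →
      I.A (mem 2 k) (v 21) ≠ I.A (mem 2 k) (mem 1 (v 8))) (hi.trans h.B_lt.le)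
      (fun t => by simp [Ex.eval]) fun t ht => ?_]
  have hu := h.upd (i := 22) (by norm_num) t
  have hdiv : ((Ex.var 9).div (.load 4 (.var 22))).eval X mem (Function.update v 22 t) =
      v 9 / 2 ^ t := by
    have := h.B_lt
    rw [eval_div] <;> simp [Ex.eval, h.pow_eq t (by omega), hq]
  rw [holds_or, holds_not, holds_ne, hu.eval_entry, hu.eval_entry, Holds, eval_mod, hdiv,
    ← imp_iff_not_or, Nat.testBit_eq_decide_div_mod_eq, decide_eq_true_iff]
  · simp [Ex.eval]
  · rw [hdiv]
    exact (Nat.div_le_self _ _).trans hq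
  · simp [Ex.eval]

theorem eval_deg (h : Ctx I X mem v) (hi : v 6 ≤ I.B) (hq : v 9 ≤ X) :
    deg.eval X mem v = I.deg (mem 1) (mem 2) (v 6) (v 8) (v 9) := by
  rw [Ex.deg, ClusterInstance.deg]
  refine eval_cnt h.n_le (fun t => by simp [Ex.eval, h.n_eq]) fun t ht => ?_
  rw [(h.upd (by norm_num) t).holds_inDeg (by simpa) (by simpa)]
  simp

theorem eval_degWith (h : Ctx I X mem v) (hi : v 6 ≤ I.B) (hq : v 9 ≤ X) {c : ℕ} (hc : 25 < c) :
    (degWith c).eval X mem v = I.degWith (mem 1) (mem 2) (v 6) (v 8) (v 9) (v c) := by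
  rw [Ex.degWith, ClusterInstance.degWith]
  refine eval_cnt h.n_le (fun t => by simp [Ex.eval, h.n_eq]) fun t ht => ?_
  have hu := h.upd (i := 21) (by norm_num) t
  rw [holds_and, hu.holds_inDeg (by simpa) (by simpa), holds_ne, hu.eval_entry, hu.eval_entry]
  simp [Ex.eval, Function.update_of_ne (show c ≠ 21 by omega)]

theorem holds_consistent (h : Ctx I X mem v) {c : ℕ} (h24 : c ≠ 24) (h25 : c ≠ 25) :
    (consistent I.K c).Holds X mem v ↔ I.Consistent (mem 1) (v c) := by
  rw [consistent, Consistent]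
  refine holds_cnt h.K_lt.le (fun t => by simp [Ex.eval]) fun w hw => ?_
  refine holds_all h.K_lt.le (fun t => by simp [Ex.eval]) fun s hs => ?_
  have hu := (h.upd (i := 24) (by norm_num) w).upd (i := 25) (by norm_num) s
  rw [holds_or, holds_not, holds_lt, holds_eq, hu.eval_table, hu.eval_entry, ← imp_iff_not_or]
  simp [Ex.eval, h.n_eq, Function.update_of_ne h24, Function.update_of_ne h25]

theorem holds_candidate (h : Ctx I X mem v) (hi : v 6 ≤ I.B) (hq : v 9 ≤ X) (he : v 11 < X)
    {c : ℕ} (hc : 25 < c) : (candidate I.K c).Holds X mem v ↔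
      I.Candidate (mem 1) (mem 2) (v 6) (v 8) (v 9) (v 11) (v c) := by
  classical
  rw [candidate, holds_ite, holds_lt, holds_not, h.holds_consistent (by omega) (by omega), holds_le,
    h.eval_deg hi hq, eval_mul, h.eval_degWith hi hq hc, Candidate]
  · simp only [Ex.eval, h.pow_eq _ he, mul_comm]
  · rw [h.eval_degWith hi hq hc]
    exact (count_le _ _).trans h.n_le

/-- The rank strictly increases along the candidates, so the sum has a single summand with a true
condition, and its value is the row itself. -/
theorem eval_select (h : Ctx I X mem v) (hi : v 6 ≤ I.B) (hq : v 9 ≤ X) (he : v 11 < X) {r : ℕ}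
    (hr : r < I.m) (hcand : I.Candidate (mem 1) (mem 2) (v 6) (v 8) (v 9) (v 11) r)
    (hrank : count r (I.Candidate (mem 1) (mem 2) (v 6) (v 8) (v 9) (v 11)) = v 12) :
    (select I.K).eval X mem v = r := by
  classical
  set P := I.Candidate (mem 1) (mem 2) (v 6) (v 8) (v 9) (v 11) with hP
  have key : ∀ t, Ex.Holds X mem (.and (.lt (.var 27) (.var 0)) (.and (candidate I.K 27)
      (.eq (.cnt 26 (.var 27) (candidate I.K 26)) (.var 12)))) (Function.update v 27 t) ↔
      t < I.m ∧ P t ∧ count t P = v 12 := by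
    intro t
    have hu := h.upd (i := 27) (by norm_num) t
    rw [holds_and, holds_and, holds_lt, hu.holds_candidate (by simpa) (by simpa) (by simpa)
      (by norm_num), holds_eq]
    simp only [Ex.eval, Function.update_self]
    rw [Function.update_of_ne (by norm_num), h.m_eq]
    refine and_congr_right fun ht => ?_
    rw [eval_cnt (N := t) (P := P) (ht.le.trans h.m_le) (fun k => by simp [Ex.eval]) fun k hk => ?_]
    · simp [hP]
    · rw [(hu.upd (i := 26) (by norm_num) k).holds_candidate (by simpa) (by simpa) (by simpa)
        (by norm_num)]
      simp [hP]
  rw [select, Ex.eval]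
  simp only [eval_ite, key]
  rw [sum_eq_single r]
  · rw [if_pos ⟨hr, hcand, hrank⟩]
    simp [Ex.eval]
  · intro t _ htr
    rw [if_neg]
    · rfl
    · rintro ⟨h1, h2, h3⟩
      rcases lt_or_gt_of_ne htr with hlt | hlt
      · have := count_lt_count hlt h2
        omega
      · have := count_lt_count hlt hcand
        omega
  · intro hrX
    exact absurd (mem_range.2 (hr.trans_le h.m_le)) hrX

theorem eval_center (h : Ctx I X mem v) :
    (center I.K).eval X mem v = I.center (mem 1) (mem 3) (v 28) (v 20) := by
  classical
  rw [Ex.center, eval_ite, h.eval_table, h.eval_entry, ClusterInstance.center]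
  simp only [Holds, Ex.eval]
  split_ifs <;> simp_all

theorem holds_near (h : Ctx I X mem v) :
    (near I.K).Holds X mem v ↔ I.Near (mem 1) (mem 3) (v 29) (v 30) := by
  rw [near, Near]
  refine holds_cnt h.K_lt.le (fun t => by simp [Ex.eval]) fun s hs => ?_
  have hu := h.upd (i := 28) (by norm_num) s
  rw [holds_and, holds_lt, holds_le, eval_cnt (N := I.m)
    (P := fun l => I.A l (v 30) ≠ I.center (mem 1) (mem 3) s l) h.m_le
    (fun t => by simp [Ex.eval, h.m_eq]) fun l hl => ?_]
  · simp [Ex.eval, h.n_eq]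
  · have huu := hu.upd (i := 20) (by norm_num) l
    rw [holds_ne, huu.eval_entry, huu.eval_center]
    simp [Ex.eval]

theorem holds_accept (h : Ctx I X mem v) :
    (accept I.K).Holds X mem v ↔ I.Accept (mem 1) (mem 3) := by
  classical
  rw [accept, Accept, holds_and]
  refine and_congr (holds_all h.m_le (fun t => by simp [Ex.eval, h.m_eq]) fun l hl => ?_) ?_
  · rw [holds_ite, holds_le, (h.upd (by norm_num) l).holds_consistent (by norm_num) (by norm_num)]
    simp only [Holds, Ex.eval, Function.update_self]
    by_cases h0 : mem 3 l = 0 <;> simp [h0]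
  · rw [holds_le]
    have : ∀ δ, (Ex.ite (.lt (.var 29) (.var 0)) (.sub (.sub (.var 1) (.var 3))
        (.cnt 30 (.var 1) (near I.K))) (.const 0)).eval X mem (Function.update v 29 δ) =
        if δ < I.m then I.p - count I.n (I.Near (mem 1) (mem 3) δ) else 0 := by
      intro δ
      have hu := h.upd (i := 29) (by norm_num) δ
      rw [eval_ite, holds_lt]
      simp only [Ex.eval, hu.p_eq, hu.m_eq, Function.update_self]
      rw [eval_cnt (P := I.Near (mem 1) (mem 3) δ) h.n_le (fun t => by simp [Ex.eval, h.n_eq])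
        fun j hj => ?_]
      rw [(hu.upd (i := 30) (by norm_num) j).holds_near]
      simp
    change ∑ δ ∈ range X, _ ≤ v 2 ↔ _
    rw [h.B_eq, sum_congr rfl fun δ _ => this δ, ← sum_filter]
    have hf : {δ ∈ range X | δ < I.m} = range I.m := by
      ext δ
      have := h.m_le
      simp only [mem_filter, mem_range]
      omega
    rw [hf]

theorem eval_logBase (h : Ctx I X mem v) : logBase.eval X mem v = Nat.log 2 I.n + 2 := by
  classical
  rw [logBase, Ex.eval, eval_cnt (P := fun t => 2 ^ t ≤ I.n) h.n_le
    (fun t => by simp [Ex.eval, h.n_eq]) fun t ht => ?_]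
  · have : {t ∈ range I.n | 2 ^ t ≤ I.n} = range (Nat.log 2 I.n + 1) := by
      ext t
      simp only [mem_filter, mem_range, Nat.lt_succ_iff]
      rw [Nat.le_log_iff_pow_le (by norm_num) h.n_pos.ne']
      exact ⟨fun h => h.2, fun h => ⟨(Nat.lt_two_pow_self).trans_le h, h⟩⟩
    have hc : count I.n (fun t => 2 ^ t ≤ I.n) = Nat.log 2 I.n + 1 := by
      rw [count, ← card_range (Nat.log 2 I.n + 1), ← this]
      congr
    rw [hc, Ex.eval]
    omega
  · have := h.n_le
    rw [holds_le]
    simp [Ex.eval, h.pow_eq t (by omega), h.n_eq]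

end Ctx

end RAM

/-! ### The decoder and one decoding step -/

namespace RAM

open ClusterInstance Finset

theorem Ctx.congr {I : ClusterInstance} {X : ℕ} {mem mem' : ℕ → ℕ → ℕ} {v v' : ℕ → ℕ}
    (h : Ctx I X mem v) (hv : ∀ i < 4, v' i = v i) (h0 : mem' 0 = mem 0) (h4 : mem' 4 = mem 4)
    (h5 : mem' 5 = mem 5) : Ctx I X mem' v' := by
  refine ⟨?_, ?_, ?_, ?_, h.m_le, h.n_lt, h.n_pos, h.B_lt, h.K_lt, ?_, ?_, ?_⟩
  · rw [hv 0 (by norm_num), h.m_eq]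
  · rw [hv 1 (by norm_num), h.n_eq]
  · rw [hv 2 (by norm_num), h.B_eq]
  · rw [hv 1 (by norm_num), hv 3 (by norm_num), h.p_eq]
  · rw [h0]; exact h.entry_eq
  · rw [h5]; exact h.table_eq
  · rw [h4]; exact h.pow_eq

/-- The statement preserves the data of the instance. -/
def Stmt.Safe (p : Stmt) : Prop :=
  (∀ i < 4, p.KeepsVar i) ∧ p.KeepsBank 0 ∧ p.KeepsBank 4 ∧ p.KeepsBank 5

theorem Stmt.Safe.ctx {p : Stmt} (hp : p.Safe) {I : ClusterInstance} {X : ℕ} {σ : Config}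
    (h : Ctx I X σ.mem σ.reg) : Ctx I X (p.eval X σ).mem (p.eval X σ).reg :=
  h.congr (fun i hi => Stmt.eval_reg (hp.1 i hi) σ) (Stmt.eval_mem hp.2.1 σ)
    (Stmt.eval_mem hp.2.2.1 σ) (Stmt.eval_mem hp.2.2.2 σ)

namespace Stmt

open Ex

/-- Split the number in variable `5` into its last digit in base `b` and the rest. -/
def takeDigit (i : ℕ) (b : Ex) : Stmt :=
  .seq (.assign i (.mod (.var 5) b)) (.assign 5 (.div (.var 5) b))

/-- Decode one deviating row and its letter. -/
def step (K : ℕ) : Stmt :=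
  .seq (takeDigit 8 (.const (K + 1))) <| .seq (takeDigit 9 (.load 4 (.var 2))) <|
  .seq (takeDigit 10 (.const (K + 1))) <| .seq (takeDigit 11 logBase) <|
  .seq (takeDigit 12 (.mul (.var 2) (.load 4 (.var 11)))) <|
  .seq (.assign 13 (select K)) <| .seq (.store 2 (.var 6) (.var 13)) <|
  .ite (.var 10) (.store 3 (.var 13) (.var 10)) .skip

/-- Banks `1`, `2`, `3` hold the columns `a`, the rows `V` and the letters `W`. Variable `5` is the
unread rest of the code, and variable `6` is the index of the running loop. -/
def decodeColumn : Stmt :=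
  .seq (takeDigit 13 (.add (.var 1) (.const 1))) (.store 1 (.var 6) (.var 13))

def decodeColumns (K : ℕ) : Stmt :=
  .loop 6 (.ite (.lt (.var 6) (.const K)) decodeColumn .skip)

def clearLetters : Stmt := .loop 6 (.store 3 (.var 6) (.const 0))

def decodeRows (K : ℕ) : Stmt := .loop 6 (.ite (.lt (.var 6) (.var 2)) (step K) .skip)

/-- Decode the number in variable `4`. -/
def decode (K : ℕ) : Stmt :=
  .seq (.assign 5 (.var 4)) <| .seq (decodeColumns K) <| .seq clearLetters (decodeRows K)

/-- Test all codes below the limit. -/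
def search (K : ℕ) : Stmt :=
  .loop 4 (.seq (decode K) (.ite (accept K) (.assign 7 (.const 1)) .skip))

variable {I : ClusterInstance} {X : ℕ}

/-- The base is evaluated twice, the second time after the digit has been assigned; hence two
hypotheses on its value. -/
theorem eval_takeDigit {i d β z : ℕ} {b : Ex} {σ : Config} (hi : i ≠ 5) (hX : σ.reg 5 ≤ X)
    (hx : σ.reg 5 = d + β * z) (hd : d < β) (hb : b.eval X σ.mem σ.reg = β)
    (hb' : b.eval X σ.mem (Function.update σ.reg i d) = β) :
    (takeDigit i b).eval X σ = (σ.setVar i d).setVar 5 z := by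
  have h1 : (Ex.mod (.var 5) b).eval X σ.mem σ.reg = d := by
    rw [eval_mod hX (by omega), hb]
    simp only [Ex.eval]
    rw [hx, Nat.add_mul_mod_self_left, Nat.mod_eq_of_lt hd]
  have hr : (Ex.var 5).eval X σ.mem (Function.update σ.reg i d) = σ.reg 5 := by
    simp [Ex.eval, Function.update_of_ne hi.symm]
  have h2 : (Ex.div (.var 5) b).eval X σ.mem (Function.update σ.reg i d) = z := by
    rw [eval_div (by rwa [hr]) (by omega), hb', hr, hx, Nat.add_mul_div_left _ _ (by omega),
      Nat.div_eq_of_lt hd, zero_add]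
  simp only [takeDigit, Stmt.eval, h1, Config.setVar, h2]

/-- The number with the digits `g` in front of the digits of `z`. -/
def _root_.ClusterInstance.combine (I : ClusterInstance) (g : Digits) (z : ℕ) : ℕ :=
  g.s + (I.K + 1) * (g.q + 2 ^ I.B * (g.w + (I.K + 1) * (g.e + (Nat.log 2 I.n + 2) *
    (g.p + I.B * 2 ^ g.e * z))))

theorem le_add_mul {d β z : ℕ} (hβ : 0 < β) : z ≤ d + β * z :=
  (Nat.le_mul_of_pos_left z hβ).trans (Nat.le_add_left _ _)

/-- The row `r` is only characterized conditionally, because the step is also executed on zero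
digits after the certificate has been read. Then `r` may be arbitrary, but `w = 0` prevents a letter
from being written. -/
theorem eval_step {σ : Config} (h : Ctx I X σ.mem σ.reg) {i z : ℕ} {g : Digits}
    (hi : σ.reg 6 = i) (hiB : i < I.B) (hx : σ.reg 5 = I.combine g z) (hX : σ.reg 5 ≤ X)
    (hs : g.s ≤ I.K) (hq : g.q < 2 ^ I.B) (hw : g.w ≤ I.K) (he : g.e ≤ Nat.log 2 I.n + 1)
    (hp : g.p < I.B * 2 ^ g.e) :
    ∃ r, (∀ r' < I.m, I.Candidate (σ.mem 1) (σ.mem 2) i g.s g.q g.e r' →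
        count r' (I.Candidate (σ.mem 1) (σ.mem 2) i g.s g.q g.e) = g.p → r = r') ∧
      ((step I.K).eval X σ).reg 5 = z ∧
      ((step I.K).eval X σ).mem 2 = Function.update (σ.mem 2) i r ∧
      ((step I.K).eval X σ).mem 3 =
        if g.w = 0 then σ.mem 3 else Function.update (σ.mem 3) r g.w := by
  set x5 := z with hx5
  set x4 := g.p + I.B * 2 ^ g.e * x5 with hx4
  set x3 := g.e + (Nat.log 2 I.n + 2) * x4 with hx3
  set x2 := g.w + (I.K + 1) * x3 with hx2
  set x1 := g.q + 2 ^ I.B * x2 with hx1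
  have e0 : σ.reg 5 = g.s + (I.K + 1) * x1 := hx
  have l1 : x1 ≤ X := le_trans (le_add_mul (Nat.succ_pos _)) (e0 ▸ hX)
  have l2 : x2 ≤ X := le_trans (le_add_mul (Nat.two_pow_pos _)) (hx1 ▸ l1)
  have l3 : x3 ≤ X := le_trans (le_add_mul (Nat.succ_pos _)) (hx2 ▸ l2)
  have l4 : x4 ≤ X := le_trans (le_add_mul (Nat.succ_pos _)) (hx3 ▸ l3)
  have hlog : Nat.log 2 I.n < I.n := Nat.log_lt_self 2 h.n_pos.ne'
  have heX : g.e < X := by have := h.n_lt; omega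
  have hqX : g.q ≤ X := le_trans (Nat.le_add_right _ _) (hx1 ▸ l1)
  have hset : ∀ (τ : Config) (c x : ℕ), 4 ≤ c → Ctx I X τ.mem τ.reg →
      Ctx I X (τ.setVar c x).mem (τ.setVar c x).reg := fun τ c x hc hτ => hτ.upd hc x
  have s1 : (takeDigit 8 (.const (I.K + 1))).eval X σ = (σ.setVar 8 g.s).setVar 5 x1 :=
    eval_takeDigit (by norm_num) hX e0 (by omega) rfl rfl
  set σ1 := (σ.setVar 8 g.s).setVar 5 x1 with hσ1
  have c1 : Ctx I X σ1.mem σ1.reg :=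
    hset _ _ _ (by norm_num) (hset _ _ _ (by norm_num) h)
  have s2 : (takeDigit 9 (.load 4 (.var 2))).eval X σ1 = (σ1.setVar 9 g.q).setVar 5 x2 :=
    eval_takeDigit (β := 2 ^ I.B) (by norm_num) (by simpa [hσ1, Config.setVar])
      (by simp [hσ1, Config.setVar, hx1]) hq
      (by simp only [Ex.eval, c1.B_eq, c1.pow_eq _ c1.B_lt])
      (by simp [Ex.eval, c1.B_eq, c1.pow_eq _ c1.B_lt])
  set σ2 := (σ1.setVar 9 g.q).setVar 5 x2 with hσ2
  have c2 : Ctx I X σ2.mem σ2.reg :=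
    hset _ _ _ (by norm_num) (hset _ _ _ (by norm_num) c1)
  have s3 : (takeDigit 10 (.const (I.K + 1))).eval X σ2 = (σ2.setVar 10 g.w).setVar 5 x3 :=
    eval_takeDigit (β := I.K + 1) (by norm_num) (by simpa [hσ2, Config.setVar])
      (by simp [hσ2, Config.setVar, hx2]) (by omega) rfl rfl
  set σ3 := (σ2.setVar 10 g.w).setVar 5 x3 with hσ3
  have c3 : Ctx I X σ3.mem σ3.reg :=
    hset _ _ _ (by norm_num) (hset _ _ _ (by norm_num) c2)
  have s4 : (takeDigit 11 logBase).eval X σ3 = (σ3.setVar 11 g.e).setVar 5 x4 :=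
    eval_takeDigit (β := Nat.log 2 I.n + 2) (by norm_num) (by simpa [hσ3, Config.setVar])
      (by simp [hσ3, Config.setVar, hx3]) (by omega) c3.eval_logBase
      (c3.upd (by norm_num) _).eval_logBase
  set σ4 := (σ3.setVar 11 g.e).setVar 5 x4 with hσ4
  have c4 : Ctx I X σ4.mem σ4.reg :=
    hset _ _ _ (by norm_num) (hset _ _ _ (by norm_num) c3)
  have b5 : ∀ v : ℕ → ℕ, Ctx I X σ4.mem v → v 11 = g.e →
      (Ex.mul (.var 2) (.load 4 (.var 11))).eval X σ4.mem v = I.B * 2 ^ g.e := by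
    intro v hv hve
    rw [eval_mul (by simpa only [Ex.eval, hv.B_eq] using hv.B_lt.le)]
    simp only [Ex.eval, hv.B_eq, hve, hv.pow_eq _ heX]
  have s5 : (takeDigit 12 (.mul (.var 2) (.load 4 (.var 11)))).eval X σ4 =
      (σ4.setVar 12 g.p).setVar 5 x5 :=
    eval_takeDigit (by norm_num) (by simpa [hσ4, Config.setVar])
      (by simp [hσ4, Config.setVar, hx4]) hp
      (b5 _ c4 (by simp [hσ4, Config.setVar])) (b5 _ (c4.upd (by norm_num) _)
        (by simp [hσ4, Config.setVar]))
  set σ5 := (σ4.setVar 12 g.p).setVar 5 x5 with hσ5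
  have c5 : Ctx I X σ5.mem σ5.reg :=
    hset _ _ _ (by norm_num) (hset _ _ _ (by norm_num) c4)
  have m5 : σ5.mem = σ.mem := rfl
  have r5 : σ5.reg 5 = z ∧ σ5.reg 6 = i ∧ σ5.reg 8 = g.s ∧ σ5.reg 9 = g.q ∧ σ5.reg 10 = g.w ∧
      σ5.reg 11 = g.e ∧ σ5.reg 12 = g.p := by
    simp [hσ5, hσ4, hσ3, hσ2, hσ1, Config.setVar, hi, hx5]
  obtain ⟨q5, q6, q8, q9, q10, q11, q12⟩ := r5
  refine ⟨(select I.K).eval X σ5.mem σ5.reg, fun r' hr' hc hrk => ?_, ?_, ?_, ?_⟩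
  · refine c5.eval_select (by omega) (by omega) (by omega) hr' ?_ ?_
    · rwa [q6, q8, q9, q11]
    · rwa [q6, q8, q9, q11, q12]
  all_goals
    simp only [step, Stmt.eval, s1, s2, s3, s4, s5, Ex.eval]
    split_ifs <;> simp_all [Config.setVar, Config.setMem]

end Stmt

end RAM

/-! ### Locality of the predicates and the size of the codes -/

namespace ClusterInstance

open Finset

variable {I : ClusterInstance} {a a' V V' W W' : ℕ → ℕ}

theorem consistent_congr (ha : ∀ s < I.K, a' s = a s) (l : ℕ) :
    I.Consistent a' l ↔ I.Consistent a l :=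
  exists_congr fun w => and_congr_right fun _ => forall₂_congr fun s hs => by rw [ha s hs]

/-- The decoder knows only the columns and the earlier rows when it looks for row `i`; this is all
that the candidates depend on. -/
theorem candidate_congr (ha : ∀ s < I.K, a' s = a s) {i : ℕ} (hV : ∀ k < i, V' k = V k)
    (s q e v : ℕ) : I.Candidate a' V' i s q e v ↔ I.Candidate a V i s q e v := by
  unfold Candidate
  by_cases hs : s < I.K
  · have h : ∀ x, (I.Close a' s x ∧ ∀ k < i, q.testBit k →
        I.A (V' k) x ≠ I.A (V' k) (a' s)) ↔ (I.Close a s x ∧ ∀ k < i, q.testBit k →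
        I.A (V k) x ≠ I.A (V k) (a s)) := fun x => by
      unfold Close
      rw [ha s hs]
      exact and_congr_right fun _ => forall₂_congr fun k hk => by rw [hV k hk]
    have h1 : I.deg a' V' i s q = I.deg a V i s q := count_congr fun x _ => h x
    have h2 : I.degWith a' V' i s q v = I.degWith a V i s q v := count_congr fun x _ => by
      rw [h x, ha s hs]
    rw [if_pos hs, if_pos hs, h1, h2]
  · rw [if_neg hs, if_neg hs, consistent_congr ha]

theorem accept_congr (ha : ∀ s < I.K, a' s = a s) (hW : ∀ l < I.m, W' l = W l) :
    I.Accept a' W' ↔ I.Accept a W := by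
  have hnear : ∀ δ j, I.Near a' W' δ j ↔ I.Near a W δ j := fun δ j =>
    exists_congr fun s => and_congr_right fun hs => by
      rw [ha s hs, count_congr fun l hl => show (I.A l j ≠ I.center a' W' s l) ↔
        I.A l j ≠ I.center a W s l by rw [center, center, hW l hl, ha s hs]]
  refine and_congr (forall₂_congr fun l hl => by rw [hW l hl, consistent_congr ha]) ?_
  have : ∀ δ, count I.n (I.Near a' W' δ) = count I.n (I.Near a W δ) := fun δ =>
    count_congr fun j _ => hnear δ j
  simp only [this]

theorem digit_lt {d b x β : ℕ} (hd : d < b) (hx : x < β) : d + b * x < b * β := by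
  calc d + b * x < b + b * x := by omega
    _ = b * (x + 1) := by ring
    _ ≤ b * β := Nat.mul_le_mul_left b hx

variable (I) in
/-- A bound on the codes of certificates. -/
def codeBound : ℕ :=
  (I.n + 1) ^ I.K * (((I.K + 1) ^ 2 * 2 ^ I.B * (Nat.log 2 I.n + 2) * I.B) ^ I.B *
    2 ^ (I.B + 2 * I.K * Nat.log 2 I.n))

/-- The base of the rank digit is `B * 2 ^ e`, where `e` is the preceding digit. Therefore the
product of all bases contains two to the sum of the exponents, not to `t` times the largest one. -/
theorem Certificate.exists_code {t : ℕ} {g : ℕ → Digits} (h : I.Certificate a W V t g) :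
    ∃ y u : ℕ → ℕ, (∀ i < t, y i = I.combine (g i) (y (i + 1))) ∧ (∀ i, t ≤ i → y i = 0) ∧
      (∀ s < I.K, u s = a s + (I.n + 1) * u (s + 1)) ∧ (∀ s, I.K ≤ s → u s = y 0) ∧
      u 0 < I.codeBound := by
  set R := (I.K + 1) ^ 2 * 2 ^ I.B * (Nat.log 2 I.n + 2) * I.B with hR
  obtain ⟨y, y1, y2, y3⟩ := ClusterInstance.exists_code t 0 1 one_pos
    (fun i x => I.combine (g i) x) (fun i => R * 2 ^ (g i).e) fun i hi x β hx => by
      have hv := h.valid i hi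
      have := digit_lt (Nat.lt_succ_of_le hv.s_le) (digit_lt hv.q_lt
        (digit_lt (Nat.lt_succ_of_le hv.w_le) (digit_lt (Nat.lt_succ_of_le hv.e_le)
        (digit_lt hv.p_lt hx))))
      refine this.trans_eq ?_
      rw [hR]
      simp only [Nat.succ_eq_add_one]
      ring
  obtain ⟨u, u1, u2, u3⟩ := ClusterInstance.exists_code I.K (y 0) _ y3
    (fun s x => a s + (I.n + 1) * x) (fun _ => I.n + 1) fun s _ x β hx =>
      digit_lt (Nat.lt_succ_of_le (h.a_le s)) hx
  refine ⟨y, u, y1, y2, u1, u2, u3.trans_le ?_⟩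
  rw [prod_const, card_range, mul_one, prod_mul_distrib, prod_const, card_range,
    prod_pow_eq_pow_sum, codeBound]
  refine Nat.mul_le_mul_left _ (Nat.mul_le_mul ?_ (Nat.pow_le_pow_right (by norm_num) h.sum_le))
  -- For `B = 0` the base `R` is zero and powers of it are not monotone in the exponent, but then `t
  -- = 0`.
  rcases Nat.eq_zero_or_pos I.B with h0 | h0
  · obtain rfl : t = 0 := Nat.le_zero.1 (h0 ▸ h.t_le)
    rw [h0, pow_zero, pow_zero]
  · exact Nat.pow_le_pow_right (by positivity) h.t_le

end ClusterInstance

/-! ### Correctness of decoding and of the exhaustive search -/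

namespace RAM

open ClusterInstance Finset

namespace Stmt

open Ex

variable {I : ClusterInstance} {X : ℕ}

theorem safe_decode (K : ℕ) : (decode K).Safe := by
  simp [Safe, decode, decodeColumns, decodeColumn, clearLetters, decodeRows, step, takeDigit,
    KeepsVar, KeepsBank]
  omega

theorem ite_eval {e : Ex} {p q : Stmt} {σ : Config} [Decidable (e.Holds X σ.mem σ.reg)] :
    (Stmt.ite e p q).eval X σ =
      if e.Holds X σ.mem σ.reg then p.eval X σ else q.eval X σ := by
  rw [Stmt.eval]
  exact if_congr Iff.rfl rfl rfl

theorem eval_decodeColumns {σ : Config} (h : Ctx I X σ.mem σ.reg) {a u : ℕ → ℕ}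
    (ha : ∀ s < I.K, a s ≤ I.n) (hu : ∀ s < I.K, u s = a s + (I.n + 1) * u (s + 1))
    (hX : u 0 ≤ X) (hσ : σ.reg 5 = u 0) :
    ((decodeColumns I.K).eval X σ).reg 5 = u I.K ∧
      ∀ s < I.K, ((decodeColumns I.K).eval X σ).mem 1 s = a s := by
  classical
  -- The loop makes `X` passes but acts only in the first `K`; hence the index `min j I.K` in the
  -- invariant.
  have key := iterate_induction (X := X) (f := fun t (τ : Config) =>
    (Stmt.ite (.lt (.var 6) (.const I.K)) decodeColumn .skip).eval X (τ.setVar 6 t))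
    (x := σ) (fun j (τ : Config) => Ctx I X τ.mem τ.reg ∧ τ.reg 5 = u (min j I.K) ∧ τ.reg 5 ≤ X ∧
      ∀ s < min j I.K, τ.mem 1 s = a s) ⟨h, by simpa, by omega, by simp⟩ ?_
  · obtain ⟨-, h1, -, h2⟩ := key
    rw [min_eq_right h.K_lt.le] at h1 h2
    exact ⟨h1, h2⟩
  · rintro j τ hj ⟨c, e1, e2, e3⟩
    rw [ite_eval, holds_lt]
    simp only [Ex.eval, Config.setVar, Function.update_self]
    split_ifs with hjK
    · rw [min_eq_left hjK.le] at e1 e3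
      rw [min_eq_left hjK]
      have hd := hu j hjK
      have ht : (takeDigit 13 (.add (.var 1) (.const 1))).eval X (τ.setVar 6 j) =
          ((τ.setVar 6 j).setVar 13 (a j)).setVar 5 (u (j + 1)) :=
        eval_takeDigit (β := I.n + 1) (by norm_num) (by simpa [Config.setVar])
          (by simp [Config.setVar, e1, hd]) (Nat.lt_succ_of_le (ha j hjK))
          (by simp [Ex.eval, Config.setVar, c.n_eq]) (by simp [Ex.eval, Config.setVar, c.n_eq])
      have hev : decodeColumn.eval X (τ.setVar 6 j) =
          (((τ.setVar 6 j).setVar 13 (a j)).setVar 5 (u (j + 1))).setMem 1 j (a j) := by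
        rw [decodeColumn, Stmt.eval, ht]
        simp [Stmt.eval, Ex.eval, Config.setVar]
      have hle : u (j + 1) ≤ u j := hd ▸ le_add_mul (Nat.succ_pos _)
      change Ctx I X (decodeColumn.eval X (τ.setVar 6 j)).mem
        (decodeColumn.eval X (τ.setVar 6 j)).reg ∧ (decodeColumn.eval X (τ.setVar 6 j)).reg 5 = _ ∧
        (decodeColumn.eval X (τ.setVar 6 j)).reg 5 ≤ X ∧
        ∀ s < _, (decodeColumn.eval X (τ.setVar 6 j)).mem 1 s = a s
      rw [hev]
      refine ⟨c.congr (fun i hi => ?_) rfl rfl rfl, ?_, ?_, fun s hs => ?_⟩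
      · simp [Config.setVar, Config.setMem, show i ≠ 5 by omega,
          show i ≠ 13 by omega, show i ≠ 6 by omega]
      · simp [Config.setVar, Config.setMem]
      · simp only [Config.setVar, Config.setMem, Function.update_self]
        omega
      · simp only [Config.setVar, Config.setMem, Function.update_self]
        rcases Nat.lt_succ_iff_lt_or_eq.1 hs with hs | rfl
        · rw [Function.update_of_ne hs.ne, e3 s hs]
        · rw [Function.update_self]
    · rw [min_eq_right (not_lt.1 hjK)] at e1 e3
      rw [min_eq_right (by omega)]
      exact ⟨c.upd (by norm_num) j, by simpa [Stmt.eval], by simpa [Stmt.eval],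
        by simpa [Stmt.eval]⟩

theorem eval_clearLetters (σ : Config) :
    ∀ l < X, (clearLetters.eval X σ).mem 3 l = 0 := by
  refine iterate_induction (X := X) (fun j (τ : Config) => ∀ l < j, τ.mem 3 l = 0)
    (by simp) ?_
  intro j τ hj h l hl
  simp only [Stmt.eval, Config.setMem, Config.setVar, Ex.eval, Function.update_self]
  rcases Nat.lt_succ_iff_lt_or_eq.1 hl with hl | rfl
  · rw [Function.update_of_ne hl.ne, h l hl]
  · rw [Function.update_self]

theorem eval_decodeRows {σ : Config} (h : Ctx I X σ.mem σ.reg) {a W V : ℕ → ℕ} {t : ℕ}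
    {g : ℕ → Digits} (hc : I.Certificate a W V t g) {y : ℕ → ℕ}
    (hy : ∀ i < t, y i = I.combine (g i) (y (i + 1))) (hy0 : ∀ i, t ≤ i → y i = 0)
    (hX : y 0 ≤ X) (hσ : σ.reg 5 = y 0) (ha : ∀ s < I.K, σ.mem 1 s = a s)
    (hW : ∀ l < I.m, σ.mem 3 l = 0) :
    ∀ l < I.m, ((decodeRows I.K).eval X σ).mem 3 l = W l := by
  classical
  have key := iterate_induction (X := X) (f := fun j (τ : Config) =>
    (Stmt.ite (.lt (.var 6) (.var 2)) (step I.K) .skip).eval X (τ.setVar 6 j))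
    (x := σ) (fun j (τ : Config) => Ctx I X τ.mem τ.reg ∧ τ.mem 1 = σ.mem 1 ∧
      τ.reg 5 = y (min j I.B) ∧ τ.reg 5 ≤ X ∧ (∀ k < min j t, τ.mem 2 k = V k) ∧
      ∀ l < I.m, τ.mem 3 l = if ∃ k < min j t, V k = l then W l else 0)
    ⟨h, rfl, by simpa, by omega, by simp, by simpa⟩ ?_
  · obtain ⟨-, -, -, -, -, h2⟩ := key
    intro l hl
    refine (h2 l hl).trans ?_
    rw [min_eq_right (hc.t_le.trans h.B_lt.le)]
    split_ifs with hex
    · rfl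
    · push Not at hex
      exact (hc.letter_zero l hl hex).symm
  · rintro j τ hj ⟨c, e1, e2, e3, e4, e5⟩
    have c' : Ctx I X (τ.setVar 6 j).mem (τ.setVar 6 j).reg := c.upd (by norm_num) j
    have htB := hc.t_le
    rw [ite_eval, holds_lt]
    simp only [Ex.eval, c'.B_eq]
    simp only [Config.setVar, Function.update_self]
    split_ifs with hjB
    · change Ctx I X ((step I.K).eval X (τ.setVar 6 j)).mem
        ((step I.K).eval X (τ.setVar 6 j)).reg ∧
        ((step I.K).eval X (τ.setVar 6 j)).mem 1 = _ ∧
        ((step I.K).eval X (τ.setVar 6 j)).reg 5 = _ ∧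
        ((step I.K).eval X (τ.setVar 6 j)).reg 5 ≤ _ ∧
        (∀ k < _, ((step I.K).eval X (τ.setVar 6 j)).mem 2 k = _) ∧
        (∀ l < _, ((step I.K).eval X (τ.setVar 6 j)).mem 3 l = _)
      have hsafe : (step I.K).Safe := by
        simp [Safe, step, takeDigit, KeepsVar, KeepsBank]
        omega
      have hk1 : (step I.K).KeepsBank 1 := by
        simp [step, takeDigit, KeepsBank]
      rw [min_eq_left hjB.le] at e2
      rw [min_eq_left (show j + 1 ≤ I.B from hjB)]
      have h5 : (τ.setVar 6 j).reg 5 = τ.reg 5 := by simp [Config.setVar]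
      have h6 : (τ.setVar 6 j).reg 6 = j := by simp [Config.setVar]
      by_cases hjt : j < t
      · rw [min_eq_left hjt.le] at e4 e5
        rw [min_eq_left (show j + 1 ≤ t from hjt)]
        have hv := hc.valid j hjt
        obtain ⟨r, r1, r2, r3, r4⟩ := eval_step c' h6 hjB (h5.trans (e2.trans (hy j hjt)))
          (h5 ▸ e3) hv.s_le hv.q_lt hv.w_le hv.e_le hv.p_lt
        -- The rows already decoded agree with the certificate, so the machine sees the same
        -- candidates and the rank picks out `V j`.
        have hca : ∀ v, I.Candidate (τ.mem 1) (τ.mem 2) j (g j).s (g j).q (g j).e v ↔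
            I.Candidate a V j (g j).s (g j).q (g j).e v := fun v =>
          candidate_congr (fun s hs => by rw [e1, ha s hs]) e4 _ _ _ v
        obtain rfl : r = V j := r1 (V j) hv.row_lt ((hca _).2 hv.cand)
          ((count_congr fun v _ => hca v).trans hv.rank)
        refine ⟨hsafe.ctx c', ?_, r2, ?_, fun k hk => ?_, fun l hl => ?_⟩
        · rw [eval_mem hk1]
          exact e1
        · have hB : 0 < I.B * 2 ^ (g j).e := lt_of_le_of_lt (Nat.zero_le _) hv.p_lt
          have hle : y (j + 1) ≤ y j := by
            rw [hy j hjt]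
            exact le_trans (le_add_mul hB) <| le_trans (le_add_mul (Nat.succ_pos _)) <|
              le_trans (le_add_mul (Nat.succ_pos _)) <|
              le_trans (le_add_mul (Nat.two_pow_pos _)) (le_add_mul (Nat.succ_pos _))
          omega
        · rw [r3]
          rcases Nat.lt_succ_iff_lt_or_eq.1 hk with hk | rfl
          · rw [Function.update_of_ne hk.ne]
            exact e4 k hk
          · rw [Function.update_self]
        · rw [r4, if_neg hv.w_pos.ne']
          by_cases hl' : l = V j
          · subst hl'
            rw [Function.update_self, if_pos ⟨j, Nat.lt_succ_self j, rfl⟩, hc.letter j hjt]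
          · rw [Function.update_of_ne hl']
            refine (e5 l hl).trans (if_congr ?_ rfl rfl)
            refine exists_congr fun k => ?_
            constructor
            · rintro ⟨h1, h2⟩
              exact ⟨by omega, h2⟩
            · rintro ⟨h1, h2⟩
              refine ⟨?_, h2⟩
              rcases Nat.lt_succ_iff_lt_or_eq.1 h1 with h1 | rfl
              · exact h1
              · exact absurd h2.symm hl'
      -- Past the last deviating row the rest of the code is `0`. It splits into zero digits, and
      -- the only effects on the decoded data are cells of bank `2` that are not needed any more.
      · have hjt' : t ≤ j := not_lt.1 hjt
        rw [min_eq_right hjt'] at e4 e5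
        rw [min_eq_right (by omega), hy0 (j + 1) (by omega)]
        have hx : (τ.setVar 6 j).reg 5 = I.combine ⟨0, 0, 0, 0, 0⟩ 0 := by
          rw [h5, e2, hy0 j hjt']
          simp [combine]
        obtain ⟨r, -, r2, r3, r4⟩ := eval_step c' h6 hjB hx (h5 ▸ e3) (Nat.zero_le _)
          (Nat.two_pow_pos _) (Nat.zero_le _) (Nat.zero_le _) (by simpa using by omega)
        refine ⟨hsafe.ctx c', ?_, r2, by omega, fun k hk => ?_, fun l hl => ?_⟩
        · rw [eval_mem hk1]
          exact e1
        · rw [r3, Function.update_of_ne (by omega)]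
          exact e4 k hk
        · rw [r4, if_pos rfl]
          exact e5 l hl
    · rw [min_eq_right (not_lt.1 hjB)] at e2
      rw [min_eq_right (show t ≤ j by omega)] at e4 e5
      rw [min_eq_right (by omega), min_eq_right (show t ≤ j + 1 by omega)]
      exact ⟨c', e1, by simpa [Stmt.eval], by simpa [Stmt.eval], e4, e5⟩

theorem eval_decode {σ : Config} (h : Ctx I X σ.mem σ.reg) {a W V : ℕ → ℕ} {t : ℕ}
    {g : ℕ → Digits} (hc : I.Certificate a W V t g) {y u : ℕ → ℕ}
    (hy : ∀ i < t, y i = I.combine (g i) (y (i + 1))) (hy0 : ∀ i, t ≤ i → y i = 0)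
    (hu : ∀ s < I.K, u s = a s + (I.n + 1) * u (s + 1)) (hu0 : ∀ s, I.K ≤ s → u s = y 0)
    (hX : u 0 ≤ X) (hσ : σ.reg 4 = u 0) :
    I.Accept (((decode I.K).eval X σ).mem 1) (((decode I.K).eval X σ).mem 3) := by
  set σ1 := σ.setVar 5 (u 0) with hσ1
  have c1 : Ctx I X σ1.mem σ1.reg := h.upd (by norm_num) _
  have h1 := eval_decodeColumns c1 (fun s _ => hc.a_le s) hu hX (by simp [hσ1, Config.setVar])
  set σ2 := (decodeColumns I.K).eval X σ1 with hσ2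
  have s2 : (decodeColumns I.K).Safe := by
    simp [Safe, decodeColumns, decodeColumn, takeDigit, KeepsVar, KeepsBank]
    omega
  have c2 : Ctx I X σ2.mem σ2.reg := s2.ctx c1
  have h2 := eval_clearLetters (X := X) σ2
  set σ3 := clearLetters.eval X σ2 with hσ3
  have s3 : clearLetters.Safe := by
    simp [Safe, clearLetters, KeepsVar, KeepsBank]
    omega
  have c3 : Ctx I X σ3.mem σ3.reg := s3.ctx c2
  have h31 : σ3.mem 1 = σ2.mem 1 := eval_mem (by simp [clearLetters, KeepsBank]) σ2
  have h35 : σ3.reg 5 = σ2.reg 5 := eval_reg (by simp [clearLetters, KeepsVar]) σ2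
  have hle : ∀ s ≤ I.K, u s ≤ X := by
    intro s hs
    induction s with
    | zero => exact hX
    | succ s ih =>
      have h1 := ih (by omega)
      rw [hu s (by omega)] at h1
      exact le_trans (le_add_mul (Nat.succ_pos _)) h1
  have h3 := eval_decodeRows c3 hc hy hy0 (by rw [← hu0 _ le_rfl]; exact hle _ le_rfl)
    (by rw [h35, h1.1, hu0 _ le_rfl]) (fun s hs => by rw [h31, h1.2 s hs])
    (fun l hl => h2 l (hl.trans_le h.m_le))
  have hdec : (decode I.K).eval X σ = (decodeRows I.K).eval X σ3 := by
    simp only [decode, Stmt.eval, Ex.eval, hσ]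
    rfl
  have h41 : ((decodeRows I.K).eval X σ3).mem 1 = σ3.mem 1 :=
    eval_mem (by simp [decodeRows, step, takeDigit, KeepsBank]) σ3
  rw [hdec, accept_congr (fun s hs => by rw [h41, h31, h1.2 s hs]) h3]
  exact hc.accept

/-- Most codes decode to garbage, which is harmless: the flag is raised only by `accept`, and
acceptance of any data implies solvability. Conversely the flag is never cleared once the code of a
certificate has been met. -/
theorem eval_search {σ : Config} (h : Ctx I X σ.mem σ.reg) (h7 : σ.reg 7 = 0) (hK : 0 < I.K)
    (hp : I.p ≤ I.n) (hX : I.codeBound ≤ X) :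
    ((search I.K).eval X σ).reg 7 ≠ 0 ↔ I.Solvable := by
  classical
  have hstep : ∀ (j : ℕ) (τ : Config), Ctx I X τ.mem τ.reg →
      (∃ τ' : Config, τ' = (decode I.K).eval X (τ.setVar 4 j) ∧ Ctx I X τ'.mem τ'.reg ∧
        (Stmt.seq (decode I.K) (.ite (accept I.K) (.assign 7 (.const 1)) .skip)).eval X
          (τ.setVar 4 j) = if I.Accept (τ'.mem 1) (τ'.mem 3) then τ'.setVar 7 1 else τ') := by
    intro j τ c
    have c1 : Ctx I X (τ.setVar 4 j).mem (τ.setVar 4 j).reg := c.upd (by norm_num) j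
    have c2 := (safe_decode I.K).ctx c1
    refine ⟨_, rfl, c2, ?_⟩
    rw [Stmt.eval, ite_eval, if_congr c2.holds_accept rfl rfl]
    rfl
  have h7' : ∀ τ : Config, ((decode I.K).eval X τ).reg 7 = τ.reg 7 := fun τ => eval_reg (by
    simp [decode, decodeColumns, decodeColumn, clearLetters, decodeRows, step, takeDigit,
      KeepsVar]) τ
  constructor
  · have key := iterate_induction (X := X) (f := fun j (τ : Config) =>
      (Stmt.seq (decode I.K) (.ite (accept I.K) (.assign 7 (.const 1)) .skip)).eval X
        (τ.setVar 4 j)) (x := σ) (fun j (τ : Config) => Ctx I X τ.mem τ.reg ∧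
        (τ.reg 7 ≠ 0 → I.Solvable)) ⟨h, fun h0 => absurd h7 h0⟩ ?_
    · exact key.2
    · rintro j τ hj ⟨c, hs⟩
      obtain ⟨τ', e1, e2, e3⟩ := hstep j τ c
      simp only [e3]
      split_ifs with hacc
      · exact ⟨e2.upd (by norm_num) 1, fun _ => hacc.solvable hK hp⟩
      · refine ⟨e2, fun h0 => hs ?_⟩
        rw [e1, h7'] at h0
        simpa [Config.setVar] using h0
  · intro hsol
    obtain ⟨a, W, V, t, g, hc⟩ := hsol.certificate
    obtain ⟨y, u, hy, hy0, hu, hu0, hlt⟩ := hc.exists_code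
    have hltX : u 0 < X := hlt.trans_le hX
    have key := iterate_induction (X := X) (f := fun j (τ : Config) =>
      (Stmt.seq (decode I.K) (.ite (accept I.K) (.assign 7 (.const 1)) .skip)).eval X
        (τ.setVar 4 j)) (x := σ) (fun j (τ : Config) => Ctx I X τ.mem τ.reg ∧
        (u 0 < j → τ.reg 7 ≠ 0)) ⟨h, fun h0 => absurd h0 (Nat.not_lt_zero _)⟩ ?_
    · exact key.2 hltX
    · rintro j τ hj ⟨c, hs⟩
      obtain ⟨τ', e1, e2, e3⟩ := hstep j τ c
      simp only [e3]
      split_ifs with hacc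
      · exact ⟨e2.upd (by norm_num) 1, fun _ => by simp [Config.setVar]⟩
      · refine ⟨e2, fun h0 => ?_⟩
        rcases Nat.lt_succ_iff_lt_or_eq.1 h0 with h0 | rfl
        · rw [e1, h7']
          simpa [Config.setVar] using hs h0
        · refine absurd ?_ hacc
          rw [e1]
          exact eval_decode (c.upd (by norm_num) _) hc hy hy0 hu hu0 hltX.le
            (by simp [Config.setVar])

end Stmt

end RAM

/-! ### The number of codes is a function of the budget times a polynomial -/

namespace ClusterInstance

/-- The power is at most a rising factorial, that is `B !` times a binomial coefficient with top
`log n + 1 + B`, and this coefficient is at most `2 ^ (log n + 1 + B)`. -/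
theorem pow_log_le (n B : ℕ) (hn : 0 < n) :
    (Nat.log 2 n + 2) ^ B ≤ 2 ^ (B * B + B + 1) * n := by
  calc (Nat.log 2 n + 2) ^ B ≤ (Nat.log 2 n + 2).ascFactorial B :=
        Nat.pow_succ_le_ascFactorial _ B
    _ = B.factorial * (Nat.log 2 n + 1 + B).choose B := Nat.ascFactorial_eq_factorial_mul_choose _ _
    _ ≤ 2 ^ (B * B) * (2 ^ (Nat.log 2 n) * 2 ^ (1 + B)) := by
        gcongr
        · calc B.factorial ≤ B ^ B := Nat.factorial_le_pow B
            _ ≤ (2 ^ B) ^ B := by gcongr; exact Nat.lt_two_pow_self.le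
            _ = 2 ^ (B * B) := by rw [pow_mul]
        · rw [← pow_add, ← add_assoc]
          exact Nat.choose_le_two_pow _ _
    _ ≤ 2 ^ (B * B) * (n * 2 ^ (1 + B)) := by
        gcongr
        exact Nat.pow_log_le_self 2 hn.ne'
    _ = _ := by ring

theorem codeBound_le {I : ClusterInstance} (hn : 0 < I.n) {len : ℕ} (hlen : I.n + 1 ≤ len) :
    I.codeBound ≤ 2 ^ ((2 * I.K + 3) * (I.B + 1) ^ 2) * len ^ (3 * I.K + 1) := by
  have h1 : ((I.K + 1) ^ 2) ^ I.B ≤ 2 ^ (2 * I.K * I.B) := by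
    rw [← pow_mul, show 2 * I.K * I.B = I.K * (2 * I.B) by ring, pow_mul 2]
    gcongr
    exact Nat.lt_two_pow_self
  have h2 : I.B ^ I.B ≤ 2 ^ (I.B * I.B) := by
    rw [pow_mul]
    gcongr
    exact Nat.lt_two_pow_self.le
  have h3 : 2 ^ (2 * I.K * Nat.log 2 I.n) ≤ len ^ (2 * I.K) := by
    rw [mul_comm, pow_mul]
    gcongr
    exact (Nat.pow_log_le_self 2 hn.ne').trans (by omega)
  have h4 := pow_log_le I.n I.B hn
  have h5 : I.n ≤ len := by omega
  calc I.codeBound = (I.n + 1) ^ I.K * (((I.K + 1) ^ 2) ^ I.B * 2 ^ (I.B * I.B) *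
        (Nat.log 2 I.n + 2) ^ I.B * I.B ^ I.B * (2 ^ I.B * 2 ^ (2 * I.K * Nat.log 2 I.n))) := by
        rw [codeBound, pow_add, mul_pow, mul_pow, mul_pow, ← pow_mul 2 I.B I.B]
    _ ≤ len ^ I.K * (2 ^ (2 * I.K * I.B) * 2 ^ (I.B * I.B) * (2 ^ (I.B * I.B + I.B + 1) * len) *
        2 ^ (I.B * I.B) * (2 ^ I.B * len ^ (2 * I.K))) := by
        gcongr
        exact h4.trans (by gcongr)
    _ = 2 ^ (2 * I.K * I.B + I.B * I.B + (I.B * I.B + I.B + 1) + I.B * I.B + I.B) *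
        len ^ (3 * I.K + 1) := by
        simp only [pow_add, show 3 * I.K = 2 * I.K + I.K by ring]
        ring
    _ ≤ _ := by
        gcongr
        · norm_num
        · nlinarith

end ClusterInstance

/-! ### Computation of the limit and assembly of the machine -/

namespace RAM

open ClusterInstance

namespace Stmt

/-- `k` copies of a statement. -/
def rep : ℕ → Stmt → Stmt
  | 0, _ => .skip
  | k + 1, p => .seq (rep k p) p

/-- Write the values of `f` below `N` into the bank `5`. -/
def writeTable (f : ℕ → ℕ) : ℕ → Stmt
  | 0 => .skip
  | N + 1 => .seq (writeTable f N) (.store 5 (.const N) (.const (f N)))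

/-- Write the powers of two into the bank `4`. -/
def writePowers : Stmt := .loop 6 (.store 4 (.var 6) (.ite (.var 6)
  (.add (.load 4 (.sub (.var 6) (.const 1))) (.load 4 (.sub (.var 6) (.const 1)))) (.const 1)))

/-- Read the first four numbers of the input. -/
def readHeader : Stmt :=
  .seq (.assign 0 (.load 0 (.const 0))) <| .seq (.assign 1 (.load 0 (.const 1))) <|
  .seq (.assign 2 (.load 0 (.const 2))) <| .seq (.assign 3 (.load 0 (.const 3))) <|
  .seq (.assign 15 (.add (.var 2) (.const 1))) (.assign 16 (.const 1))

/-- Double the variable `16` often. -/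
def doubling (C : ℕ) : Stmt :=
  .loop 17 (.loop 18 (rep C (.assign 16 (.add (.var 16) (.var 16)))))

/-- Multiply the variable `16` with a power of the variable `14`. -/
def multiplying (c : ℕ) : Stmt := rep c (.assign 16 (.mul (.var 14) (.var 16)))

/-- The main part of the algorithm, for `K` centers and the table `f`. -/
def solve (K : ℕ) (f : ℕ → ℕ) : Stmt :=
  .seq writePowers (.seq (writeTable f (K * K)) (search K))

variable {X : ℕ}

theorem eval_rep {I : ℕ → Config → Prop} {p : Stmt}
    (h : ∀ j σ, I j σ → I (j + 1) (p.eval X σ)) (k : ℕ) {σ : Config} (h0 : I 0 σ) :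
    I k ((rep k p).eval X σ) := by
  induction k with
  | zero => exact h0
  | succ k ih => exact h k _ ih

theorem keepsVar_rep {p : Stmt} {i : ℕ} (h : p.KeepsVar i) (k : ℕ) : (rep k p).KeepsVar i := by
  induction k with
  | zero => trivial
  | succ k ih => exact ⟨ih, h⟩

theorem keepsBank_rep {p : Stmt} {b : ℕ} (h : p.KeepsBank b) (k : ℕ) : (rep k p).KeepsBank b := by
  induction k with
  | zero => trivial
  | succ k ih => exact ⟨ih, h⟩

theorem bd_rep_le {p : Stmt} {D : ℕ} (h : p.bd ≤ D) (k : ℕ) : (rep k p).bd ≤ D := by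
  induction k with
  | zero => exact Nat.zero_le _
  | succ k ih => exact max_le ih h

theorem keepsVar_writeTable (f : ℕ → ℕ) (i N : ℕ) : (writeTable f N).KeepsVar i := by
  induction N with
  | zero => trivial
  | succ k ih => exact ⟨ih, trivial⟩

theorem keepsBank_writeTable (f : ℕ → ℕ) {b : ℕ} (hb : b ≠ 5) (N : ℕ) :
    (writeTable f N).KeepsBank b := by
  induction N with
  | zero => trivial
  | succ k ih => exact ⟨ih, hb⟩

theorem bd_writeTable (f : ℕ → ℕ) (N : ℕ) : (writeTable f N).bd = 0 := by
  induction N with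
  | zero => rfl
  | succ k ih => simp [writeTable, bd, ih, Ex.bd]

theorem eval_writeTable (f : ℕ → ℕ) (N : ℕ) (σ : Config) :
    ((writeTable f N).eval X σ).mem 5 = fun k => if k < N then f k else σ.mem 5 k := by
  induction N with
  | zero => simp [writeTable, Stmt.eval]
  | succ N ih =>
    funext k
    simp only [writeTable, Stmt.eval, Config.setMem, Ex.eval, Function.update_self, ih,
      Function.update_apply]
    split_ifs <;> first | omega | rfl | simp_all

theorem eval_writePowers (σ : Config) : ∀ k < X, (writePowers.eval X σ).mem 4 k = 2 ^ k := by
  refine iterate_induction (X := X) (fun j (τ : Config) => ∀ k < j, τ.mem 4 k = 2 ^ k)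
    (by simp) ?_
  intro j τ hj h k hk
  simp only [Stmt.eval, Config.setMem, Config.setVar, Ex.eval, Function.update_self]
  rcases Nat.lt_succ_iff_lt_or_eq.1 hk with hk | rfl
  · rw [Function.update_of_ne hk.ne, h k hk]
  · rw [Function.update_self]
    cases k with
    | zero => simp
    | succ k => simp [h k (by omega), pow_succ, mul_two]

/-- Executed with the limit `B + 1`, this produces the factor of the search bound that depends on
`B`, by additions only. -/
theorem eval_doubling (C : ℕ) (σ : Config) :
    ((doubling C).eval X σ).reg 16 = 2 ^ (C * X ^ 2) * σ.reg 16 := by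
  have h1 : ∀ τ : Config, ((rep C (.assign 16 (.add (.var 16) (.var 16)))).eval X τ).reg 16 =
      2 ^ C * τ.reg 16 := fun τ =>
    eval_rep (I := fun j τ' => τ'.reg 16 = 2 ^ j * τ.reg 16) (fun j τ' h => by
      simp [Stmt.eval, Config.setVar, Ex.eval, h]; ring) C (by simp)
  have h2 : ∀ τ : Config, ((Stmt.loop 18 (rep C (.assign 16 (.add (.var 16) (.var 16))))).eval
      X τ).reg 16 = 2 ^ (C * X) * τ.reg 16 := fun τ =>
    iterate_induction (X := X) (fun j (τ' : Config) => τ'.reg 16 = 2 ^ (C * j) * τ.reg 16)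
      (by simp) fun j τ' _ h => by
        rw [h1]
        simp [Config.setVar, h, mul_add, pow_add]
        ring
  refine (iterate_induction (X := X) (x := σ)
    (fun j (τ' : Config) => τ'.reg 16 = 2 ^ (C * X * j) * σ.reg 16)
    (by simp) fun j τ' _ h => ?_).trans (by ring)
  rw [h2]
  simp [Config.setVar, h, mul_add, pow_add]
  ring

theorem eval_multiplying (c : ℕ) (σ : Config) (h : σ.reg 14 ≤ X) :
    ((multiplying c).eval X σ).reg 16 = σ.reg 14 ^ c * σ.reg 16 := by
  refine (eval_rep (X := X) (σ := σ) (I := fun j τ => τ.reg 14 = σ.reg 14 ∧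
    τ.reg 16 = σ.reg 14 ^ j * σ.reg 16) (fun j τ ⟨h1, h2⟩ => ?_) c (by simp)).2
  simp only [Stmt.eval, Config.setVar, Ex.eval]
  simp only [Function.update_self, h1, h2, min_eq_left h]
  exact ⟨by simp [h1], by ring⟩

end Stmt

/-- The program for `K` centers and the table `f`. Without any entry of the matrix it accepts at
once. -/
def solver (K : ℕ) (f : ℕ → ℕ) : Program :=
  .seq (.instr (.const 1 4)) <| .seq (.instr (.sub 1 0 1)) <| .branch 1
    (.seq (.instr (.copy 15 0)) <| .seq (Stmt.readHeader.compile 41) <|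
      .seq (.instr (.copy 0 16)) <| .seq ((Stmt.doubling (2 * K + 3)).compile 41) <|
      .seq (.instr (.copy 0 15)) <| .seq ((Stmt.multiplying (3 * K + 1)).compile 41) <|
      .seq (.instr (.copy 0 17)) <| .seq ((Stmt.solve K f).compile 41) (.instr (.copy 0 8)))
    (.instr (.const 0 1))

/-- The number of steps of the solver, up to constants. -/
def limit (K B len : ℕ) : ℕ := 2 ^ ((2 * K + 3) * (B + 1) ^ 2) * len ^ (3 * K + 1)

theorem Represents.copy_limit {D X : ℕ} {σ s : Config} (h : Represents D X σ s) {i : ℕ}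
    (hi : i < D) : Represents D (σ.reg i) σ ((Instr.copy 0 (i + 1)).exec s) := by
  refine ⟨by simp [Instr.exec, h.var i hi], fun k hk => ?_, h.mem⟩
  simp [Instr.exec, h.var k hk]

theorem PolyBounded.uniform {g : ℕ → ℕ} (h : PolyBounded g) :
    ∃ C k, ∀ Y, ∀ X ≤ Y, g X ≤ C * (Y + 1) ^ k := by
  obtain ⟨C, k, h⟩ := h
  exact ⟨C, k, fun Y X hX => (h X).trans (by gcongr)⟩

/-- These bounds let the loops reach all rows, columns, centers and steps, as `Ctx` requires. The
factor `2` makes `n + 1 < X` strict. -/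
theorem le_limit (K B : ℕ) {len : ℕ} (h : 0 < len) :
    2 * len ≤ limit K B len ∧ K < limit K B len ∧ B < limit K B len := by
  have h1 : len ≤ len ^ (3 * K + 1) := Nat.le_self_pow (by omega) _
  have h2 : 2 * K + 3 + B ≤ (2 * K + 3) * (B + 1) ^ 2 := by
    have := Nat.mul_le_mul_left (2 * K + 3) (Nat.le_self_pow two_ne_zero (B + 1))
    nlinarith [Nat.zero_le (K * B)]
  have h3 := (Nat.lt_two_pow_self (n := 2 * K + 3 + B)).trans_le
    (Nat.pow_le_pow_right (n := 2) (by norm_num) h2)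
  have h4 : 1 ≤ len ^ (3 * K + 1) := Nat.one_le_pow _ _ h
  unfold limit
  set a := 2 ^ ((2 * K + 3) * (B + 1) ^ 2)
  have h5 : 1 * len ≤ 1 * len ^ (3 * K + 1) := by omega
  have h6 := Nat.mul_le_mul_left a h4
  refine ⟨Nat.mul_le_mul (by omega) h1, by omega, by omega⟩

/-- The clustering instance that is given by an input word. -/
def wordInstance (K : ℕ) (f : ℕ → ℕ) (w : List ℕ) : ClusterInstance where
  K := K
  m := w.getD 0 0
  n := w.getD 1 0
  B := w.getD 2 0
  p := w.getD 1 0 - w.getD 3 0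
  A l j := w.getD (4 + (w.getD 1 0 * l + j)) 0
  T a s := if K * a + s < K * K then f (K * a + s) else 0

-- Variable `i` lives in register `i + 1`. The copies into register `0` set the limit to `B + 1`
-- (variable `15`), to the length of the input (variable `14`) and to the search bound `X` (variable
-- `16`), after a first phase whose limit is the length. All these limits are at most `X`, so the
-- total time is polynomial in `X`.
open Stmt in
theorem solver_halts {K : ℕ} (hK : 0 < K) (f : ℕ → ℕ) : ∃ C k, ∀ w : List ℕ, 4 < w.length →
    w.getD 0 0 ≤ w.length → 0 < w.getD 1 0 → w.getD 1 0 + 1 ≤ w.length →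
    Halts (solver K f) (initial w) (C * (limit K (w.getD 2 0) w.length + 1) ^ k)
      fun s => s.reg 0 ≠ 0 ↔ (wordInstance K f w).Solvable := by
  obtain ⟨C1, k1, hC1⟩ := readHeader.cost_polyBounded.uniform
  obtain ⟨C2, k2, hC2⟩ := (doubling (2 * K + 3)).cost_polyBounded.uniform
  obtain ⟨C3, k3, hC3⟩ := (multiplying (3 * K + 1)).cost_polyBounded.uniform
  obtain ⟨C4, k4, hC4⟩ := (solve K f).cost_polyBounded.uniform
  have hpoly : ∀ C k, PolyBounded fun X => C * (X + 1) ^ k := fun C k => ⟨C, k, fun _ => le_rfl⟩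
  obtain ⟨C, k, hC⟩ := ((((hpoly C1 k1).add (hpoly C2 k2)).add (hpoly C3 k3)).add
    (hpoly C4 k4)).add (.const 8)
  refine ⟨C, k, fun w hlen hm hn hn' => ?_⟩
  set B := w.getD 2 0 with hB
  set X := limit K B w.length with hX
  obtain ⟨l1, l2, l3⟩ := le_limit K B (len := w.length) (by omega)
  rw [← hX] at l1 l2 l3
  refine Halts.mono (T := 1 + 1 + (1 + (C1 * (X + 1) ^ k1 + (1 + (C2 * (X + 1) ^ k2 +
    (1 + (C3 * (X + 1) ^ k3 + (1 + (C4 * (X + 1) ^ k4 + 1)))))))) + 1) ?_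
    (by have := hC X; dsimp only at this; omega) fun _ h => h
  rw [show ∀ a : ℕ, 1 + 1 + a + 1 = a + 1 + 1 + 1 by omega]
  refine .instr_seq (.instr_seq (.branch (fun _ => ?_) fun h => ?_))
  swap
  · simp [Instr.exec, initial] at h
    omega
  set s0 := (Instr.sub 1 0 1).exec ((Instr.const 1 4).exec (initial w)) with hs0
  refine Halts.seq (R := fun s => Represents 40 w.length
    ⟨fun i => s.reg (i + 1), (initial w).mem⟩ s ∧ s.reg 15 = w.length ∧ s.reg 8 = 0) (.instr ?_) ?_
  · refine ⟨⟨?_, fun _ _ => rfl, ?_⟩, ?_, ?_⟩ <;> simp [Instr.exec, hs0, initial]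
  rintro s ⟨hs, hs15, hs8⟩
  set σ0 : Config := ⟨fun i => s.reg (i + 1), (initial w).mem⟩ with hσ0
  refine Halts.seq ((readHeader.halts 41 σ0 s (by simp [readHeader, Stmt.bd, Ex.bd])
    (by norm_num) hs).mono (hC1 X _ (by omega)) fun _ h => h) ?_
  rintro s1 ⟨h1, -⟩
  set σ1 := readHeader.eval w.length σ0 with hσ1
  have m0 : ∀ k, (initial w).mem 0 k = w.getD k 0 := fun k => by simp [initial]
  have r1 : σ1.mem = (initial w).mem ∧ σ1.reg 0 = w.getD 0 0 ∧ σ1.reg 1 = w.getD 1 0 ∧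
      σ1.reg 2 = B ∧ σ1.reg 3 = w.getD 3 0 ∧ σ1.reg 14 = w.length ∧ σ1.reg 15 = B + 1 ∧
      σ1.reg 16 = 1 := by
    have h14 : σ0.reg 14 = w.length := hs15
    have hm0 : σ0.mem = (initial w).mem := rfl
    simp only [hσ1, readHeader, Stmt.eval, Ex.eval, Config.setVar, hm0, m0]
    simp [h14, hB]
  obtain ⟨m1, a0, a1, a2, a3, a14, a15, a16⟩ := r1
  refine Halts.seq (.instr (h1.copy_limit (i := 15) (by norm_num))) fun s2 h2 => ?_
  rw [a15] at h2
  have keep2 : ∀ i, i ≠ 16 → i ≠ 17 → i ≠ 18 → (doubling (2 * K + 3)).KeepsVar i :=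
    fun i h h' h'' => ⟨h', h'', keepsVar_rep (p := .assign 16 _) h _⟩
  refine Halts.seq (((doubling (2 * K + 3)).halts 41 σ1 s2 (by
    simp only [doubling, Stmt.bd, max_le_iff]
    exact ⟨by norm_num, by norm_num, bd_rep_le (by simp [Stmt.bd, Ex.bd]) _⟩) (by norm_num)
    h2).mono (hC2 X _ (by omega)) fun _ h => h) ?_
  rintro s3 ⟨h3, -⟩
  set σ2 := (doubling (2 * K + 3)).eval (B + 1) σ1 with hσ2
  have e2 : ∀ i, i ≠ 16 → i ≠ 17 → i ≠ 18 → σ2.reg i = σ1.reg i := fun i h h' h'' =>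
    eval_reg (keep2 i h h' h'') σ1
  have m2 : ∀ b, σ2.mem b = σ1.mem b := fun b => eval_mem (p := doubling _)
    (keepsBank_rep (p := .assign 16 _) trivial _) σ1
  have b16 : σ2.reg 16 = 2 ^ ((2 * K + 3) * (B + 1) ^ 2) := by
    rw [hσ2, eval_doubling, a16, mul_one]
  refine Halts.seq (.instr (h3.copy_limit (i := 14) (by norm_num))) fun s4 h4 => ?_
  have b14 : σ2.reg 14 = w.length := by rw [e2 14 (by norm_num) (by norm_num) (by norm_num), a14]
  rw [b14] at h4
  refine Halts.seq (((multiplying (3 * K + 1)).halts 41 σ2 s4 (bd_rep_le (by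
    simp [Stmt.bd, Ex.bd]) _) (by norm_num) h4).mono (hC3 X _ (by omega)) fun _ h => h) ?_
  rintro s5 ⟨h5, -⟩
  set σ3 := (multiplying (3 * K + 1)).eval w.length σ2 with hσ3
  have e3 : ∀ i, i ≠ 16 → σ3.reg i = σ2.reg i := fun i h => eval_reg (p := multiplying _)
    (keepsVar_rep (p := .assign 16 _) h _) σ2
  have m3 : ∀ b, σ3.mem b = σ2.mem b := fun b => eval_mem (p := multiplying _)
    (keepsBank_rep (p := .assign 16 _) trivial _) σ2
  have c16 : σ3.reg 16 = X := by
    rw [hσ3, eval_multiplying _ _ b14.le, b14, b16, hX, limit, mul_comm]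
  refine Halts.seq (.instr (h5.copy_limit (i := 16) (by norm_num))) fun s6 h6 => ?_
  rw [c16] at h6
  have hkeep : ∀ i, i ≠ 0 → i ≠ 1 → i ≠ 2 → i ≠ 3 → i ≠ 15 → i ≠ 16 → readHeader.KeepsVar i :=
    fun i g0 g1 g2 g3 g4 g5 => ⟨g0, g1, g2, g3, g4, g5⟩
  have c7 : σ3.reg 7 = 0 := by
    rw [e3 7 (by norm_num), e2 7 (by norm_num) (by norm_num) (by norm_num), hσ1,
      eval_reg (hkeep 7 (by norm_num) (by norm_num) (by norm_num) (by norm_num) (by norm_num)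
        (by norm_num))]
    exact hs8
  have hreg : ∀ i, i < 4 → σ3.reg i = σ1.reg i := fun i hi => by
    rw [e3 i (by omega), e2 i (by omega) (by omega) (by omega)]
  have hmem : ∀ b, σ3.mem b = (initial w).mem b := fun b => by rw [m3, m2, m1]
  refine Halts.seq (((solve K f).halts 41 σ3 s6 ?_ (by norm_num) h6).mono (hC4 X _ le_rfl)
    fun _ h => h) ?_
  · simp [solve, Stmt.bd, bd_writeTable, writePowers, search, decode, decodeColumns, decodeColumn,
      clearLetters, decodeRows, step, takeDigit, Ex.bd, Ex.accept, Ex.all, Ex.cnt, Ex.near,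
      Ex.center, Ex.consistent, Ex.table, Ex.entry, Ex.select, Ex.candidate, Ex.deg, Ex.degWith,
      Ex.inDeg, Ex.close, Ex.logBase, Ex.mod, Ex.ne, Ex.eq, Ex.lt, Ex.le, Ex.not, Ex.and, Ex.or]
  rintro s7 ⟨h7, -⟩
  refine .instr ?_
  set σ4 := (writeTable f (K * K)).eval X (writePowers.eval X σ3) with hσ4
  have hsolve : (solve K f).eval X σ3 = (search K).eval X σ4 := rfl
  have keepP : ∀ i, i ≠ 6 → writePowers.KeepsVar i := fun i h => ⟨h, trivial⟩
  have hreg4 : ∀ i, i ≠ 6 → σ4.reg i = σ3.reg i := fun i h => by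
    rw [hσ4, eval_reg (keepsVar_writeTable f i _), eval_reg (keepP i h)]
  have hmem4 : ∀ b, b ≠ 4 → b ≠ 5 → σ4.mem b = (initial w).mem b := fun b hb hb' => by
    rw [hσ4, eval_mem (keepsBank_writeTable f hb' _), eval_mem (p := writePowers) hb, hmem]
  have hctx : Ctx (wordInstance K f w) X σ4.mem σ4.reg := by
    refine ⟨?_, ?_, ?_, ?_, ?_, ?_, hn, l3, l2, fun l j => ?_, fun a b => ?_, fun k hk => ?_⟩
    · rw [hreg4 0 (by norm_num), hreg 0 (by norm_num), a0]; rfl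
    · rw [hreg4 1 (by norm_num), hreg 1 (by norm_num), a1]; rfl
    · rw [hreg4 2 (by norm_num), hreg 2 (by norm_num), a2]; rfl
    · rw [hreg4 1 (by norm_num), hreg4 3 (by norm_num), hreg 1 (by norm_num),
        hreg 3 (by norm_num), a1, a3]; rfl
    · change w.getD 0 0 ≤ X
      omega
    · change w.getD 1 0 + 1 < X
      omega
    · rw [hmem4 0 (by norm_num) (by norm_num), m0]; rfl
    · rw [hσ4, eval_writeTable, eval_mem (p := writePowers) (show 5 ≠ 4 by norm_num), hmem]
      simp [wordInstance, initial]
    · rw [hσ4, eval_mem (keepsBank_writeTable f (by norm_num) _), eval_writePowers σ3 k hk]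
  have hbound : (wordInstance K f w).codeBound ≤ X := codeBound_le hn hn'
  have hfin := eval_search hctx (by rw [hreg4 7 (by norm_num), c7]) hK (Nat.sub_le _ _) hbound
  have hval := h7.var 7 (by norm_num)
  rw [hsolve] at hval
  simp only [Instr.exec, Function.update_self, hval]
  exact hfin

end RAM

/-! ### From Boolean rank to clustering -/

open ClusterInstance Finset

/-- Two sets of numbers, given by their binary digits below `r`, intersect. -/
def bitsMeet (r w s : ℕ) : ℕ := if ∃ k < r, w.testBit k ∧ s.testBit k then 1 else 0

/-- The table of `bitsMeet` in row-major order. -/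
def bitsMeetTable (r k : ℕ) : ℕ := bitsMeet r (k / 2 ^ r) (k % 2 ^ r)

/-- The rows of the left factor and the columns of the right factor are read as bit vectors. A
factorization of smaller inner dimension is padded with zero bits. -/
theorem boolRank_le_iff {m n r : ℕ} {M : Matrix (Fin m) (Fin n) Bool} : boolRank M ≤ r ↔
    ∃ (w : Fin m → ℕ) (s : Fin n → ℕ), (∀ i, w i < 2 ^ r) ∧ (∀ j, s j < 2 ^ r) ∧
      ∀ i j, M i j = decide (bitsMeet r (w i) (s j) = 1) := by
  constructor
  · intro h
    have hne : {r | ∃ (U : Matrix (Fin m) (Fin r) Bool) (V : Matrix (Fin r) (Fin n) Bool),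
        M = boolMul U V}.Nonempty := by
      -- Multiplication with the identity. Without some factorization the infimum would be `0` by
      -- convention and would not be attained.
      refine ⟨n, M, fun k j => decide (k = j), ?_⟩
      ext i j
      simp [boolMul]
    obtain ⟨U, V, hM⟩ := Nat.sInf_mem hne
    change boolRank M ≤ r at h
    change Matrix (Fin m) (Fin (boolRank M)) Bool at U
    change Matrix (Fin (boolRank M)) (Fin n) Bool at V
    refine ⟨fun i => Nat.ofBits (U i), fun j => Nat.ofBits fun k => V k j, fun i => ?_,
      fun j => ?_, fun i j => ?_⟩
    · exact (Nat.ofBits_lt_two_pow _).trans_le (Nat.pow_le_pow_right (by norm_num) h)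
    · exact (Nat.ofBits_lt_two_pow _).trans_le (Nat.pow_le_pow_right (by norm_num) h)
    · have : (∃ k, (U i k && V k j) = true) ↔ ∃ k < r, (Nat.ofBits (U i)).testBit k = true ∧
          (Nat.ofBits fun k => V k j).testBit k = true := by
        constructor
        · rintro ⟨k, hk⟩
          rw [Bool.and_eq_true] at hk
          refine ⟨k, k.2.trans_le h, ?_⟩
          rw [Nat.testBit_ofBits_lt _ _ k.2, Nat.testBit_ofBits_lt _ _ k.2]
          exact hk
        · rintro ⟨k, -, h1, h2⟩
          by_cases hk : k < boolRank M
          · rw [Nat.testBit_ofBits_lt _ _ hk] at h1 h2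
            exact ⟨⟨k, hk⟩, by rw [h1, h2]; rfl⟩
          · rw [Nat.testBit_ofBits_ge _ _ (not_lt.1 hk)] at h1
            exact absurd h1 (by simp)
      have hMij : M i j = decide (∃ k, (U i k && V k j) = true) := congrFun (congrFun hM i) j
      rw [hMij, decide_eq_decide, this, bitsMeet]
      split_ifs <;> simp_all
  · rintro ⟨w, s, -, -, h⟩
    refine Nat.sInf_le ⟨fun i k => (w i).testBit k, fun k j => (s j).testBit k, ?_⟩
    ext i j
    have : (∃ k < r, (w i).testBit k = true ∧ (s j).testBit k = true) ↔
        ∃ k : Fin r, ((w i).testBit k && (s j).testBit k) = true := by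
      constructor
      · rintro ⟨k, hk, h1, h2⟩
        exact ⟨⟨k, hk⟩, by simp [h1, h2]⟩
      · rintro ⟨k, hk⟩
        rw [Bool.and_eq_true] at hk
        exact ⟨k, k.2, hk⟩
    change M i j = decide (∃ k : Fin r, ((w i).testBit k && (s j).testBit k) = true)
    rw [h, decide_eq_decide, ← this, bitsMeet]
    split_ifs <;> simp_all

theorem count_eq_card_fin (m : ℕ) (P : ℕ → Prop) [∀ i : Fin m, Decidable (P i)] :
    count m P = #{i : Fin m | P i} := by
  simp only [count, card_filter]
  rw [sum_range]
  exact sum_congr rfl fun i _ => by congr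

theorem binToInt_ne_zero_iff {m n : ℕ} {M : Matrix (Fin m) (Fin n) Bool} {i j} :
    binToInt M i j ≠ 0 ↔ M i j = true := by
  simp [binToInt]

theorem l0norm_eq_sum {m n : ℕ} (M : Matrix (Fin m) (Fin n) ℤ) :
    l0norm M = ∑ j, #{i | M i j ≠ 0} := by
  simp only [l0norm, card_filter]
  rw [Fintype.sum_prod_type_right]

namespace BoolApproxInstance

variable (x : BoolApproxInstance)

theorem length_encode : x.encode.length = 4 + x.m * x.n := by
  simp [encode, Function.comp_def]
  omega

theorem getD_encode_entry {l j : ℕ} (hl : l < x.m) (hj : j < x.n) :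
    x.encode.getD (4 + (x.n * l + j)) 0 = if x.A ⟨l, hl⟩ ⟨j, hj⟩ then 1 else 0 := by
  have hlt : l * x.n + j < x.m * x.n := by
    calc l * x.n + j < l * x.n + x.n := by omega
      _ = (l + 1) * x.n := by ring
      _ ≤ x.m * x.n := Nat.mul_le_mul_right _ hl
  have hflat : (List.ofFn fun i => List.ofFn fun j => if x.A i j then 1 else 0).flatten =
      List.ofFn fun k : Fin (x.m * x.n) => if x.A k.divNat k.modNat then 1 else 0 := by
    rw [List.ofFn_mul]
    congr 2
    funext i
    congr 1
    funext j
    have h1 : (⟨(i : ℕ) * x.n + j, by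
        calc (i : ℕ) * x.n + j < (i + 1) * x.n := by rw [Nat.succ_mul]; omega
          _ ≤ x.m * x.n := Nat.mul_le_mul_right _ i.2⟩ : Fin (x.m * x.n)) =
        finProdFinEquiv (i, j) := by
      ext
      simp [finProdFinEquiv]
      ring
    have h2 : (finProdFinEquiv (i, j)).divNat = i := congrArg Prod.fst
      (finProdFinEquiv.symm_apply_apply (i, j))
    have h3 : (finProdFinEquiv (i, j)).modNat = j := congrArg Prod.snd
      (finProdFinEquiv.symm_apply_apply (i, j))
    rw [h1, h2, h3]
  have hget : x.encode.getD (4 + (x.n * l + j)) 0 =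
      (List.ofFn fun k : Fin (x.m * x.n) => if x.A k.divNat k.modNat then 1 else 0).getD
        (l * x.n + j) 0 := by
    rw [encode, hflat, List.getD_append_right _ _ _ _ (by simp), mul_comm x.n]
    simp
  rw [hget, List.getD_eq_getElem _ _ (by simpa using hlt), List.getElem_ofFn]
  have h2 : (⟨l * x.n + j, hlt⟩ : Fin (x.m * x.n)).divNat = ⟨l, hl⟩ := by
    ext
    rw [Fin.coe_divNat]
    change (l * x.n + j) / x.n = l
    rw [mul_comm, Nat.mul_add_div (by omega), Nat.div_eq_of_lt hj, add_zero]
  have h3 : (⟨l * x.n + j, hlt⟩ : Fin (x.m * x.n)).modNat = ⟨j, hj⟩ := by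
    ext
    rw [Fin.coe_modNat]
    change (l * x.n + j) % x.n = j
    rw [Nat.mul_add_mod_self_right, Nat.mod_eq_of_lt hj]
  simp only [h2, h3]

/-- The clustering instance for the rank bound `r`. -/
def toCluster (r : ℕ) : ClusterInstance :=
  RAM.wordInstance (2 ^ r) (bitsMeetTable r) x.encode

theorem toCluster_T {r w s : ℕ} (hw : w < 2 ^ r) (hs : s < 2 ^ r) :
    (x.toCluster r).T w s = bitsMeet r w s := by
  have hlt : 2 ^ r * w + s < 2 ^ r * 2 ^ r := by
    calc 2 ^ r * w + s < 2 ^ r * w + 2 ^ r := by omega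
      _ = 2 ^ r * (w + 1) := by ring
      _ ≤ _ := Nat.mul_le_mul_left _ hw
  change (if _ then _ else _) = _
  rw [if_pos hlt, bitsMeetTable, Nat.mul_add_div (by positivity), Nat.div_eq_of_lt hs, add_zero,
    Nat.mul_add_mod, Nat.mod_eq_of_lt hs]

theorem toCluster_dist {r : ℕ} {w : ℕ → ℕ} {s : ℕ} (hw : ∀ l < x.m, w l < 2 ^ r)
    (hs : s < 2 ^ r) (j : Fin x.n) :
    (x.toCluster r).dist w s j = #{i : Fin x.m | x.A i j ≠ decide (bitsMeet r (w i) s = 1)} := by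
  classical
  change count x.m _ = _
  rw [count_eq_card_fin]
  congr 1
  ext i
  simp only [mem_filter, mem_univ, true_and]
  rw [x.toCluster_T (hw i i.2) hs]
  change x.encode.getD (4 + (x.n * i + j)) 0 ≠ _ ↔ _
  rw [x.getD_encode_entry i.2 j.2]
  have : bitsMeet r (w i) s = 0 ∨ bitsMeet r (w i) s = 1 := by
    unfold bitsMeet
    split_ifs <;> simp
  rcases this with h | h <;> rw [h] <;> cases x.A i j <;> simp

/-- The covered columns are those where `C` vanishes; there the residual counts the distance to the
center. -/
theorem mem_robustLowBoolRankApprox_iff (r : ℕ) :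
    x ∈ robustLowBoolRankApprox r ↔ (x.toCluster r).Solvable := by
  have hentry : ∀ (M C : Matrix (Fin x.m) (Fin x.n) Bool) i j,
      (binToInt x.A - binToInt M - binToInt C) i j =
        (if x.A i j then 1 else 0) - (if M i j then 1 else 0) - (if C i j then 1 else 0) :=
    fun M C i j => rfl
  constructor
  · rintro ⟨M, C, hM, hC, hB⟩
    obtain ⟨w, s, hw, hs, hws⟩ := boolRank_le_iff.1 hM
    set N : Finset (Fin x.n) := {j | ¬ ∃ i, binToInt C i j ≠ 0} with hN
    have hNcard : x.n - x.ℓ ≤ N.card := by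
      have hsum : nonzeroColumns (binToInt C) + N.card = x.n := by
        rw [nonzeroColumns, hN]
        convert card_filter_add_card_filter_not (s := (univ : Finset (Fin x.n)))
          (fun j => ∃ i, binToInt C i j ≠ 0)
        simp
      omega
    let w' : ℕ → ℕ := fun l => if h : l < x.m then w ⟨l, h⟩ else 0
    let σ : ℕ → ℕ := fun j => if h : j < x.n then s ⟨j, h⟩ else 0
    have hw' : ∀ i : Fin x.m, w' i = w i := fun i => by simp [w']
    have hσ : ∀ j : Fin x.n, σ j = s j := fun j => by simp [σ]
    have hwlt : ∀ l < x.m, w' l < 2 ^ r := fun l hl => by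
      simpa [w', hl] using hw ⟨l, hl⟩
    refine ⟨w', hwlt, N.map Fin.valEmbedding, fun j hj => ?_, σ, fun j hj => ?_, ?_, ?_⟩
    · obtain ⟨k, -, rfl⟩ := mem_map.1 hj
      exact mem_range.2 k.2
    · obtain ⟨k, -, rfl⟩ := mem_map.1 hj
      exact (hσ k).trans_lt (hs k)
    · rw [card_map]
      exact hNcard
    · rw [sum_map]
      change _ ≤ x.B
      refine le_trans ?_ hB
      rw [l0norm_eq_sum]
      refine le_trans (sum_le_sum fun j hj => le_of_eq ?_) (sum_le_sum_of_subset (subset_univ N))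
      change (x.toCluster r).dist w' (σ j) j = _
      rw [hσ, x.toCluster_dist hwlt (hs j)]
      congr 1
      ext i
      simp only [mem_filter, mem_univ, true_and]
      have hCij : C i j = false := by
        have := (mem_filter.1 hj).2
        rw [not_exists] at this
        have := this i
        rw [not_not, ← not_ne_iff, binToInt_ne_zero_iff] at this
        simpa using this
      rw [hentry, hCij, hw', ← hws]
      cases x.A i j <;> cases M i j <;> simp
  · rintro ⟨w, hw, N, hN, σ, hσ, hp, hB⟩
    -- In an uncovered column, `C` copies `A` and the empty set as center makes `M` zero, so that
    -- the residual vanishes.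
    let s : Fin x.n → ℕ := fun j => if (j : ℕ) ∈ N then σ j else 0
    let M : Matrix (Fin x.m) (Fin x.n) Bool := fun i j => decide (bitsMeet r (w i) (s j) = 1)
    let C : Matrix (Fin x.m) (Fin x.n) Bool := fun i j => decide ((j : ℕ) ∉ N) && x.A i j
    refine ⟨M, C, boolRank_le_iff.2 ⟨fun i => w i, s, fun i => hw i i.2, fun j => ?_,
      fun i j => rfl⟩, ?_, ?_⟩
    · by_cases hj : (j : ℕ) ∈ N
      · simp only [s, if_pos hj]
        exact hσ j hj
      · simp [s, hj]
    · have hsub : ({j : Fin x.n | ∃ i, binToInt C i j ≠ 0} : Finset (Fin x.n)) ⊆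
          ({j : Fin x.n | (j : ℕ) ∉ N} : Finset (Fin x.n)) := by
        intro j hj
        simp only [mem_filter, mem_univ, true_and] at hj ⊢
        obtain ⟨i, hi⟩ := hj
        intro hjN
        rw [binToInt_ne_zero_iff] at hi
        simp [C, hjN] at hi
      refine (card_le_card hsub).trans ?_
      have h1 := card_filter_add_card_filter_not (s := (univ : Finset (Fin x.n)))
        (fun j => (j : ℕ) ∈ N)
      rw [card_univ, Fintype.card_fin] at h1
      have h2 : N.card ≤ #{j : Fin x.n | (j : ℕ) ∈ N} := by
        rw [← card_map Fin.valEmbedding]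
        refine card_le_card fun j hj => mem_map.2 ⟨⟨j, mem_range.1 (hN hj)⟩, by simpa, rfl⟩
      change x.n - x.ℓ ≤ N.card at hp
      omega
    · change _ ≤ x.B at hB
      refine le_trans (le_of_eq ?_) hB
      have hcol : ∀ j : Fin x.n, #{i | (binToInt x.A - binToInt M - binToInt C) i j ≠ 0} =
          if (j : ℕ) ∈ N then (x.toCluster r).dist w (σ j) j else 0 := by
        intro j
        by_cases hj : (j : ℕ) ∈ N
        · rw [if_pos hj, x.toCluster_dist hw (hσ j hj)]
          congr 1
          ext i
          simp only [mem_filter, mem_univ, true_and]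
          have hMij : M i j = decide (bitsMeet r (w i) (σ j) = 1) := by simp only [M, s, if_pos hj]
          have hCij : C i j = false := by simp [C, hj]
          rw [hentry, hCij, ← hMij]
          cases x.A i j <;> cases M i j <;> simp
        · rw [if_neg hj, card_eq_zero, filter_eq_empty_iff]
          intro i _
          have hMij : M i j = false := by simp [M, s, hj, bitsMeet]
          have hCij : C i j = x.A i j := by simp [C, hj]
          rw [hentry, hCij, hMij]
          simp
      rw [l0norm_eq_sum, sum_congr rfl fun j _ => hcol j,
        ← sum_range (n := x.n) (fun j => if j ∈ N then (x.toCluster r).dist w (σ j) j else 0),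
        sum_ite_mem, inter_eq_right.2 (show N ⊆ range x.n from hN)]

end BoolApproxInstance

/-! ### The time bound and the conclusion -/

theorem RAM.length_le_inputSize (w : List ℕ) : w.length ≤ RAM.inputSize w := by
  induction w with
  | nil => simp [RAM.inputSize]
  | cons a w ih =>
    simp only [RAM.inputSize, List.map_cons, List.sum_cons, List.length_cons] at ih ⊢
    omega

theorem primrec_pow : Primrec₂ ((· ^ ·) : ℕ → ℕ → ℕ) :=
  Primrec₂.unpaired'.1 Nat.Primrec.pow

theorem computable_timeBound (C c e : ℕ) :
    Computable fun B : ℕ => C * (2 ^ (c * (B + 1) ^ 2)) ^ e + 4 := by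
  refine Primrec.to_comp ?_
  have h1 : Primrec fun B : ℕ => c * (B + 1) ^ 2 :=
    Primrec.nat_mul.comp (Primrec.const c) (primrec_pow.comp Primrec.succ (Primrec.const 2))
  have h2 : Primrec fun B : ℕ => (2 ^ (c * (B + 1) ^ 2)) ^ e :=
    primrec_pow.comp (primrec_pow.comp (Primrec.const 2) h1) (Primrec.const e)
  exact Primrec.nat_add.comp (Primrec.nat_mul.comp (Primrec.const C) h2) (Primrec.const 4)

theorem RAM.solver_halts_of_length_le {K : ℕ} (f : ℕ → ℕ) {w : List ℕ} (h : w.length ≤ 4) :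
    RAM.Halts (RAM.solver K f) (RAM.initial w) 4 fun s => s.reg 0 ≠ 0 := by
  refine .instr_seq (.instr_seq (.branch (T := 1) (fun h0 => ?_) fun _ => ?_))
  · simp [RAM.Instr.exec, RAM.initial] at h0
    omega
  · exact .instr (by simp [RAM.Instr.exec])

theorem BoolApproxInstance.mem_of_mul_eq_zero {x : BoolApproxInstance} {r : ℕ}
    (h : x.m * x.n = 0) : x ∈ robustLowBoolRankApprox r := by
  have : IsEmpty (Fin x.m × Fin x.n) := by
    rcases Nat.mul_eq_zero.1 h with h | h <;> rw [h] <;> infer_instance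
  refine ⟨fun _ _ => false, fun _ _ => false, boolRank_le_iff.2 ⟨fun _ => 0, fun _ => 0,
    fun _ => by positivity, fun _ => by positivity, fun i j => isEmptyElim (i, j)⟩, ?_, ?_⟩
  · rw [nonzeroColumns, filter_false_of_mem fun j _ ⟨i, _⟩ => isEmptyElim (i, j)]
    exact Nat.zero_le _
  · simp [l0norm]

theorem theorem5 (r : ℕ) (hr : 0 < r) :
    FixedParameterTractable BoolApproxInstance.encode (fun x => x.B)
      (robustLowBoolRankApprox r) := by
  obtain ⟨C, k, h⟩ := RAM.solver_halts (K := 2 ^ r) (by positivity) (bitsMeetTable r)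
  -- The factor `2 ^ k` comes from `limit + 1 ≤ 2 * limit`, and the summand `4` in the time bound
  -- pays for the run on an empty matrix.
  refine ⟨RAM.solver (2 ^ r) (bitsMeetTable r), _, (3 * 2 ^ r + 1) * k,
    computable_timeBound (C * 2 ^ k) (2 * 2 ^ r + 3) k, fun x => ?_⟩
  have hsize := RAM.length_le_inputSize x.encode
  have hlen := x.length_encode
  set S := RAM.inputSize x.encode with hS
  have hpos : 1 ≤ S ^ ((3 * 2 ^ r + 1) * k) := Nat.one_le_pow _ _ (by omega)
  -- An empty matrix is always a yes-instance. It is treated separately because its other dimension,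
  -- written in binary, is not bounded by the length of the input.
  rcases Nat.eq_zero_or_pos (x.m * x.n) with h0 | h0
  · obtain ⟨t, s, h1, h2, h3⟩ := RAM.solver_halts_of_length_le (K := 2 ^ r) (bitsMeetTable r)
      (w := x.encode) (by omega)
    refine ⟨t, s, h1, h2.trans ?_, iff_of_true h3 (x.mem_of_mul_eq_zero h0)⟩
    exact Nat.le_trans (Nat.le_mul_of_pos_right 4 hpos)
      (Nat.mul_le_mul_right _ (Nat.le_add_left 4 _))
  · have hm : 0 < x.m := Nat.pos_of_mul_pos_right h0
    have hn : 0 < x.n := Nat.pos_of_mul_pos_left h0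
    have hmn : x.m ≤ x.m * x.n := Nat.le_mul_of_pos_right _ hn
    have hnm : x.n ≤ x.m * x.n := Nat.le_mul_of_pos_left _ hm
    have g0 : x.encode.getD 0 0 = x.m := rfl
    have g1 : x.encode.getD 1 0 = x.n := rfl
    have g2 : x.encode.getD 2 0 = x.B := rfl
    obtain ⟨t, s, h1, h2, h3⟩ := h x.encode (by omega) (by rw [g0]; omega) (by rw [g1]; omega)
      (by rw [g1]; omega)
    refine ⟨t, s, h1, h2.trans ?_, h3.trans (x.mem_robustLowBoolRankApprox_iff r).symm⟩
    rw [g2]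
    set a := 2 ^ ((2 * 2 ^ r + 3) * (x.B + 1) ^ 2)
    have ha : 1 ≤ RAM.limit (2 ^ r) x.B x.encode.length := by
      have := (RAM.le_limit (2 ^ r) x.B (len := x.encode.length) (by omega)).2.1
      exact (Nat.zero_le _).trans_lt this
    calc C * (RAM.limit (2 ^ r) x.B x.encode.length + 1) ^ k
        ≤ C * (2 * RAM.limit (2 ^ r) x.B x.encode.length) ^ k :=
          Nat.mul_le_mul_left _ (Nat.pow_le_pow_left (by omega) _)
      _ ≤ C * (2 * (a * S ^ (3 * 2 ^ r + 1))) ^ k := by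
          unfold RAM.limit
          gcongr
      _ = C * 2 ^ k * a ^ k * S ^ ((3 * 2 ^ r + 1) * k) := by
          rw [mul_pow, mul_pow, ← pow_mul]
          ring
      _ ≤ _ := by
          exact Nat.mul_le_mul_right _ (Nat.le_add_right _ _)
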